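/- **Theorem (Universality for multilinear polynomials).** Fix $\nu\in(2,3]$. There is a constant $C>0$, depending on nothing but (possibly) $\nu$, such that the following holds for all $n,m,d\in\mathbb N$. Let $X_1,\dots,X_n$ be independent random vectors in $\mathbb R^d$ with finite second moments, not necessarily identically distributed and with arbitrary dependence between the coordinates of each $X_i$. Let $Z_1,\dots,Z_n$ be independent Gaussian vectors, independent of $X=(X_1,\dots,X_n)$, with $Z_i\sim\mathcal N(\mathbb E[X_i],\mathrm{Var}[X_i])$, and write $Z=(Z_1,\dots,Z_n)$. Let $q_m:\mathbb R^{nd}\to\mathbb R$ be a polynomial of total degree at most $m$ in the $nd$ coordinates of $(x_1,\dots,x_n)\in(\mathbb R^d)^n$ which is multilinear, in the sense that for every $i$ the gradient $\partial_i q_m(x_1,\dots,x_n)\in\mathbb R^d$ with respect to the vector $x_i$ does not depend on $x_i$. Put $$\sigma=\sqrt{\mathrm{Var}\,q_m(X)},\qquad W_i=(X_1,\dots,X_{i-1},0,Z_{i+1},\dots,Z_n),\qquad M_{\nu;i}=\big\|\partial_i q_m(W_i)^\top(X_i-\mathbb E[X_i])\big\|_{L_\nu}\in[0,\infty],$$ where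 $\|Y\|_{L_\nu}=(\mathbb E|Y|^\nu)^{1/\nu}$. If $\sigma>0$, then for every $t\in\mathbb R$ $$\Big|\mathbb P\Big(\frac{q_m(X)-\mathbb E[q_m(X)]}{\sigma}\le t\Big)-\mathbb P\Big(\frac{q_m(Z)-\mathbb E[q_m(X)]}{\sigma}\le t\Big)\Big|\;\le\; C\,m\,\Big(\frac{\sum_{i=1}^n M_{\nu;i}^\nu}{(1+t^2)^{\nu/2}\,\sigma^\nu}\Big)^{\frac1{\nu m+1}},$$ the right-hand side being $+\infty$ if some $M_{\nu;i}=\infty$. Moreover, whether or not $\sigma>0$, $q_m(X)$ and $q_m(Z)$ are square integrable, $\mathbb E[q_m(X)]=\mathbb E[q_m(Z)]$ and $\mathrm{Var}[q_m(X)]=\mathrm{Var}[q_m(Z)]$. -/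

import Mathlib

noncomputable section

namespace Universality

open MeasureTheory ProbabilityTheory

/-- The value `q(x₁, …, xₙ)` of a real polynomial in the `n * d` coordinates of `n` vectors
`x₁, …, xₙ` of `ℝ^d`. -/
def evalAt {n d : ℕ} (q : MvPolynomial (Fin n × Fin d) ℝ)
    (x : Fin n → EuclideanSpace ℝ (Fin d)) : ℝ :=
  MvPolynomial.eval (fun p : Fin n × Fin d => x p.1 p.2) q

/-- `∂ᵢ q (x) ∈ ℝ^d`: the gradient of `q` with respect to its `i`-th vector argument, at `x`. -/
def partialGrad {n d : ℕ} (q : MvPolynomial (Fin n × Fin d) ℝ) (i : Fin n)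
    (x : Fin n → EuclideanSpace ℝ (Fin d)) : EuclideanSpace ℝ (Fin d) :=
  gradient (fun y : EuclideanSpace ℝ (Fin d) => evalAt q (Function.update x i y)) (x i)

/-- `q` is multilinear: for every `i`, `∂ᵢ q (x₁, …, xₙ)` does not depend on `xᵢ`. -/
def IsMultilinear {n d : ℕ} (q : MvPolynomial (Fin n × Fin d) ℝ) : Prop :=
  ∀ (i : Fin n) (x : Fin n → EuclideanSpace ℝ (Fin d)) (y : EuclideanSpace ℝ (Fin d)),
    partialGrad q i (Function.update x i y) = partialGrad q i x

variable {Ω : Type*} [MeasurableSpace Ω]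

/-- The covariance matrix of a random vector of `ℝ^d`. -/
def covMatrix {d : ℕ} (Y : Ω → EuclideanSpace ℝ (Fin d)) (μ : Measure Ω) :
    Matrix (Fin d) (Fin d) ℝ :=
  Matrix.of fun j k => covariance (fun ω => Y ω j) (fun ω => Y ω k) μ

/-- `Wᵢ = (X₁, …, Xᵢ₋₁, 0, Zᵢ₊₁, …, Zₙ)`. -/
def hybrid {n d : ℕ} (X Z : Fin n → Ω → EuclideanSpace ℝ (Fin d)) (i : Fin n) (ω : Ω) :
    Fin n → EuclideanSpace ℝ (Fin d) :=
  fun k => if k < i then X k ω else if k = i then 0 else Z k ω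

/-- `M_{ν;i} = ‖∂ᵢ q (Wᵢ)ᵀ (Xᵢ - 𝔼 Xᵢ)‖_{L_ν}`, with value in `[0, ∞]`. -/
def influence {n d : ℕ} (q : MvPolynomial (Fin n × Fin d) ℝ)
    (X Z : Fin n → Ω → EuclideanSpace ℝ (Fin d)) (μ : Measure Ω) (ν : ℝ) (i : Fin n) :
    ENNReal :=
  eLpNorm
    (fun ω => inner ℝ (partialGrad q i (hybrid X Z i ω)) (X i ω - ∫ ω', X i ω' ∂μ))
    (ENNReal.ofReal ν) μ

/-- The standard deviation `σ` of `q(X)`. -/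
def sd {n d : ℕ} (q : MvPolynomial (Fin n × Fin d) ℝ)
    (X : Fin n → Ω → EuclideanSpace ℝ (Fin d)) (μ : Measure Ω) : ℝ :=
  Real.sqrt (variance (fun ω => evalAt q (fun i => X i ω)) μ)

/-- `ℙ((q(Y) - c) / s ≤ t)`. -/
def standardizedCDF {n d : ℕ} (q : MvPolynomial (Fin n × Fin d) ℝ)
    (Y : Fin n → Ω → EuclideanSpace ℝ (Fin d)) (μ : Measure Ω) (c s t : ℝ) : ℝ :=
  μ.real {ω | (evalAt q (fun i => Y i ω) - c) / s ≤ t}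

end Universality

end

/-! ### The Prékopa–Leindler inequality, up to Gaussian product measures. -/

namespace Universality

open MeasureTheory Set
open scoped ENNReal NNReal Pointwise

/-! The proof joins Lindeberg replacement to anti-concentration of Gaussian polynomials. By
multilinearity `q` is affine in each vector argument, hence a combination of products to which each
`xᵢ` contributes either `1` or one coordinate (`IsMultilinear.exists_expansion`). Under independence
its mean and second moment see only the first two moments of each `Xᵢ`, which `Zᵢ` shares; this
gives the equality of means and variances.

For the distribution functions, the indicator of `(-∞, T]` is replaced by a smooth step of width
`D`. Exchanging `Xᵢ` for `Zᵢ` affects `q` only through the scalar `∂ᵢq(Wᵢ)ᵀxᵢ`, whose conditional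
mean and variance given `Wᵢ` agree for both vectors. A second-order Taylor expansion therefore
leaves an error of order `D^(-ν) M_{ν;i}^ν`, and telescoping adds these up
(`IsSmoothStep.abs_integral_sub_le_sum`). Smoothing costs `ℙ(|q(Z) - T| ≤ D)`, which the
Carbery–Wright inequality (`stdGaussian_small_ball_le`) bounds by a multiple of `m (D/s)^(1/m)`,
where `s² = 𝔼(q(Z) - T)²`. For `T = 𝔼q + σt` this is `s² = σ²(1 + t²)`, the source of the decay in
`t`. Optimising over `D` (`le_mul_rpow_of_forall_le_add`) yields the exponent `1/(νm + 1)`.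

Carbery–Wright is obtained with a dimension-free constant by localization. If the small values of
`f` had too large a Gaussian share, repeated bisection (`exists_thin_convex`) would produce a convex
body close to a line on which this share is still too large while the mean of `f²` is not small. The
marginal along the line is log-concave by Prékopa–Leindler. There a Remez inequality and the
exponential decay of log-concave densities bound the second moment
(`IsLogConcaveDensity.lintegral_sq_mul_le`), a contradiction. -/

theorem ennreal_geom_mean_le_arith_mean {a b : ℝ} (ha : 0 < a) (hb : 0 < b) (hab : a + b = 1)
    (x y : ℝ≥0∞) : x ^ a * y ^ b ≤ ENNReal.ofReal a * x + ENNReal.ofReal b * y := by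
  rcases eq_or_ne x ∞ with rfl | hx
  · simp [ENNReal.mul_top, ha]
  rcases eq_or_ne y ∞ with rfl | hy
  · simp [ENNReal.mul_top, hb]
  lift x to ℝ≥0 using hx
  lift y to ℝ≥0 using hy
  have h := NNReal.geom_mean_le_arith_mean2_weighted a.toNNReal b.toNNReal x y
    (by rw [← Real.toNNReal_add ha.le hb.le, hab, Real.toNNReal_one])
  rw [Real.coe_toNNReal _ ha.le, Real.coe_toNNReal _ hb.le] at h
  rw [← ENNReal.coe_rpow_of_nonneg _ ha.le, ← ENNReal.coe_rpow_of_nonneg _ hb.le]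
  unfold ENNReal.ofReal
  exact_mod_cast h

/-- Layer-cake formula, by Tonelli on the region under the graph. Levels are real while `f` may take
the value `∞`. -/
theorem lintegral_eq_lintegral_meas_ofReal_lt {α : Type*} [MeasurableSpace α] (μ : Measure α)
    [SFinite μ] {f : α → ℝ≥0∞} (hf : Measurable f) :
    ∫⁻ x, f x ∂μ = ∫⁻ t in Ioi (0 : ℝ), μ {x | ENNReal.ofReal t < f x} := by
  have key : ∀ c : ℝ≥0∞, ∫⁻ t in Ioi (0 : ℝ), (if ENNReal.ofReal t < c then 1 else 0) = c := by
    intro c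
    have hm : MeasurableSet {t : ℝ | ENNReal.ofReal t < c} :=
      measurableSet_lt ENNReal.measurable_ofReal measurable_const
    have : (fun t : ℝ => if ENNReal.ofReal t < c then (1 : ℝ≥0∞) else 0)
        = {t : ℝ | ENNReal.ofReal t < c}.indicator 1 := by
      ext t; simp [indicator_apply]
    rw [this, lintegral_indicator_one hm, Measure.restrict_apply hm]
    rcases eq_or_ne c ∞ with rfl | hc
    · simp
    · have : {t : ℝ | ENNReal.ofReal t < c} ∩ Ioi 0 = Ioo 0 c.toReal := by
        ext t
        simp only [mem_inter_iff, mem_ofPred_eq, mem_Ioi, mem_Ioo]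
        constructor
        · rintro ⟨h1, h2⟩; exact ⟨h2, (ENNReal.ofReal_lt_iff_lt_toReal h2.le hc).1 h1⟩
        · rintro ⟨h1, h2⟩; exact ⟨(ENNReal.ofReal_lt_iff_lt_toReal h1.le hc).2 h2, h1⟩
      rw [this, Real.volume_Ioo, sub_zero, ENNReal.ofReal_toReal hc]
  have hset : MeasurableSet {p : α × ℝ | ENNReal.ofReal p.2 < f p.1} :=
    measurableSet_lt (ENNReal.measurable_ofReal.comp measurable_snd) (hf.comp measurable_fst)
  calc ∫⁻ x, f x ∂μ
      = ∫⁻ x, (∫⁻ t in Ioi (0 : ℝ), (if ENNReal.ofReal t < f x then 1 else 0)) ∂μ := by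
        simp_rw [key]
    _ = ∫⁻ t in Ioi (0 : ℝ), ∫⁻ x, (if ENNReal.ofReal t < f x then 1 else 0) ∂μ := by
        rw [lintegral_lintegral_swap]
        exact (Measurable.ite hset measurable_const measurable_const).aemeasurable
    _ = _ := by
        congr 1 with t
        have hm : MeasurableSet {x | ENNReal.ofReal t < f x} :=
          measurableSet_lt measurable_const hf
        rw [← lintegral_indicator_one hm]
        congr 1 with x
        simp [indicator_apply]

/-- One-dimensional Brunn–Minkowski inequality. -/
theorem volume_add_le_of_forall_add_mem {A B C : Set ℝ} {a b : ℝ} (ha : 0 < a) (hb : 0 < b)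
    (hA : MeasurableSet A) (hB : MeasurableSet B) (hA' : A.Nonempty) (hB' : B.Nonempty)
    (hC : ∀ x ∈ A, ∀ y ∈ B, a * x + b * y ∈ C) :
    ENNReal.ofReal a * volume A + ENNReal.ofReal b * volume B ≤ volume C := by
  have main : ∀ K ⊆ A, IsCompact K → K.Nonempty → ∀ L ⊆ B, IsCompact L → L.Nonempty →
      ENNReal.ofReal a * volume K + ENNReal.ofReal b * volume L ≤ volume C := by
    intro K hKA hK hKne L hLB hL hLne
    -- The translates `a K + b l` and `a k + b L`, with `k` the maximum of `K` and `l` the minimum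
    -- of `L`, both lie in `C` and meet only at `a k + b l`.
    obtain ⟨k, hkK, hk⟩ := hK.exists_isGreatest hKne
    obtain ⟨l, hlL, hl⟩ := hL.exists_isLeast hLne
    have volK : volume ((fun x => a * x + b * l) '' K) = ENNReal.ofReal a * volume K := by
      have : (fun x => a * x + b * l) '' K = (fun x => x + b * l) '' (a • K) := by
        rw [← image_smul, image_image]; simp
      rw [this, image_add_right, measure_preimage_add_right, Measure.addHaar_smul]
      simp [abs_of_pos ha]
    have volL : volume ((fun y => a * k + b * y) '' L) = ENNReal.ofReal b * volume L := by
      have : (fun y => a * k + b * y) '' L = (fun x => a * k + x) '' (b • L) := by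
        rw [← image_smul, image_image]; simp
      rw [this, image_add_left, measure_preimage_add, Measure.addHaar_smul]
      simp [abs_of_pos hb]
    rw [← volK, ← volL]
    have mL : MeasurableSet ((fun y => a * k + b * y) '' L) :=
      (hL.image (by fun_prop)).measurableSet
    have disj : AEDisjoint volume ((fun x => a * x + b * l) '' K)
        ((fun y => a * k + b * y) '' L) := by
      refine measure_mono_null (t := {a * k + b * l}) ?_ (by simp)
      rintro z ⟨⟨x, hx, rfl⟩, ⟨y, hy, hxy⟩⟩
      have h1 := mul_le_mul_of_nonneg_left (hk hx) ha.le
      have h2 := mul_le_mul_of_nonneg_left (hl hy) hb.le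
      simp only [mem_singleton_iff] at *
      linarith
    rw [← measure_union₀ mL.nullMeasurableSet disj]
    refine measure_mono (union_subset ?_ ?_)
    · rintro _ ⟨x, hx, rfl⟩; exact hC _ (hKA hx) _ (hLB hlL)
    · rintro _ ⟨x, hx, rfl⟩; exact hC _ (hKA hkK) _ (hLB hx)
  obtain ⟨x₀, hx₀⟩ := hA'
  obtain ⟨y₀, hy₀⟩ := hB'
  have step : ∀ K ⊆ A, IsCompact K → ∀ L ⊆ B, IsCompact L →
      ENNReal.ofReal a * volume K + ENNReal.ofReal b * volume L ≤ volume C := by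
    intro K hKA hK L hLB hL
    -- Compact subsets may be empty, for which `main` fails; adding one point of `A` and of `B`
    -- repairs this.
    refine le_trans ?_ (main (insert x₀ K) (insert_subset hx₀ hKA) (hK.insert _) ⟨x₀, by simp⟩
      (insert y₀ L) (insert_subset hy₀ hLB) (hL.insert _) ⟨y₀, by simp⟩)
    gcongr <;> exact subset_insert _ _
  rw [hA.measure_eq_iSup_isCompact, hB.measure_eq_iSup_isCompact]
  simp only [ENNReal.mul_iSup]
  refine ENNReal.biSup_add_biSup_le' (p := fun K => K ⊆ A) (q := fun K => K ⊆ B) ⟨∅, empty_subset _⟩ ⟨∅, empty_subset _⟩ ?_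
  intro K hKA L hLB
  by_cases hK : IsCompact K <;> by_cases hL : IsCompact L <;> simp only [hK, hL, iSup_pos]
  · exact step K hKA hK L hLB hL
  · simpa using step K hKA hK ∅ (empty_subset _) isCompact_empty
  · simpa using step ∅ (empty_subset _) isCompact_empty L hLB hL
  · simp

/-- The Prékopa–Leindler inequality for a measure. -/
def PrekopaLeindler {E : Type*} [AddCommGroup E] [Module ℝ E] [MeasurableSpace E]
    (μ : Measure E) : Prop :=
  ∀ ⦃a b : ℝ⦄, 0 < a → 0 < b → a + b = 1 → ∀ ⦃f g h : E → ℝ≥0∞⦄, Measurable f → Measurable g →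
    Measurable h → (∀ x y, f x ^ a * g y ^ b ≤ h (a • x + b • y)) →
    (∫⁻ x, f x ∂μ) ^ a * (∫⁻ x, g x ∂μ) ^ b ≤ ∫⁻ x, h x ∂μ

/-- After dividing by the suprema, the superlevel sets of `f / M` and `g / N` at every `t < 1` are
nonempty, so Brunn–Minkowski applies level by level. Integrating over the levels gives the
arithmetic-mean form, which is stronger than the geometric one. -/
theorem prekopaLeindler_volume_of_iSup_ne_top {a b : ℝ} (ha : 0 < a) (hb : 0 < b)
    (hab : a + b = 1) {f g h : ℝ → ℝ≥0∞} (hf : Measurable f) (hg : Measurable g)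
    (hh : Measurable h) (H : ∀ x y, f x ^ a * g y ^ b ≤ h (a • x + b • y))
    (hfM : ⨆ x, f x ≠ ∞) (hgM : ⨆ x, g x ≠ ∞) :
    (∫⁻ x, f x) ^ a * (∫⁻ x, g x) ^ b ≤ ∫⁻ x, h x := by
  set M := ⨆ x, f x with hM
  set N := ⨆ x, g x with hN
  have hfle : ∀ x, f x ≤ M := le_iSup f
  have hgle : ∀ x, g x ≤ N := le_iSup g
  rcases eq_or_ne M 0 with hM0 | hM0
  · have : f = 0 := by ext x; simpa [hM0] using hfle x
    simp [this, ENNReal.zero_rpow_of_pos ha]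
  rcases eq_or_ne N 0 with hN0 | hN0
  · have : g = 0 := by ext x; simpa [hN0] using hgle x
    simp [this, ENNReal.zero_rpow_of_pos hb]
  set c := M ^ a * N ^ b with hc
  have hc0 : c ≠ 0 := by
    simp [hc, hM0, hN0, hfM, hgM, ENNReal.rpow_eq_zero_iff, ha.not_gt, hb.not_gt]
  have hct : c ≠ ∞ := ENNReal.mul_ne_top (ENNReal.rpow_ne_top_of_nonneg ha.le hfM)
    (ENNReal.rpow_ne_top_of_nonneg hb.le hgM)
  have level : ∀ t ∈ Ioo (0 : ℝ) 1,
      ENNReal.ofReal a * volume {x | ENNReal.ofReal t < f x / M}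
        + ENNReal.ofReal b * volume {x | ENNReal.ofReal t < g x / N}
        ≤ volume {x | ENNReal.ofReal t < h x / c} := by
    intro t ht
    have ht1 : ENNReal.ofReal t < 1 := by
      rw [← ENNReal.ofReal_one]; exact (ENNReal.ofReal_lt_ofReal_iff one_pos).2 ht.2
    have ne : ∀ (u : ℝ → ℝ≥0∞) (U : ℝ≥0∞), U = ⨆ x, u x → U ≠ 0 → U ≠ ∞ →
        {x | ENNReal.ofReal t < u x / U}.Nonempty := by
      intro u U hU h0 htop
      have : ENNReal.ofReal t * U < ⨆ x, u x := by
        rw [← hU]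
        calc ENNReal.ofReal t * U < 1 * U := ENNReal.mul_lt_mul_left h0 htop ht1
          _ = U := one_mul U
      obtain ⟨x, hx⟩ := lt_iSup_iff.1 this
      exact ⟨x, (ENNReal.lt_div_iff_mul_lt (Or.inl h0) (Or.inl htop)).2 hx⟩
    refine volume_add_le_of_forall_add_mem ha hb
      (measurableSet_lt measurable_const (hf.div_const _))
      (measurableSet_lt measurable_const (hg.div_const _)) (ne f M hM hM0 hfM)
      (ne g N hN hN0 hgM) ?_
    intro x hx y hy
    simp only [mem_ofPred_eq] at hx hy ⊢
    have e1 : ENNReal.ofReal t = ENNReal.ofReal t ^ a * ENNReal.ofReal t ^ b := by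
      rw [← ENNReal.rpow_add_of_nonneg _ _ ha.le hb.le, hab, ENNReal.rpow_one]
    have lt1 : ENNReal.ofReal t ^ a < (f x / M) ^ a := ENNReal.rpow_lt_rpow hx ha
    have lt2 : ENNReal.ofReal t ^ b < (g y / N) ^ b := ENNReal.rpow_lt_rpow hy hb
    calc ENNReal.ofReal t = ENNReal.ofReal t ^ a * ENNReal.ofReal t ^ b := e1
      _ < (f x / M) ^ a * (g y / N) ^ b := ENNReal.mul_lt_mul lt1 lt2
      _ = f x ^ a * g y ^ b / c := by
        rw [ENNReal.div_rpow_of_nonneg _ _ ha.le, ENNReal.div_rpow_of_nonneg _ _ hb.le, hc,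
          div_eq_mul_inv, div_eq_mul_inv, div_eq_mul_inv, ENNReal.mul_inv, mul_mul_mul_comm]
        · left; simp [ENNReal.rpow_eq_zero_iff, hM0, hfM]
        · left; exact ENNReal.rpow_ne_top_of_nonneg ha.le hfM
      _ ≤ h (a * x + b * y) / c := ENNReal.div_le_div_right (H x y) c
  have norm_eq : ∀ (u : ℝ → ℝ≥0∞) (U : ℝ≥0∞), Measurable u → (∀ x, u x ≤ U) →
      ∫⁻ x, u x / U = ∫⁻ t in Ioo (0 : ℝ) 1, volume {x | ENNReal.ofReal t < u x / U} := by
    intro u U hu hle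
    rw [lintegral_eq_lintegral_meas_ofReal_lt _ (hu.div_const _),
      ← Ioo_union_Ici_eq_Ioi (zero_lt_one' ℝ), lintegral_union measurableSet_Ici]
    · rw [setLIntegral_congr_fun (g := 0) measurableSet_Ici]
      · simp
      · intro t ht
        have : {x | ENNReal.ofReal t < u x / U} = ∅ := by
          ext x
          simp only [mem_ofPred_eq, mem_empty_iff_false, iff_false, not_lt]
          calc u x / U ≤ 1 := ENNReal.div_le_of_le_mul (by simpa using hle x)
            _ ≤ ENNReal.ofReal t := by simpa using ht
        simp [this]
    · rw [Set.disjoint_left]; intro x hx hx'; exact absurd hx.2 (not_lt.2 hx')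
  have hmeas : ∀ (u : ℝ → ℝ≥0∞), Measurable fun t : ℝ => volume {x | ENNReal.ofReal t < u x} := by
    intro u
    refine Antitone.measurable fun s t hst => measure_mono fun x hx => ?_
    exact lt_of_le_of_lt (ENNReal.ofReal_le_ofReal hst) hx
  have main : ENNReal.ofReal a * (∫⁻ x, f x / M) + ENNReal.ofReal b * (∫⁻ x, g x / N)
      ≤ ∫⁻ x, h x / c := by
    rw [norm_eq f M hf hfle, norm_eq g N hg hgle,
      lintegral_eq_lintegral_meas_ofReal_lt _ (hh.div_const _)]
    rw [← lintegral_const_mul _ (hmeas _), ← lintegral_const_mul _ (hmeas _),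
      ← lintegral_add_left ((hmeas _).const_mul _)]
    -- Only `h / c` can exceed `1`; its levels above `1` are discarded, in the favourable direction.
    calc _ ≤ ∫⁻ t in Ioo (0 : ℝ) 1, volume {x | ENNReal.ofReal t < h x / c} :=
          setLIntegral_mono (hmeas _) level
      _ ≤ _ := lintegral_mono_set Ioo_subset_Ioi_self
  have agm := (ennreal_geom_mean_le_arith_mean ha hb hab (∫⁻ x, f x / M) (∫⁻ x, g x / N)).trans main
  simp only [div_eq_mul_inv] at agm
  rw [lintegral_mul_const _ hf, lintegral_mul_const _ hg, lintegral_mul_const _ hh,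
    ENNReal.mul_rpow_of_nonneg _ _ ha.le, ENNReal.mul_rpow_of_nonneg _ _ hb.le,
    mul_mul_mul_comm, ENNReal.inv_rpow, ENNReal.inv_rpow, ← ENNReal.mul_inv, ← hc] at agm
  · exact (ENNReal.mul_le_mul_iff_left (ENNReal.inv_ne_zero.2 hct) (ENNReal.inv_ne_top.2 hc0)).1 agm
  · left; simp [ENNReal.rpow_eq_zero_iff, hM0, hfM]
  · left; exact ENNReal.rpow_ne_top_of_nonneg ha.le hfM

theorem prekopaLeindler_volume : PrekopaLeindler (volume : Measure ℝ) := by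
  intro a b ha hb hab f g h hf hg hh H
  have lim : ∀ u : ℝ → ℝ≥0∞, Measurable u →
      ∫⁻ x, u x = ⨆ n : ℕ, ∫⁻ x, min (u x) n := by
    intro u hu
    rw [← lintegral_iSup (fun n => hu.min measurable_const)]
    · congr 1 with x
      refine le_antisymm ?_ (iSup_le fun n => min_le_left _ _)
      rcases eq_or_ne (u x) ∞ with hx | hx
      · simp [hx, ENNReal.iSup_natCast]
      · obtain ⟨n, hn⟩ := ENNReal.exists_nat_gt hx
        exact le_iSup_of_le n (le_min le_rfl hn.le)
    · intro m n hmn x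
      exact min_le_min le_rfl (by exact_mod_cast hmn)
  have bdd : ∀ (u : ℝ → ℝ≥0∞) (n : ℕ), ⨆ x, min (u x) (n : ℝ≥0∞) ≠ ∞ := fun u n =>
    ne_top_of_le_ne_top (ENNReal.natCast_ne_top n) (iSup_le fun x => min_le_right _ _)
  have mono : ∀ (u : ℝ → ℝ≥0∞), Monotone fun n : ℕ => ∫⁻ x, min (u x) (n : ℝ≥0∞) := by
    intro u m n hmn
    refine lintegral_mono fun x => min_le_min le_rfl (by exact_mod_cast hmn)
  rw [lim f hf, lim g hg, (ENNReal.monotone_rpow_of_nonneg ha.le).map_iSup_of_continuousAt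
      (ENNReal.continuous_rpow_const.continuousAt) (by simp [ha]),
    (ENNReal.monotone_rpow_of_nonneg hb.le).map_iSup_of_continuousAt
      (ENNReal.continuous_rpow_const.continuousAt) (by simp [hb]), ENNReal.iSup_mul]
  refine iSup_le fun i => ?_
  rw [ENNReal.mul_iSup]
  refine iSup_le fun j => le_trans (mul_le_mul'
    (ENNReal.rpow_le_rpow (mono f (le_max_left i j)) ha.le)
    (ENNReal.rpow_le_rpow (mono g (le_max_right i j)) hb.le)) ?_
  refine prekopaLeindler_volume_of_iSup_ne_top ha hb hab (hf.min measurable_const)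
    (hg.min measurable_const) hh (fun x y => le_trans ?_ (H x y)) (bdd f _) (bdd g _)
  gcongr <;> exact min_le_left _ _

theorem PrekopaLeindler.withDensity {E : Type*} [AddCommGroup E] [Module ℝ E] [MeasurableSpace E]
    {μ : Measure E} (hμ : PrekopaLeindler μ) {w : E → ℝ≥0∞} (hw : Measurable w)
    (hlog : ∀ ⦃a b : ℝ⦄, 0 < a → 0 < b → a + b = 1 → ∀ x y, w x ^ a * w y ^ b ≤ w (a • x + b • y)) :
    PrekopaLeindler (μ.withDensity w) := by
  intro a b ha hb hab f g h hf hg hh H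
  rw [lintegral_withDensity_eq_lintegral_mul _ hw hf, lintegral_withDensity_eq_lintegral_mul _ hw hg,
    lintegral_withDensity_eq_lintegral_mul _ hw hh]
  refine hμ ha hb hab (hw.mul hf) (hw.mul hg) (hw.mul hh) fun x y => ?_
  simp only [Pi.mul_apply]
  rw [ENNReal.mul_rpow_of_nonneg _ _ ha.le, ENNReal.mul_rpow_of_nonneg _ _ hb.le, mul_mul_mul_comm]
  exact mul_le_mul' (hlog ha hb hab x y) (H x y)

/-- The inequality tensorizes: applied on the fibres, it says that the fibre integrals satisfy its
own hypothesis on the base. -/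
theorem PrekopaLeindler.prod {E F : Type*} [AddCommGroup E] [Module ℝ E] [MeasurableSpace E]
    [AddCommGroup F] [Module ℝ F] [MeasurableSpace F] {μ : Measure E} {ν : Measure F} [SFinite ν]
    (hμ : PrekopaLeindler μ) (hν : PrekopaLeindler ν) : PrekopaLeindler (μ.prod ν) := by
  intro a b ha hb hab f g h hf hg hh H
  rw [lintegral_prod _ hf.aemeasurable, lintegral_prod _ hg.aemeasurable,
    lintegral_prod _ hh.aemeasurable]
  refine hμ ha hb hab hf.lintegral_prod_right' hg.lintegral_prod_right' hh.lintegral_prod_right'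
    fun x y => ?_
  exact hν ha hb hab (hf.comp measurable_prodMk_left) (hg.comp measurable_prodMk_left)
    (hh.comp measurable_prodMk_left) fun x' y' => H (x, x') (y, y')

theorem PrekopaLeindler.map {E F : Type*} [AddCommGroup E] [Module ℝ E] [MeasurableSpace E]
    [AddCommGroup F] [Module ℝ F] [MeasurableSpace F] {μ : Measure E} (hμ : PrekopaLeindler μ)
    (T : E →ₗ[ℝ] F) (hT : Measurable T) : PrekopaLeindler (μ.map T) := by
  intro a b ha hb hab f g h hf hg hh H
  rw [lintegral_map hf hT, lintegral_map hg hT, lintegral_map hh hT]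
  refine hμ ha hb hab (hf.comp hT) (hg.comp hT) (hh.comp hT) fun x y => ?_
  simpa using H (T x) (T y)

theorem PrekopaLeindler.pi {μ : Measure ℝ} [SigmaFinite μ] (hμ : PrekopaLeindler μ) (n : ℕ) :
    PrekopaLeindler (Measure.pi fun _ : Fin n => μ) := by
  induction n with
  | zero =>
    intro a b ha hb hab f g h hf hg hh H
    rw [Measure.pi_of_empty _ 0]
    simpa using H 0 0
  | succ n ih =>
    have e := (measurePreserving_piFinSuccAbove (fun _ : Fin (n + 1) => μ) 0).symm
    rw [← e.map_eq]
    let T : ℝ × (Fin n → ℝ) →ₗ[ℝ] (Fin (n + 1) → ℝ) :=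
      { toFun := fun x => Fin.cons x.1 x.2
        map_add' := by
          intro x y; ext i; refine Fin.cases ?_ (fun j => ?_) i <;> simp
        map_smul' := by
          intro c x; ext i; refine Fin.cases ?_ (fun j => ?_) i <;> simp }
    have hT : (T : ℝ × (Fin n → ℝ) → (Fin (n + 1) → ℝ))
        = (MeasurableEquiv.piFinSuccAbove (fun _ : Fin (n + 1) => ℝ) 0).symm := by
      ext x i
      refine Fin.cases ?_ (fun j => ?_) i <;>
        simp [T, MeasurableEquiv.piFinSuccAbove, Fin.insertNthEquiv]
    rw [← hT]
    exact (hμ.prod ih).map T (hT ▸ e.measurable)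

theorem gaussianPDF_mul_le {a b : ℝ} (ha : 0 < a) (hb : 0 < b) (hab : a + b = 1) (x y : ℝ) :
    ProbabilityTheory.gaussianPDF 0 1 x ^ a * ProbabilityTheory.gaussianPDF 0 1 y ^ b
      ≤ ProbabilityTheory.gaussianPDF 0 1 (a • x + b • y) := by
  unfold ProbabilityTheory.gaussianPDF
  have hp : ∀ x, 0 < ProbabilityTheory.gaussianPDFReal 0 1 x := fun x =>
    ProbabilityTheory.gaussianPDFReal_pos _ _ _ one_ne_zero
  rw [ENNReal.ofReal_rpow_of_pos (hp x), ENNReal.ofReal_rpow_of_pos (hp y),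
    ← ENNReal.ofReal_mul (Real.rpow_nonneg (hp x).le _)]
  refine ENNReal.ofReal_le_ofReal ?_
  simp only [ProbabilityTheory.gaussianPDFReal, NNReal.coe_one, mul_one, sub_zero, smul_eq_mul]
  set k := (Real.sqrt (2 * Real.pi))⁻¹
  have hk : 0 < k := by positivity
  rw [Real.mul_rpow hk.le (Real.exp_pos _).le, Real.mul_rpow hk.le (Real.exp_pos _).le,
    mul_mul_mul_comm, ← Real.rpow_add hk, hab, Real.rpow_one, ← Real.exp_mul, ← Real.exp_mul,
    ← Real.exp_add]
  gcongr
  have : b = 1 - a := by linarith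
  subst this
  nlinarith [mul_nonneg (mul_nonneg ha.le hb.le) (sq_nonneg (x - y))]

theorem prekopaLeindler_pi_gaussianReal (n : ℕ) :
    PrekopaLeindler (Measure.pi fun _ : Fin n => ProbabilityTheory.gaussianReal 0 1) := by
  refine PrekopaLeindler.pi ?_ n
  rw [ProbabilityTheory.gaussianReal_of_var_ne_zero _ one_ne_zero]
  exact prekopaLeindler_volume.withDensity (ProbabilityTheory.measurable_gaussianPDF _ _)
    fun a b ha hb hab x y => gaussianPDF_mul_le ha hb hab x y

end Universality

/-! ### A Remez inequality from Lagrange interpolation at spaced points. -/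

namespace Universality

open MeasureTheory Set
open scoped ENNReal NNReal RealInnerProductSpace

/-- Greedy choice: take the minimum of `E` and discard everything within `s` to its right, which
loses measure at most `s`. -/
theorem exists_spaced_points (k : ℕ) {s : ℝ} (hs : 0 ≤ s) :
    ∀ E : Set ℝ, IsCompact E → k * s < volume.real E →
      ∃ x : ℕ → ℝ, (∀ i ≤ k, x i ∈ E) ∧ ∀ i j, i ≤ j → j ≤ k → x i + ((j : ℝ) - i) * s ≤ x j := by
  induction k with
  | zero =>
    intro E hE hvol
    have hne : E.Nonempty := by
      rw [nonempty_iff_ne_empty]; rintro rfl; simp at hvol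
    obtain ⟨x, hx⟩ := hne
    refine ⟨fun _ => x, fun i _ => hx, fun i j hij hj => ?_⟩
    obtain rfl : j = 0 := by omega
    obtain rfl : i = 0 := by omega
    simp
  | succ k ih =>
    intro E hE hvol
    have hne : E.Nonempty := by
      rw [nonempty_iff_ne_empty]; rintro rfl
      simp at hvol; nlinarith [mul_nonneg (by positivity : (0 : ℝ) ≤ k + 1) hs]
    obtain ⟨x₀, hx₀, hmin⟩ := hE.exists_isLeast hne
    have hE' : IsCompact (E ∩ Ici (x₀ + s)) := hE.inter_right isClosed_Ici
    have hfin : volume E ≠ ∞ := hE.measure_ne_top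
    have hle : volume.real E ≤ s + volume.real (E ∩ Ici (x₀ + s)) := by
      have hsub : E ⊆ Icc x₀ (x₀ + s) ∪ (E ∩ Ici (x₀ + s)) := by
        intro x hx
        rcases le_total x (x₀ + s) with h | h
        · exact Or.inl ⟨hmin hx, h⟩
        · exact Or.inr ⟨hx, h⟩
      calc volume.real E ≤ volume.real (Icc x₀ (x₀ + s) ∪ (E ∩ Ici (x₀ + s))) :=
            measureReal_mono hsub (measure_union_ne_top (by simp) hE'.measure_ne_top)
        _ ≤ volume.real (Icc x₀ (x₀ + s)) + volume.real (E ∩ Ici (x₀ + s)) :=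
            measureReal_union_le _ _
        _ = _ := by simp [Real.volume_real_Icc, hs]
    obtain ⟨x, hxE, hx⟩ := ih _ hE' (by push_cast at hvol; linarith)
    refine ⟨fun i => Nat.casesOn i x₀ x, ?_, ?_⟩
    · rintro (_ | i) hi
      · exact hx₀
      · exact (hxE i (by omega)).1
    · rintro (_ | i) (_ | j) hij hj
      · simp
      · have h1 := hx 0 j (by omega) (by omega)
        have h2 : x₀ + s ≤ x 0 := (hxE 0 (by omega)).2
        simp only [Nat.cast_zero, sub_zero] at h1
        change x₀ + (((j + 1 : ℕ) : ℝ) - (0 : ℕ)) * s ≤ x j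
        push_cast
        linarith
      · omega
      · have h1 := hx i j (by omega) (by omega)
        change x i + (((j + 1 : ℕ) : ℝ) - (i + 1 : ℕ)) * s ≤ x j
        push_cast
        linarith

/-- This is the Lagrange denominator for unit-spaced nodes. Nodes with gaps at least `s` have a
denominator at least `s ^ m` times as large. -/
theorem prod_erase_abs_sub_eq_factorial {m j : ℕ} (hj : j ≤ m) :
    ∏ i ∈ (Finset.range (m + 1)).erase j, |(j : ℝ) - i| = (j.factorial : ℝ) * (m - j).factorial := by
  obtain ⟨k, rfl⟩ := Nat.exists_eq_add_of_le hj
  have hsplit : (Finset.range (j + k + 1)).erase j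
      = Finset.range j ∪ (Finset.range k).image (fun i => j + 1 + i) := by
    ext i
    simp only [Finset.mem_erase, Finset.mem_range, Finset.mem_union, Finset.mem_image]
    constructor
    · rintro ⟨h1, h2⟩
      rcases lt_or_ge i j with h | h
      · exact Or.inl h
      · exact Or.inr ⟨i - (j + 1), by omega, by omega⟩
    · rintro (h | ⟨a, h1, h2⟩) <;> omega
  rw [hsplit, Finset.prod_union, Finset.prod_image (by intro a _ b _ h; simpa using h)]
  · congr 1
    · rw [← Finset.prod_range_reflect, ← Finset.prod_range_add_one_eq_factorial]
      push_cast
      refine Finset.prod_congr rfl fun i hi => ?_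
      have hi' := Finset.mem_range.1 hi
      rw [Nat.sub_sub, Nat.cast_sub (by omega), abs_of_nonneg] <;> push_cast <;> [ring; linarith]
    · rw [Nat.add_sub_cancel_left, ← Finset.prod_range_add_one_eq_factorial]
      push_cast
      refine Finset.prod_congr rfl fun i hi => ?_
      rw [abs_of_nonpos] <;> [ring; linarith]
  · rw [Finset.disjoint_left]
    intro i hi hi'
    simp only [Finset.mem_range, Finset.mem_image] at hi hi'
    omega

theorem sum_inv_factorial_mul_factorial (m : ℕ) :
    ∑ j ∈ Finset.range (m + 1), ((j.factorial : ℝ) * (m - j).factorial)⁻¹ = 2 ^ m / m.factorial := by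
  rw [eq_div_iff (by positivity), Finset.sum_mul]
  have := Nat.sum_range_choose m
  have h2 : (2 : ℝ) ^ m = ∑ j ∈ Finset.range (m + 1), (m.choose j : ℝ) := by exact_mod_cast this.symm
  rw [h2]
  refine Finset.sum_congr rfl fun j hj => ?_
  rw [Nat.cast_choose ℝ (by simpa [Nat.lt_succ_iff] using hj)]
  field_simp

/-- A Remez-type inequality. -/
theorem abs_eval_mul_volume_pow_le {p : Polynomial ℝ} {m : ℕ} (hm : 1 ≤ m) (hp : p.natDegree ≤ m)
    {ε : ℝ} (hε : 0 ≤ ε) {E : Set ℝ} (hE : IsCompact E) (hpE : ∀ x ∈ E, |p.eval x| ≤ ε)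
    {α β t : ℝ} (hEI : E ⊆ Icc α β) (ht : t ∈ Icc α β) :
    |p.eval t| * volume.real E ^ m ≤ ε * (4 * Real.exp 1 * (β - α)) ^ m := by
  have hm0 : (0 : ℝ) < m := by exact_mod_cast hm
  have hαβ : 0 ≤ β - α := by linarith [ht.1, ht.2]
  rcases (measureReal_nonneg (μ := volume) (s := E)).eq_or_lt with h0 | hpos
  · rw [← h0, zero_pow (by omega), mul_zero]; positivity
  set v := volume.real E with hv
  -- Then `m * s = v / 2`, strictly below `v` as the spacing lemma requires.
  set s := v / (2 * m) with hs
  have hspos : 0 < s := by positivity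
  obtain ⟨x, hxE, hx⟩ := exists_spaced_points m hspos.le E hE (by rw [hs]; field_simp; linarith)
  have hsep : ∀ i ≤ m, ∀ j ≤ m, |(j : ℝ) - i| * s ≤ |x j - x i| := by
    intro i hi j hj
    rcases le_total i j with h | h
    · have := hx i j h hj
      have h' : (i : ℝ) ≤ j := by exact_mod_cast h
      rw [abs_of_nonneg (by linarith)]
      exact (by linarith : _ ≤ x j - x i).trans (le_abs_self _)
    · have := hx j i h hi
      have h' : (j : ℝ) ≤ i := by exact_mod_cast h
      rw [abs_of_nonpos (by linarith), abs_sub_comm]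
      exact (by linarith : _ ≤ x i - x j).trans (le_abs_self _)
  have hinj : Set.InjOn x (Finset.range (m + 1) : Set ℕ) := by
    intro i hi j hj hij
    simp only [Finset.coe_range, mem_Iio] at hi hj
    have := hsep i (by omega) j (by omega)
    rw [hij, sub_self, abs_zero] at this
    have h0 : |(j : ℝ) - i| = 0 := by
      by_contra h
      exact absurd this (not_le.2 (mul_pos (lt_of_le_of_ne (abs_nonneg _) (Ne.symm h)) hspos))
    have := sub_eq_zero.1 (abs_eq_zero.1 h0)
    exact_mod_cast this.symm
  have hdeg : p.degree < (Finset.range (m + 1)).card := by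
    rw [Finset.card_range]
    exact lt_of_le_of_lt Polynomial.degree_le_natDegree (by exact_mod_cast Nat.lt_succ_of_le hp)
  have hint := Lagrange.eq_interpolate hinj hdeg
  have hbasis : ∀ j ∈ Finset.range (m + 1), |(Lagrange.basis (Finset.range (m + 1)) x j).eval t|
      ≤ ((β - α) / s) ^ m * ((j.factorial : ℝ) * (m - j).factorial)⁻¹ := by
    intro j hj
    have hjm : j ≤ m := by simpa [Nat.lt_succ_iff] using hj
    rw [Lagrange.basis, Polynomial.eval_prod, Finset.abs_prod,
      ← prod_erase_abs_sub_eq_factorial hjm]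
    have hcard : ((Finset.range (m + 1)).erase j).card = m := by
      rw [Finset.card_erase_of_mem hj, Finset.card_range]; rfl
    have hpow : ((β - α) / s) ^ m = ∏ _i ∈ (Finset.range (m + 1)).erase j, (β - α) / s := by
      rw [Finset.prod_const, hcard]
    rw [← Finset.prod_inv_distrib, hpow, ← Finset.prod_mul_distrib]
    refine Finset.prod_le_prod (fun _ _ => abs_nonneg _) fun i hi => ?_
    have him : i ≤ m := by
      have := (Finset.mem_erase.1 hi).2
      simpa [Nat.lt_succ_iff] using this
    have hij : (j : ℝ) - i ≠ 0 := by
      have := (Finset.mem_erase.1 hi).1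
      rw [sub_ne_zero]; exact_mod_cast this.symm
    simp only [Lagrange.basisDivisor, Polynomial.eval_mul, Polynomial.eval_C, Polynomial.eval_sub,
      Polynomial.eval_X, abs_mul, abs_inv]
    have h1 : |t - x i| ≤ β - α := by
      have := hEI (hxE i him)
      rw [abs_le]; constructor <;> linarith [this.1, this.2, ht.1, ht.2]
    have h2 := hsep i him j hjm
    have h3 : 0 < |(j : ℝ) - i| * s := mul_pos (abs_pos.2 hij) hspos
    calc |x j - x i|⁻¹ * |t - x i| ≤ (|(j : ℝ) - i| * s)⁻¹ * (β - α) := by gcongr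
      _ = (β - α) / s * |(j : ℝ) - i|⁻¹ := by rw [mul_inv]; ring
  have hbound : |p.eval t| ≤ ε * (((β - α) / s) ^ m * (2 ^ m / m.factorial)) := by
    rw [hint, Lagrange.interpolate_apply, Polynomial.eval_finsetSum,
      ← sum_inv_factorial_mul_factorial, Finset.mul_sum, Finset.mul_sum]
    refine (Finset.abs_sum_le_sum_abs _ _).trans (Finset.sum_le_sum fun j hj => ?_)
    rw [Polynomial.eval_mul, Polynomial.eval_C, abs_mul]
    exact mul_le_mul (hpE _ (hxE j (by simpa [Nat.lt_succ_iff] using hj))) (hbasis j hj)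
      (abs_nonneg _) hε
  -- The `m ^ m` from `1 / s ^ m` is cancelled by the `m!` from interpolation, so that the constant
  -- per degree is absolute.
  have hfac : (m : ℝ) ^ m / m.factorial ≤ Real.exp 1 ^ m := by
    rw [← Real.exp_nat_mul, mul_one]; exact Real.pow_div_factorial_le_exp _ hm0.le _
  calc |p.eval t| * v ^ m ≤ ε * (((β - α) / s) ^ m * (2 ^ m / m.factorial)) * v ^ m := by gcongr
    _ = ε * ((4 * (β - α)) ^ m * ((m : ℝ) ^ m / m.factorial)) := by
        have : (β - α) / s = (2 * m) * (β - α) / v := by rw [hs]; field_simp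
        rw [this, div_pow, mul_pow, mul_pow, mul_pow, (by norm_num : (4 : ℝ) = 2 * 2), mul_pow]
        field_simp
    _ ≤ ε * ((4 * (β - α)) ^ m * Real.exp 1 ^ m) := by gcongr
    _ = _ := by rw [← mul_pow]; ring_nf

/-! ### Log-concave densities on the line and the growth of polynomials against them. -/

/-- A density on the line which is log-concave. -/
structure IsLogConcaveDensity (r : ℝ → ℝ) : Prop where
  nonneg : ∀ t, 0 ≤ r t
  integrable : Integrable r
  bddAbove : BddAbove (range r)
  measurable : Measurable r
  log_concave : ∀ ⦃a b : ℝ⦄, 0 < a → 0 < b → a + b = 1 → ∀ x y, r x ^ a * r y ^ b ≤ r (a * x + b * y)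
  integral_pos : 0 < ∫ t, r t

namespace IsLogConcaveDensity

variable {r : ℝ → ℝ}

/-- The supremum need not be attained; a point within a factor `2` of it serves as the mode. -/
theorem exists_near_max (hr : IsLogConcaveDensity r) : ∃ c, 0 < r c ∧ ∀ t, r t ≤ 2 * r c := by
  have hpos : 0 < ⨆ t, r t := by
    by_contra h
    have h0 : ∀ t, r t = 0 := fun t =>
      le_antisymm ((le_ciSup hr.bddAbove t).trans (not_lt.1 h)) (hr.nonneg t)
    have := hr.integral_pos
    simp [h0] at this
  obtain ⟨c, hc⟩ := exists_lt_of_lt_ciSup (half_lt_self hpos)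
  exact ⟨c, by linarith, fun t => by linarith [le_ciSup hr.bddAbove t]⟩

theorem lineMap_le (hr : IsLogConcaveDensity r) {θ : ℝ} (h0 : 0 ≤ θ) (h1 : θ ≤ 1) (x y : ℝ) :
    r x ^ (1 - θ) * r y ^ θ ≤ r ((1 - θ) * x + θ * y) := by
  rcases h0.eq_or_lt with rfl | h0
  · simp
  rcases h1.eq_or_lt with rfl | h1
  · simp
  exact hr.log_concave (by linarith) h0 (by ring) x y

theorem ordConnected_superlevel (hr : IsLogConcaveDensity r) {s : ℝ} (hs : 0 ≤ s) :
    OrdConnected {t | s < r t} := by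
  refine Convex.ordConnected (𝕜 := ℝ) (convex_iff_forall_pos.2 ?_)
  intro x hx y hy a b ha hb hab
  have h := hr.log_concave ha hb hab x y
  simp only [mem_ofPred_eq, smul_eq_mul] at *
  refine lt_of_lt_of_le ?_ h
  rcases hs.eq_or_lt with rfl | hs
  · exact mul_pos (Real.rpow_pos_of_pos hx _) (Real.rpow_pos_of_pos hy _)
  · calc s = s ^ a * s ^ b := by rw [← Real.rpow_add hs, hab, Real.rpow_one]
      _ < r x ^ a * r y ^ b := mul_lt_mul'' (Real.rpow_lt_rpow hs.le hx ha)
        (Real.rpow_lt_rpow hs.le hy hb) (by positivity) (by positivity)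

/-- If `r` drops from `c` to `t` by a factor `exp (-y)`, log-concavity keeps it above `r c / e` on
the initial fraction `1 / max 1 y` of the segment. The mass of that piece is at most the total,
which forces `y` to grow linearly with the distance. The `2` in the exponent covers the region near
`c`, where `r` may exceed `r c` by a factor `2 < e`. -/
theorem le_exp (hr : IsLogConcaveDensity r) {c : ℝ} (hc : 0 < r c) (hmax : ∀ t, r t ≤ 2 * r c)
    (t : ℝ) : r t ≤ r c * Real.exp (2 - r c / (∫ t, r t) * |t - c| / Real.exp 1) := by
  set I := ∫ t, r t with hI
  have hI0 : 0 < I := hr.integral_pos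
  rcases (hr.nonneg t).eq_or_lt with h0 | hpos
  · rw [← h0]; positivity
  set y := Real.log (r c / r t) with hy
  have hrt : r t = r c * Real.exp (-y) := by
    rw [hy, Real.exp_neg, Real.exp_log (by positivity)]; field_simp
  have hy1 : -1 ≤ y := by
    by_contra h
    push Not at h
    have h1 : Real.exp 1 ≤ Real.exp (-y) := Real.exp_le_exp.2 (by linarith)
    have h2 : (2 : ℝ) < Real.exp 1 := by linarith [Real.exp_one_gt_d9]
    have := hmax t
    rw [hrt] at this
    nlinarith
  set θ := 1 / max 1 y with hθ
  have hmx : 0 < max 1 y := lt_of_lt_of_le one_pos (le_max_left _ _)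
  have hθ0 : 0 < θ := by positivity
  have hθ1 : θ ≤ 1 := by rw [hθ, div_le_one hmx]; exact le_max_left _ _
  have hθy : θ * y ≤ 1 := by rw [hθ, one_div, inv_mul_le_one₀ hmx]; exact le_max_right _ _
  have hseg : ∀ s ∈ segment ℝ c (c + θ * (t - c)), r c / Real.exp 1 ≤ r s := by
    rintro s ⟨a, b, ha, hb, hab, rfl⟩
    have h := hr.lineMap_le (θ := b * θ) (by positivity) (by nlinarith) c t
    have e : (1 - b * θ) * c + b * θ * t = a • c + b • (c + θ * (t - c)) := by
      have : a = 1 - b := by linarith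
      subst this
      simp only [smul_eq_mul]; ring
    rw [e] at h
    refine le_trans ?_ h
    rw [hrt, Real.mul_rpow hc.le (Real.exp_pos _).le, ← mul_assoc, ← Real.rpow_add hc,
      sub_add_cancel, Real.rpow_one, ← Real.exp_mul, div_eq_mul_inv, ← Real.exp_neg]
    gcongr
    nlinarith
  have hvol : volume.real (segment ℝ c (c + θ * (t - c))) = θ * |t - c| := by
    rw [segment_eq_uIcc, Real.volume_real_interval, add_sub_cancel_left, abs_mul,
      abs_of_pos hθ0]
  have hmass : θ * |t - c| * (r c / Real.exp 1) ≤ I := by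
    calc θ * |t - c| * (r c / Real.exp 1)
        = ∫ s in segment ℝ c (c + θ * (t - c)), r c / Real.exp 1 := by
          rw [setIntegral_const, hvol, smul_eq_mul]
      _ ≤ ∫ s in segment ℝ c (c + θ * (t - c)), r s := by
          refine setIntegral_mono_on ?_ hr.integrable.integrableOn ?_ hseg
          · refine integrableOn_const ?_
            rw [segment_eq_uIcc]; exact isCompact_uIcc.measure_ne_top
          · rw [segment_eq_uIcc]; exact measurableSet_uIcc
      _ ≤ I := setIntegral_le_integral hr.integrable (ae_of_all _ hr.nonneg)
  have hkey : r c / I * |t - c| / Real.exp 1 ≤ max 1 y := by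
    have : |t - c| * (r c / Real.exp 1) ≤ I * max 1 y := by
      rw [hθ] at hmass
      have h2 := mul_le_mul_of_nonneg_right hmass hmx.le
      calc |t - c| * (r c / Real.exp 1) = 1 / max 1 y * |t - c| * (r c / Real.exp 1) * max 1 y := by
            field_simp
        _ ≤ _ := h2
    calc r c / I * |t - c| / Real.exp 1 = |t - c| * (r c / Real.exp 1) / I := by ring
      _ ≤ max 1 y := by rw [div_le_iff₀ hI0]; linarith
  rw [hrt]
  gcongr
  rcases max_choice 1 y with h | h <;> rw [h] at hkey <;> linarith

/-- The share of a set which is sparse when seen from `t`. -/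
theorem setLIntegral_le_of_sparse (hr : IsLogConcaveDensity r) {c : ℝ} (hc : 0 < r c)
    (hmax : ∀ t, r t ≤ 2 * r c) {V : Set ℝ} (hV : MeasurableSet V) {t δ : ℝ} (hδ : 0 < δ)
    (hsparse : ∀ E ⊆ V, IsCompact E → ∀ α β, E ⊆ Icc α β → t ∈ Icc α β →
      volume.real E ≤ δ * (β - α)) :
    ∫⁻ s in V, ENNReal.ofReal (r s)
      ≤ ENNReal.ofReal (2 * δ * ((∫ s, r s) + r c * |t - c|)) := by
  -- Below level `r c` a superlevel set is an interval containing `c`, so enlarging it to contain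
  -- `t` adds length at most `|t - c|`.
  have level : ∀ s ∈ Ioo 0 (r c), volume ({x | s < r x} ∩ V)
      ≤ ENNReal.ofReal δ * (volume {x | s < r x} + ENNReal.ofReal |t - c|) := by
    intro s hs
    set I := {x | s < r x} with hI
    have hIm : MeasurableSet I := measurableSet_lt measurable_const hr.measurable
    have hIo : OrdConnected I := hr.ordConnected_superlevel hs.1.le
    have hcI : c ∈ I := hs.2
    rw [(hIm.inter hV).measure_eq_iSup_isCompact]
    refine iSup₂_le fun E hE => iSup_le fun hEc => ?_
    have hEc' : IsCompact (insert c E) := hEc.insert c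
    obtain ⟨β, hβ, hβ'⟩ := hEc'.exists_isGreatest ⟨c, by simp⟩
    obtain ⟨α, hα, hα'⟩ := hEc'.exists_isLeast ⟨c, by simp⟩
    have hsub : insert c E ⊆ I := insert_subset hcI fun x hx => (hE hx).1
    have hαβ : Icc α β ⊆ I := hIo.out (hsub hα) (hsub hβ)
    have hcα : α ≤ c := hα' (by simp)
    have hcβ : c ≤ β := hβ' (by simp)
    have h1 := hsparse E (fun x hx => (hE hx).2) hEc (min α t) (max β t)
      (fun x hx => ⟨(min_le_left _ _).trans (hα' (by simp [hx])),
        (hβ' (by simp [hx])).trans (le_max_left _ _)⟩) ⟨min_le_right _ _, le_max_right _ _⟩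
    have h2 : max β t - min α t ≤ (β - α) + |t - c| := by
      rcases le_total β t with h | h <;> rcases le_total α t with h' | h' <;>
        simp only [max_eq_left, max_eq_right, min_eq_left, min_eq_right, h, h'] <;>
        cases abs_cases (t - c) <;> linarith
    have h3 : ENNReal.ofReal (β - α) ≤ volume I := by
      rw [← Real.volume_Icc]; exact measure_mono hαβ
    calc volume E = ENNReal.ofReal (volume.real E) := by
          rw [measureReal_def, ENNReal.ofReal_toReal hEc.measure_ne_top]
      _ ≤ ENNReal.ofReal (δ * ((β - α) + |t - c|)) :=
          ENNReal.ofReal_le_ofReal (h1.trans (mul_le_mul_of_nonneg_left h2 hδ.le))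
      _ = ENNReal.ofReal δ * (ENNReal.ofReal (β - α) + ENNReal.ofReal |t - c|) := by
          rw [ENNReal.ofReal_mul hδ.le, ENNReal.ofReal_add (by linarith) (abs_nonneg _)]
      _ ≤ _ := by gcongr
  have hmeas : Measurable fun s : ℝ => volume {x | s < r x} :=
    Antitone.measurable fun s t hst => measure_mono fun x hx => lt_of_le_of_lt hst hx
  -- Truncating at `r c` leaves only the levels treated above, and `hmax` makes the truncation cost
  -- a factor `2`.
  have hmin : ∫⁻ s in V, ENNReal.ofReal (min (r s) (r c))
      ≤ ENNReal.ofReal δ * (ENNReal.ofReal (∫ s, r s) + ENNReal.ofReal (r c * |t - c|)) := by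
    rw [lintegral_eq_lintegral_meas_lt (volume.restrict V)
      (ae_of_all _ fun s => le_min (hr.nonneg s) hc.le) (hr.measurable.min measurable_const).aemeasurable]
    have hlay : ENNReal.ofReal (∫ s, r s) = ∫⁻ s in Ioi 0, volume {x | s < r x} := by
      rw [ofReal_integral_eq_lintegral_ofReal hr.integrable (ae_of_all _ hr.nonneg),
        lintegral_eq_lintegral_meas_lt volume (ae_of_all _ hr.nonneg) hr.measurable.aemeasurable]
    calc ∫⁻ s in Ioi (0 : ℝ), (volume.restrict V) {x | s < min (r x) (r c)}
        ≤ ∫⁻ s in Ioi (0 : ℝ), (Ioo 0 (r c)).indicator (fun s =>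
            ENNReal.ofReal δ * (volume {x | s < r x} + ENNReal.ofReal |t - c|)) s := by
          refine setLIntegral_mono ((measurable_const.mul
            (hmeas.add measurable_const)).indicator measurableSet_Ioo) fun s hs => ?_
          by_cases hsc : s < r c
          · rw [indicator_of_mem (show s ∈ Ioo 0 (r c) from ⟨hs, hsc⟩),
              Measure.restrict_apply (measurableSet_lt measurable_const
                (hr.measurable.min measurable_const))]
            refine le_trans (measure_mono ?_) (level s ⟨hs, hsc⟩)
            exact fun x hx => ⟨(lt_min_iff.1 (show s < min (r x) (r c) from hx.1)).1, hx.2⟩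
          · have : {x | s < min (r x) (r c)} = ∅ := by
              ext x; simp [hsc]
            rw [this]; simp
      _ = ∫⁻ s in Ioo 0 (r c),
            ENNReal.ofReal δ * (volume {x | s < r x} + ENNReal.ofReal |t - c|) := by
          rw [setLIntegral_indicator measurableSet_Ioo,
            inter_eq_self_of_subset_left Ioo_subset_Ioi_self]
      _ = ENNReal.ofReal δ * ((∫⁻ s in Ioo 0 (r c), volume {x | s < r x})
            + ENNReal.ofReal (r c * |t - c|)) := by
          rw [lintegral_const_mul' _ _ ENNReal.ofReal_ne_top, lintegral_add_left hmeas,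
            setLIntegral_const, Real.volume_Ioo, sub_zero, ← ENNReal.ofReal_mul (abs_nonneg _),
            mul_comm |t - c|]
      _ ≤ _ := by
          rw [hlay]
          gcongr
          exact Ioo_subset_Ioi_self
  calc ∫⁻ s in V, ENNReal.ofReal (r s)
      ≤ ∫⁻ s in V, 2 * ENNReal.ofReal (min (r s) (r c)) := by
        refine lintegral_mono fun s => ?_
        rw [← ENNReal.ofReal_ofNat, ← ENNReal.ofReal_mul (by norm_num)]
        refine ENNReal.ofReal_le_ofReal ?_
        rcases min_choice (r s) (r c) with h | h <;> rw [h]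
        · linarith [hr.nonneg s]
        · exact hmax s
    _ = 2 * ∫⁻ s in V, ENNReal.ofReal (min (r s) (r c)) := by
        rw [lintegral_const_mul _ (hr.measurable.min measurable_const).ennreal_ofReal]
    _ ≤ 2 * (ENNReal.ofReal δ * (ENNReal.ofReal (∫ s, r s) + ENNReal.ofReal (r c * |t - c|))) := by
        gcongr
    _ = _ := by
        rw [← ENNReal.ofReal_add hr.integral_pos.le (by positivity), ← ENNReal.ofReal_mul hδ.le,
          ← ENNReal.ofReal_ofNat, ← ENNReal.ofReal_mul (by norm_num), mul_assoc]

/-- Remez says that the sublevel set is sparse as seen from `t`, with density of order `(ε / |p t|)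
^ (1 / m)`. Its share of the mass is then small unless `|p t|` obeys the stated bound. -/
theorem abs_eval_le (hr : IsLogConcaveDensity r) {c : ℝ} (hc : 0 < r c)
    (hmax : ∀ t, r t ≤ 2 * r c) {p : Polynomial ℝ} {m : ℕ} (hm : 1 ≤ m) (hp : p.natDegree ≤ m)
    {ε v : ℝ} (hε : 0 < ε) (hv : 0 < v)
    (hV : v * ∫ s, r s ≤ ∫ s in {s | |p.eval s| ≤ ε}, r s) (t : ℝ) :
    |p.eval t| ≤ ε * (8 * Real.exp 1 * (1 + r c / (∫ s, r s) * |t - c|) / v) ^ m := by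
  set I := ∫ s, r s with hI
  have hI0 : 0 < I := hr.integral_pos
  rcases (abs_nonneg (p.eval t)).eq_or_lt with h0 | hpos
  · rw [← h0]; positivity
  set P := |p.eval t| with hP
  have hm0 : (m : ℝ) ≠ 0 := by exact_mod_cast (by omega : m ≠ 0)
  set η := (ε / P) ^ (1 / (m : ℝ)) with hη
  have hηm : η ^ m = ε / P := by
    rw [hη, ← Real.rpow_natCast, ← Real.rpow_mul (by positivity), one_div,
      inv_mul_cancel₀ hm0, Real.rpow_one]
  have hη0 : 0 < η := by positivity
  have hVm : MeasurableSet {s | |p.eval s| ≤ ε} :=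
    measurableSet_le (p.continuous.abs.measurable) measurable_const
  have hsp := hr.setLIntegral_le_of_sparse hc hmax hVm (t := t)
    (δ := 4 * Real.exp 1 * η) (by positivity) (by
      intro E hE hEc α β hEI ht
      have hR := abs_eval_mul_volume_pow_le hm hp hε.le hEc (fun x hx => hE hx) hEI ht
      have hαβ : 0 ≤ β - α := by linarith [ht.1, ht.2]
      refine (pow_le_pow_iff_left₀ measureReal_nonneg (by positivity) (by omega : m ≠ 0)).1 ?_
      rw [show 4 * Real.exp 1 * η * (β - α) = η * (4 * Real.exp 1 * (β - α)) by ring, mul_pow, hηm,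
        div_mul_eq_mul_div, le_div_iff₀ hpos, mul_comm]
      exact hR)
  rw [← ofReal_integral_eq_lintegral_ofReal hr.integrable.integrableOn (ae_of_all _ hr.nonneg),
    ENNReal.ofReal_le_ofReal_iff (by positivity)] at hsp
  have h1 : v * I ≤ 2 * (4 * Real.exp 1 * η) * (I + r c * |t - c|) := hV.trans hsp
  have h2 : v ≤ η * (8 * Real.exp 1 * (1 + r c / I * |t - c|)) := by
    refine le_of_mul_le_mul_right ?_ hI0
    calc v * I ≤ 2 * (4 * Real.exp 1 * η) * (I + r c * |t - c|) := h1
      _ = _ := by field_simp; ring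
  have h3 : v ^ m ≤ ε / P * (8 * Real.exp 1 * (1 + r c / I * |t - c|)) ^ m := by
    rw [← hηm, ← mul_pow]; exact pow_le_pow_left₀ hv.le h2 m
  rw [div_pow, ← mul_div_assoc, le_div_iff₀ (by positivity)]
  rw [div_mul_eq_mul_div, le_div_iff₀ hpos] at h3
  linarith

theorem integrable_exp_neg_mul_abs_sub {a : ℝ} (ha : 0 < a) (c : ℝ) :
    Integrable (fun t : ℝ => Real.exp (-a * |t - c|)) ∧
      ∫ t : ℝ, Real.exp (-a * |t - c|) = 2 / a := by
  have hval : ∫ t : ℝ, Real.exp (-a * |t - c|) = 2 / a := by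
    rw [integral_sub_right_eq_self (fun t : ℝ => Real.exp (-a * |t|)) c,
      integral_comp_abs (f := fun t => Real.exp (-a * t)), integral_exp_mul_Ioi (by linarith)]
    simp [div_eq_mul_inv]
  refine ⟨?_, hval⟩
  -- A nonintegrable function would have integral `0`, not `2 / a`.
  by_contra h
  rw [integral_undef h] at hval
  exact absurd hval (by positivity)

/-- Polynomials with respect to a log-concave density on the line: a lower bound for the mass
of a sublevel set gives an upper bound for the second moment. -/
theorem lintegral_sq_mul_le (hr : IsLogConcaveDensity r) {p : Polynomial ℝ} {m : ℕ} (hm : 1 ≤ m)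
    (hp : p.natDegree ≤ m) {ε v : ℝ} (hε : 0 < ε) (hv : 0 < v)
    (hV : v * ∫ s, r s ≤ ∫ s in {s | |p.eval s| ≤ ε}, r s) :
    ∫⁻ t, ENNReal.ofReal (p.eval t ^ 2 * r t)
      ≤ ENNReal.ofReal (ε ^ 2 * (32 * Real.exp 5 * m / v) ^ (2 * m) * ∫ s, r s) := by
  obtain ⟨c, hc, hmax⟩ := hr.exists_near_max
  set I := ∫ s, r s with hI
  have hI0 : 0 < I := hr.integral_pos
  set κ := r c / I with hκ
  have hκ0 : 0 < κ := by positivity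
  -- Half of the decay rate `κ / e` of `r`; the other half absorbs the power `(1 + κ D) ^ (2 * m)`
  -- through `x ^ k / k! ≤ exp x`.
  set a := κ / (2 * Real.exp 1) with ha
  have ha0 : 0 < a := by positivity
  set e := Real.exp 1 with he
  have he0 : 0 < e := Real.exp_pos 1
  set A := ε ^ 2 * (8 * e / v) ^ (2 * m) * ((2 * m).factorial * (2 * e) ^ (2 * m)) * r c
    * Real.exp 3 with hA
  have hpt : ∀ t, p.eval t ^ 2 * r t ≤ A * Real.exp (-a * |t - c|) := by
    intro t
    set D := |t - c| with hD
    have hD0 : 0 ≤ D := abs_nonneg _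
    have h1 := hr.abs_eval_le hc hmax hm hp hε hv hV t
    have h2 := hr.le_exp hc hmax t
    have h3 : p.eval t ^ 2 ≤ ε ^ 2 * (8 * e / v) ^ (2 * m) * (1 + κ * D) ^ (2 * m) := by
      rw [← sq_abs]
      calc |p.eval t| ^ 2 ≤ (ε * (8 * e * (1 + κ * D) / v) ^ m) ^ 2 := by gcongr
        _ = _ := by
          rw [mul_pow ε, ← pow_mul, mul_comm m 2, mul_assoc (ε ^ 2), ← mul_pow]; ring_nf
    have h4 : (1 + κ * D) ^ (2 * m)
        ≤ (2 * m).factorial * (2 * e) ^ (2 * m) * Real.exp ((1 + κ * D) / (2 * e)) := by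
      have := Real.pow_div_factorial_le_exp ((1 + κ * D) / (2 * e)) (by positivity) (2 * m)
      rw [div_le_iff₀ (by positivity), div_pow, div_le_iff₀ (by positivity)] at this
      linarith
    have h5 : Real.exp ((1 + κ * D) / (2 * e)) * Real.exp (2 - κ * D / e)
        ≤ Real.exp 3 * Real.exp (-a * D) := by
      rw [← Real.exp_add, ← Real.exp_add, Real.exp_le_exp]
      have : 1 / (2 * e) ≤ 1 := by
        rw [div_le_one (by positivity)]; linarith [Real.add_one_le_exp 1]
      have e1 : (1 + κ * D) / (2 * e) + (2 - κ * D / e) = 2 + 1 / (2 * e) + -a * D := by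
        rw [ha]; field_simp; ring
      rw [e1]; linarith
    calc p.eval t ^ 2 * r t
        ≤ (ε ^ 2 * (8 * e / v) ^ (2 * m) * ((2 * m).factorial * (2 * e) ^ (2 * m)
            * Real.exp ((1 + κ * D) / (2 * e)))) * (r c * Real.exp (2 - κ * D / e)) := by
          exact mul_le_mul (h3.trans (by gcongr)) h2 (hr.nonneg t) (by positivity)
      _ = ε ^ 2 * (8 * e / v) ^ (2 * m) * ((2 * m).factorial * (2 * e) ^ (2 * m)) * r c *
            (Real.exp ((1 + κ * D) / (2 * e)) * Real.exp (2 - κ * D / e)) := by ring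
      _ ≤ ε ^ 2 * (8 * e / v) ^ (2 * m) * ((2 * m).factorial * (2 * e) ^ (2 * m)) * r c *
            (Real.exp 3 * Real.exp (-a * D)) := by gcongr
      _ = _ := by rw [hA]; ring
  obtain ⟨hint, hval⟩ := integrable_exp_neg_mul_abs_sub ha0 c
  calc ∫⁻ t, ENNReal.ofReal (p.eval t ^ 2 * r t)
      ≤ ∫⁻ t, ENNReal.ofReal (A * Real.exp (-a * |t - c|)) :=
        lintegral_mono fun t => ENNReal.ofReal_le_ofReal (hpt t)
    _ = ENNReal.ofReal (A * (2 / a)) := by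
        rw [← ofReal_integral_eq_lintegral_ofReal (hint.const_mul A), integral_const_mul, hval]
        exact ae_of_all _ fun t => by positivity
    _ ≤ _ := by
        refine ENNReal.ofReal_le_ofReal ?_
        have hfac : ((2 * m).factorial : ℝ) ≤ (2 * m : ℝ) ^ (2 * m) := by
          exact_mod_cast Nat.factorial_le_pow (2 * m)
        -- Absolute factors are moved under the power `2 * m`, which is possible because `m ≥ 1`.
        have e4 : 4 * Real.exp 4 ≤ (Real.exp 3) ^ (2 * m) := by
          calc 4 * Real.exp 4 ≤ Real.exp 2 * Real.exp 4 := by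
                gcongr
                have := Real.exp_one_gt_d9
                rw [show (2 : ℝ) = 1 + 1 by norm_num, Real.exp_add]; nlinarith
            _ = Real.exp 3 ^ (2 * 1) := by rw [← Real.exp_add, ← Real.exp_nat_mul]; norm_num
            _ ≤ _ := pow_le_pow_right₀ (Real.one_le_exp (by norm_num)) (by omega)
        have eA : A * (2 / a) = ε ^ 2 * (16 * e ^ 2 / v) ^ (2 * m) * (2 * m).factorial
            * (4 * Real.exp 4) * I := by
          have : r c * (2 / a) = 4 * e * I := by rw [ha, hκ]; field_simp; norm_num
          have e4' : Real.exp 4 = e * Real.exp 3 := by rw [he, ← Real.exp_add]; norm_num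
          rw [hA, e4']
          calc _ = ε ^ 2 * ((8 * e / v) ^ (2 * m) * (2 * e) ^ (2 * m)) * (2 * m).factorial *
                Real.exp 3 * (r c * (2 / a)) := by ring
            _ = _ := by rw [this, ← mul_pow]; ring_nf
        rw [eA]
        calc _ ≤ ε ^ 2 * (16 * e ^ 2 / v) ^ (2 * m) * (2 * m : ℝ) ^ (2 * m)
              * (Real.exp 3) ^ (2 * m) * I := by gcongr
          _ = _ := by
            have e5 : Real.exp 5 = e ^ 2 * Real.exp 3 := by
              rw [he, ← Real.exp_nat_mul, ← Real.exp_add]; norm_num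
            rw [e5, mul_assoc (ε ^ 2), mul_assoc (ε ^ 2), ← mul_pow, ← mul_pow]
            ring_nf

end IsLogConcaveDensity

/-! ### Localization by bisection with half-spaces. -/

/-- The half-space `cos θ (x_j - a) + sin θ (x_k - b) ≥ 0`. -/
def halfSpace {ι : Type*} (j k : ι) (a b θ : ℝ) : Set (EuclideanSpace ℝ ι) :=
  {x | 0 ≤ Real.cos θ * (x j - a) + Real.sin θ * (x k - b)}

section Bisection

variable {ι : Type*}

theorem isClosed_halfSpace (j k : ι) (a b θ : ℝ) : IsClosed (halfSpace j k a b θ) :=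
  isClosed_le continuous_const (by fun_prop)

theorem convex_halfSpace (j k : ι) (a b θ : ℝ) : Convex ℝ (halfSpace j k a b θ) := by
  intro x hx y hy s t hs ht hst
  simp only [halfSpace, mem_ofPred_eq, PiLp.add_apply, PiLp.smul_apply, smul_eq_mul] at *
  have : Real.cos θ * (s * x j + t * y j - a) + Real.sin θ * (s * x k + t * y k - b)
      = s * (Real.cos θ * (x j - a) + Real.sin θ * (x k - b))
        + t * (Real.cos θ * (y j - a) + Real.sin θ * (y k - b)) := by
    have : t = 1 - s := by linarith
    subst this; ring
  rw [this]; positivity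

/-- Turning by `π` swaps the two sides of the line through `(a, b)`. The integral of `h` over one
side is continuous in the angle since boundaries are null, so some angle splits it equally. Both
sides then keep the sign of `h`, and at least one has a positive integral of `g`. -/
theorem exists_halfSpace_bisecting [Fintype ι] {μ : Measure (EuclideanSpace ℝ ι)} {j k : ι} {a b : ℝ}
    (hnull : ∀ θ, μ {x | Real.cos θ * (x j - a) + Real.sin θ * (x k - b) = 0} = 0)
    {h g : EuclideanSpace ℝ ι → ℝ} (hh : Integrable h μ) (hg : Integrable g μ)
    {K : Set (EuclideanSpace ℝ ι)} (hK : MeasurableSet K)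
    (hhK : 0 ≤ ∫ x in K, h x ∂μ) (hgK : 0 < ∫ x in K, g x ∂μ) :
    ∃ θ, 0 ≤ ∫ x in K ∩ halfSpace j k a b θ, h x ∂μ ∧
      0 < ∫ x in K ∩ halfSpace j k a b θ, g x ∂μ := by
  have hHm : ∀ θ, MeasurableSet (halfSpace j k a b θ) := fun θ =>
    (isClosed_halfSpace j k a b θ).measurableSet
  have split : ∀ (u : EuclideanSpace ℝ ι → ℝ), Integrable u μ → ∀ θ,
      (∫ x in K ∩ halfSpace j k a b θ, u x ∂μ) + ∫ x in K ∩ halfSpace j k a b (θ + Real.pi), u x ∂μ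
        = ∫ x in K, u x ∂μ := by
    intro u hu θ
    rw [← setIntegral_union₀ _ (hK.inter (hHm _)).nullMeasurableSet hu.integrableOn
      hu.integrableOn, ← inter_union_distrib_left]
    · have : halfSpace j k a b θ ∪ halfSpace j k a b (θ + Real.pi) = univ := by
        ext x
        simp only [halfSpace, mem_union, mem_ofPred_eq, mem_univ, iff_true, Real.cos_add_pi,
          Real.sin_add_pi]
        rcases le_total 0 (Real.cos θ * (x j - a) + Real.sin θ * (x k - b)) with h | h
        · exact Or.inl h
        · right; linarith
      rw [this, inter_univ]
    · refine measure_mono_null ?_ (hnull θ)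
      rintro x ⟨⟨-, h1⟩, ⟨-, h2⟩⟩
      simp only [halfSpace, mem_ofPred_eq, Real.cos_add_pi, Real.sin_add_pi] at h1 h2 ⊢
      linarith
  set F : ℝ → ℝ := fun θ => ∫ x in K ∩ halfSpace j k a b θ, h x ∂μ with hF
  have hFind : ∀ θ, F θ = ∫ x in K, (halfSpace j k a b θ).indicator h x ∂μ := by
    intro θ
    rw [hF]
    simp only
    rw [setIntegral_indicator (hHm θ)]
  have hcont : Continuous F := by
    rw [continuous_iff_continuousAt]
    intro θ₀
    rw [show F = fun θ => ∫ x in K, (halfSpace j k a b θ).indicator h x ∂μ from funext hFind]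
    refine continuousAt_of_dominated (bound := fun x => ‖h x‖) ?_ ?_ hh.norm.integrableOn ?_
    · exact Filter.Eventually.of_forall fun θ =>
        (hh.integrableOn.aestronglyMeasurable).indicator (hHm θ)
    · exact Filter.Eventually.of_forall fun θ => ae_of_all _ fun x => norm_indicator_le_norm_self _ _
    · have hae : ∀ᵐ x ∂(μ.restrict K),
          Real.cos θ₀ * (x j - a) + Real.sin θ₀ * (x k - b) ≠ 0 :=
        ae_restrict_of_ae (by simpa [ae_iff] using hnull θ₀)
      filter_upwards [hae] with x hx
      have hc : Continuous fun θ => Real.cos θ * (x j - a) + Real.sin θ * (x k - b) := by fun_prop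
      rcases lt_or_gt_of_ne hx with hneg | hpos
      · refine ContinuousAt.congr (f := fun _ => (0 : ℝ)) continuousAt_const ?_
        filter_upwards [hc.continuousAt.eventually_lt continuousAt_const hneg] with θ hθ
        rw [indicator_of_notMem]
        simpa [halfSpace] using hθ
      · refine ContinuousAt.congr (f := fun _ => h x) continuousAt_const ?_
        filter_upwards [continuousAt_const.eventually_lt hc.continuousAt hpos] with θ hθ
        rw [indicator_of_mem]
        exact hθ.le
  set I := ∫ x in K, h x ∂μ with hI
  have hsum : ∀ θ, F θ + F (θ + Real.pi) = I := split h hh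
  obtain ⟨θ, hθ⟩ : ∃ θ, F θ = I / 2 := by
    have h0 := hsum 0
    rcases le_total (F 0) (I / 2) with h1 | h1
    · exact mem_range_of_exists_le_of_exists_ge hcont ⟨0, h1⟩ ⟨0 + Real.pi, by linarith⟩
    · exact mem_range_of_exists_le_of_exists_ge hcont ⟨0 + Real.pi, by linarith⟩ ⟨0, h1⟩
  have hθ' : F (θ + Real.pi) = I / 2 := by linarith [hsum θ]
  have hgsum := split g hg θ
  by_cases hpos : 0 < ∫ x in K ∩ halfSpace j k a b θ, g x ∂μ
  · exact ⟨θ, by change 0 ≤ F θ; rw [hθ]; positivity, hpos⟩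
  · exact ⟨θ + Real.pi, by change 0 ≤ F (θ + Real.pi); rw [hθ']; positivity, by linarith⟩

/-- An affine function that vanishes at an interior point of a triangle and is nonnegative at its
vertices vanishes at all of them: a positive combination of its vertex values is zero. -/
theorem eq_zero_of_barycentric_nonneg {p q x y : ℝ} (hp : 0 < p) (hq : 0 < q) (hpq : p + q < 1)
    (h1 : 0 ≤ -(p * x) - q * y) (h2 : 0 ≤ -(p * x) - q * y + x) (h3 : 0 ≤ -(p * x) - q * y + y) :
    x = 0 ∧ y = 0 := by
  generalize hA : -(p * x) - q * y = A at *
  have e : (1 - p - q) * A + p * (A + x) + q * (A + y) = 0 := by linear_combination -hA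
  have n1 := mul_nonneg (by linarith : (0 : ℝ) ≤ 1 - p - q) h1
  have n2 := mul_nonneg hp.le h2
  have n3 := mul_nonneg hq.le h3
  have z1 := (mul_eq_zero.1 (by linarith : (1 - p - q) * A = 0)).resolve_left (by linarith)
  have z2 := (mul_eq_zero.1 (by linarith : p * (A + x) = 0)).resolve_left hp.ne'
  have z3 := (mul_eq_zero.1 (by linarith : q * (A + y) = 0)).resolve_left hq.ne'
  constructor <;> linarith

/-- Otherwise `a`, `b`, `c` would project to a nondegenerate triangle in the `(j, k)`-plane, with a
rational point in its interior. The half-plane through that point cannot contain the triangle, since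
its normal `(cos θ, sin θ)` is nonzero. -/
theorem minor_eq_zero_of_halfSpace {S : Set (EuclideanSpace ℝ ι)} {j k : ι}
    (hS : ∀ r s : ℚ, ∃ θ, S ⊆ halfSpace j k r s θ) {a b c : EuclideanSpace ℝ ι} (ha : a ∈ S)
    (hb : b ∈ S) (hc : c ∈ S) :
    (b j - a j) * (c k - a k) - (b k - a k) * (c j - a j) = 0 := by
  by_contra hD
  set v₁ := b j - a j with hv₁
  set v₂ := b k - a k with hv₂
  set w₁ := c j - a j with hw₁
  set w₂ := c k - a k with hw₂
  set D := v₁ * w₂ - v₂ * w₁ with hDdef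
  let σ : ℝ × ℝ → ℝ := fun y => ((y.1 - a j) * w₂ - (y.2 - a k) * w₁) / D
  let τ : ℝ × ℝ → ℝ := fun y => (v₁ * (y.2 - a k) - v₂ * (y.1 - a j)) / D
  have hσ : Continuous σ := by fun_prop
  have hτ : Continuous τ := by fun_prop
  have hopen : IsOpen {y | 0 < σ y ∧ 0 < τ y ∧ σ y + τ y < 1} :=
    (isOpen_lt continuous_const hσ).inter ((isOpen_lt continuous_const hτ).inter
      (isOpen_lt (hσ.add hτ) continuous_const))
  have hne : {y | 0 < σ y ∧ 0 < τ y ∧ σ y + τ y < 1}.Nonempty := by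
    refine ⟨(a j + (v₁ + w₁) / 3, a k + (v₂ + w₂) / 3), ?_⟩
    have e1 : σ (a j + (v₁ + w₁) / 3, a k + (v₂ + w₂) / 3) = 1 / 3 := by
      simp only [σ]; rw [div_eq_iff hD, hDdef]; ring
    have e2 : τ (a j + (v₁ + w₁) / 3, a k + (v₂ + w₂) / 3) = 1 / 3 := by
      simp only [τ]; rw [div_eq_iff hD, hDdef]; ring
    simp only [mem_ofPred_eq, e1, e2]; norm_num
  have hdense : DenseRange (Prod.map ((↑) : ℚ → ℝ) ((↑) : ℚ → ℝ)) :=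
    Rat.denseRange_cast.prodMap Rat.denseRange_cast
  obtain ⟨⟨r, s⟩, h1, h2, h3⟩ := hdense.exists_mem_open hopen hne
  obtain ⟨θ, hθ⟩ := hS r s
  have la := hθ ha
  have lb := hθ hb
  have lc := hθ hc
  simp only [Prod.map_apply] at h1 h2 h3
  set p := σ ((r : ℝ), (s : ℝ)) with hp
  set q := τ ((r : ℝ), (s : ℝ)) with hq
  have e1 : (r : ℝ) = a j + p * v₁ + q * w₁ := by
    simp only [hp, hq, σ, τ]; field_simp; rw [hDdef]; ring
  have e2 : (s : ℝ) = a k + p * v₂ + q * w₂ := by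
    simp only [hp, hq, σ, τ]; field_simp; rw [hDdef]; ring
  simp only [halfSpace, mem_ofPred_eq] at la lb lc
  have hbj : b j = a j + v₁ := by rw [hv₁]; ring
  have hbk : b k = a k + v₂ := by rw [hv₂]; ring
  have hcj : c j = a j + w₁ := by rw [hw₁]; ring
  have hck : c k = a k + w₂ := by rw [hw₂]; ring
  rw [e1, e2] at la lb lc
  rw [hbj, hbk] at lb
  rw [hcj, hck] at lc
  set C := Real.cos θ
  set S' := Real.sin θ
  set x := C * v₁ + S' * v₂ with hx
  set y := C * w₁ + S' * w₂ with hy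
  have la' : 0 ≤ -(p * x) - q * y := by linarith
  have lb' : 0 ≤ -(p * x) - q * y + x := by linarith
  have lc' : 0 ≤ -(p * x) - q * y + y := by linarith
  obtain ⟨hx0, hy0⟩ := eq_zero_of_barycentric_nonneg h1 h2 h3 la' lb' lc'
  have hcos : C * D = 0 := by
    have : C * D = x * w₂ - y * v₂ := by rw [hx, hy, hDdef]; ring
    rw [this, hx0, hy0]; ring
  have hsin : S' * D = 0 := by
    have : S' * D = y * v₁ - x * w₁ := by rw [hx, hy, hDdef]; ring
    rw [this, hx0, hy0]; ring
  have hc0 := (mul_eq_zero.1 hcos).resolve_right hD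
  have hs0 := (mul_eq_zero.1 hsin).resolve_right hD
  have := Real.sin_sq_add_cos_sq θ
  rw [show Real.cos θ = 0 from hc0, show Real.sin θ = 0 from hs0] at this
  norm_num at this

/-- With all `2 × 2` minors zero, the differences of points of `S` are proportional. When `S` has at
most one point, the direction is arbitrary. -/
theorem exists_line_of_halfSpace [Fintype ι] [Nonempty ι] {S : Set (EuclideanSpace ℝ ι)}
    (hS : ∀ j k, j ≠ k → ∀ r s : ℚ, ∃ θ, S ⊆ halfSpace j k r s θ) :
    ∃ x₀ ω : EuclideanSpace ℝ ι, ‖ω‖ = 1 ∧ ∀ x ∈ S, x = x₀ + ⟪ω, x - x₀⟫ • ω := by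
  classical
  by_cases hsub : S.Subsingleton
  · rcases S.eq_empty_or_nonempty with rfl | ⟨x₀, hx₀⟩
    · exact ⟨0, EuclideanSpace.single (Classical.arbitrary ι) 1, by simp, by simp⟩
    · refine ⟨x₀, EuclideanSpace.single (Classical.arbitrary ι) 1, by simp, fun x hx => ?_⟩
      rw [hsub hx hx₀]; simp
  obtain ⟨a, ha, b, hb, hab⟩ := not_subsingleton_iff.1 hsub
  have hne : b - a ≠ 0 := sub_ne_zero.2 hab.symm
  have hn : ‖b - a‖ ≠ 0 := norm_ne_zero_iff.2 hne
  obtain ⟨j, hj⟩ : ∃ j, b j - a j ≠ 0 := by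
    by_contra h
    push Not at h
    exact hne (by ext i; simpa using h i)
  refine ⟨a, ‖b - a‖⁻¹ • (b - a), by rw [norm_smul, norm_inv, norm_norm, inv_mul_cancel₀ hn],
    fun c hc => ?_⟩
  have hcr : c - a = ((c j - a j) / (b j - a j)) • (b - a) := by
    ext k
    simp only [PiLp.sub_apply, PiLp.smul_apply, smul_eq_mul]
    rcases eq_or_ne j k with rfl | hjk
    · field_simp
    · have := minor_eq_zero_of_halfSpace (hS j k hjk) ha hb hc
      field_simp
      linarith
  set r := (c j - a j) / (b j - a j)
  have : c = a + r • (b - a) := by rw [← hcr]; abel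
  rw [hcr, inner_smul_right, real_inner_smul_left, real_inner_self_eq_norm_sq, smul_smul, this]
  congr 2
  field_simp

/-- Localization: a convex body on which two integrals have a sign contains convex bodies arbitrarily
close to a line on which they have the same sign. -/
theorem exists_thin_convex [Fintype ι] [Nonempty ι] {μ : Measure (EuclideanSpace ℝ ι)}
    (hnull : ∀ j k, j ≠ k → ∀ a b θ,
      μ {x | Real.cos θ * (x j - a) + Real.sin θ * (x k - b) = 0} = 0)
    {h g : EuclideanSpace ℝ ι → ℝ} (hh : Integrable h μ) (hg : Integrable g μ)
    {K : Set (EuclideanSpace ℝ ι)} (hK : IsCompact K) (hKc : Convex ℝ K)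
    (hhK : 0 ≤ ∫ x in K, h x ∂μ) (hgK : 0 < ∫ x in K, g x ∂μ) {τ : ℝ} (hτ : 0 < τ) :
    ∃ K' ⊆ K, IsCompact K' ∧ Convex ℝ K' ∧ 0 ≤ ∫ x in K', h x ∂μ ∧ 0 < ∫ x in K', g x ∂μ ∧
      ∃ x₀ ω : EuclideanSpace ℝ ι, ‖ω‖ = 1 ∧ ∀ x ∈ K', ‖x - (x₀ + ⟪ω, x - x₀⟫ • ω)‖ < τ := by
  classical
  let P : Set (EuclideanSpace ℝ ι) → Prop := fun L =>
    IsCompact L ∧ Convex ℝ L ∧ 0 ≤ ∫ x in L, h x ∂μ ∧ 0 < ∫ x in L, g x ∂μ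
  have step : ∀ (L : {L // P L}) (d : ι × ι × ℚ × ℚ), ∃ L' : {L // P L}, (L' : Set (EuclideanSpace ℝ ι)) ⊆ L ∧
      (d.1 ≠ d.2.1 → ∃ θ, (L' : Set (EuclideanSpace ℝ ι)) ⊆ halfSpace d.1 d.2.1 d.2.2.1 d.2.2.2 θ) := by
    rintro ⟨L, h1, h2, h3, h4⟩ ⟨j, k, r, s⟩
    by_cases hjk : j = k
    · exact ⟨⟨L, h1, h2, h3, h4⟩, subset_rfl, fun h => absurd hjk h⟩
    · obtain ⟨θ, h5, h6⟩ := exists_halfSpace_bisecting (hnull j k hjk r s) hh hg h1.measurableSet h3 h4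
      exact ⟨⟨L ∩ halfSpace j k r s θ, h1.inter_right (isClosed_halfSpace _ _ _ _ _),
        h2.inter (convex_halfSpace _ _ _ _ _), h5, h6⟩, inter_subset_left,
        fun _ => ⟨θ, inter_subset_right⟩⟩
  choose nxt hsub hhalf using step
  obtain ⟨e, he⟩ := exists_surjective_nat (ι × ι × ℚ × ℚ)
  let seq : ℕ → {L // P L} := fun n => Nat.rec ⟨K, hK, hKc, hhK, hgK⟩ (fun n L => nxt L (e n)) n
  have hseq : ∀ n, seq (n + 1) = nxt (seq n) (e n) := fun n => rfl
  have hanti : Antitone fun n => (seq n).1 :=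
    antitone_nat_of_succ_le fun n => hsub (seq n) (e n)
  obtain ⟨x₀, ω, hω, hline⟩ := exists_line_of_halfSpace
    (S := ⋂ n, (seq n).1) (by
      intro j k hjk r s
      obtain ⟨n, hn⟩ := he (j, k, r, s)
      obtain ⟨θ, hθ⟩ := hhalf (seq n) (e n) (by rw [hn]; exact hjk)
      refine ⟨θ, (iInter_subset _ (n + 1)).trans ?_⟩
      rw [hseq]
      rw [hn] at hθ ⊢
      exact hθ)
  have hopen : IsOpen {x : EuclideanSpace ℝ ι | ‖x - (x₀ + ⟪ω, x - x₀⟫ • ω)‖ < τ} :=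
    isOpen_lt (by fun_prop) continuous_const
  -- The intersection lies on a line, so by compactness some finite stage is already within `τ` of
  -- it. Stopping there preserves the strict inequality for `g`, which could be lost in the limit.
  obtain ⟨n, hn⟩ := exists_subset_nhds_of_isCompact' (hanti.directed_ge)
    (fun n => (seq n).2.1) (fun n => (seq n).2.1.isClosed)
    (U := {x : EuclideanSpace ℝ ι | ‖x - (x₀ + ⟪ω, x - x₀⟫ • ω)‖ < τ}) (fun x hx => by
      refine hopen.mem_nhds ?_
      have := hline x hx
      simp only [mem_ofPred_eq]
      rw [← this, sub_self, norm_zero]; exact hτ)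
  exact ⟨(seq n).1, hanti (Nat.zero_le n), (seq n).2.1, (seq n).2.2.1, (seq n).2.2.2.1, (seq n).2.2.2.2,
    x₀, ω, hω, fun x hx => hn hx⟩

end Bisection

end Universality

/-! ### Gaussian needles and the Carbery–Wright inequality. -/

namespace Universality

open MeasureTheory Set ProbabilityTheory
open scoped ENNReal NNReal RealInnerProductSpace

theorem exists_orthonormalBasis_zero_eq {E : Type*} [NormedAddCommGroup E] [InnerProductSpace ℝ E]
    [FiniteDimensional ℝ E] {k : ℕ} (hk : Module.finrank ℝ E = k + 1) {ω : E} (hω : ‖ω‖ = 1) :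
    ∃ b : OrthonormalBasis (Fin (k + 1)) ℝ E, b 0 = ω := by
  have hv : Orthonormal ℝ (({0} : Set (Fin (k + 1))).domRestrict fun _ => ω) := by
    refine ⟨fun _ => hω, fun i j hij => absurd ?_ hij⟩
    have hi := i.2
    have hj := j.2
    simp only [mem_singleton_iff] at hi hj
    exact Subtype.ext (hi.trans hj.symm)
  obtain ⟨b, hb⟩ := hv.exists_orthonormalBasis_extension_of_card_eq (by simpa using hk)
  exact ⟨b, hb 0 rfl⟩

section Needle

variable {E : Type*} [NormedAddCommGroup E] [InnerProductSpace ℝ E] [FiniteDimensional ℝ E]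
  [MeasurableSpace E] [BorelSpace E]

/-- The marginal, along a direction, of the standard Gaussian measure restricted to a convex set. -/
theorem exists_logConcave_marginal {k : ℕ} (hk : Module.finrank ℝ E = k + 1) {ω : E}
    (hω : ‖ω‖ = 1) {K : Set E} (hK : MeasurableSet K) (hKc : Convex ℝ K)
    (hK0 : stdGaussian E K ≠ 0) :
    ∃ r : ℝ → ℝ, IsLogConcaveDensity r ∧ ∀ u : ℝ → ℝ≥0∞, Measurable u →
      ∫⁻ x in K, u ⟪ω, x⟫ ∂(stdGaussian E) = ∫⁻ t, u t * ENNReal.ofReal (r t) := by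
  obtain ⟨b, hb⟩ := exists_orthonormalBasis_zero_eq hk hω
  let ν : Measure (Fin k → ℝ) := Measure.pi fun _ => gaussianReal 0 1
  let Φ : ℝ × (Fin k → ℝ) → E := fun z => z.1 • b 0 + ∑ i, z.2 i • b i.succ
  have hΦ : Measurable Φ := by
    have : Continuous Φ := by fun_prop
    exact this.measurable
  have hγ : stdGaussian E = ((gaussianReal 0 1).prod ν).map Φ := by
    rw [stdGaussian_eq_map_pi_orthonormalBasis b]
    have e := (measurePreserving_piFinSuccAbove (fun _ : Fin (k + 1) => gaussianReal 0 1) 0)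
    have : (fun x : Fin (k + 1) → ℝ => ∑ i, x i • b i)
        = Φ ∘ (MeasurableEquiv.piFinSuccAbove (fun _ : Fin (k + 1) => ℝ) 0) := by
      ext x
      simp [Φ, Fin.sum_univ_succ, MeasurableEquiv.piFinSuccAbove, Fin.insertNthEquiv, Fin.tail]
    rw [this, ← Measure.map_map hΦ e.measurable, e.map_eq]
  have hinner : ∀ z, ⟪ω, Φ z⟫ = z.1 := by
    intro z
    have h0 : ∀ i : Fin k, ⟪b 0, b i.succ⟫ = 0 := fun i =>
      b.orthonormal.2 (Fin.succ_ne_zero i).symm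
    simp [Φ, ← hb, inner_add_right, inner_sum, inner_smul_right, h0,
      b.orthonormal.1 0]
  have hS : MeasurableSet (Φ ⁻¹' K) := hΦ hK
  -- Gaussian measure of the slice of `K` at height `t`; the density is this times the
  -- one-dimensional Gaussian density.
  let ρ : ℝ → ℝ≥0∞ := fun t => ν (Prod.mk t ⁻¹' (Φ ⁻¹' K))
  have hρm : Measurable ρ := measurable_measure_prodMk_left hS
  have hρ1 : ∀ t, ρ t ≤ 1 := fun t => prob_le_one
  -- Prékopa–Leindler for indicators of slices: by convexity of `K`, slices at `x` and `y` combine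
  -- into the slice at `p * x + q * y`.
  have hρlog : ∀ ⦃a b : ℝ⦄, 0 < a → 0 < b → a + b = 1 → ∀ x y,
      ρ x ^ a * ρ y ^ b ≤ ρ (a * x + b * y) := by
    intro p q hp hq hpq x y
    have hm : ∀ t, MeasurableSet (Prod.mk t ⁻¹' (Φ ⁻¹' K)) := fun t => measurable_prodMk_left hS
    have := prekopaLeindler_pi_gaussianReal k hp hq hpq
      (f := (Prod.mk x ⁻¹' (Φ ⁻¹' K)).indicator 1) (g := (Prod.mk y ⁻¹' (Φ ⁻¹' K)).indicator 1)
      (h := (Prod.mk (p * x + q * y) ⁻¹' (Φ ⁻¹' K)).indicator 1)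
      (measurable_one.indicator (hm _)) (measurable_one.indicator (hm _))
      (measurable_one.indicator (hm _)) (by
        intro z w
        by_cases hz : z ∈ Prod.mk x ⁻¹' (Φ ⁻¹' K)
        · by_cases hw : w ∈ Prod.mk y ⁻¹' (Φ ⁻¹' K)
          · have hmem : p • z + q • w ∈ Prod.mk (p * x + q * y) ⁻¹' (Φ ⁻¹' K) := by
              have h1 := hKc (show Φ (x, z) ∈ K from hz) (show Φ (y, w) ∈ K from hw) hp.le hq.le hpq
              have h2 : p • Φ (x, z) + q • Φ (y, w) = Φ (p * x + q * y, p • z + q • w) := by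
                simp only [Φ, smul_add, Finset.smul_sum, smul_smul, add_smul, Pi.add_apply,
                  Pi.smul_apply, smul_eq_mul, Finset.sum_add_distrib]
                abel
              rw [h2] at h1
              exact h1
            simp [indicator_of_mem hz, indicator_of_mem hw, indicator_of_mem hmem]
          · simp [indicator_of_notMem hw, ENNReal.zero_rpow_of_pos hq]
        · simp [indicator_of_notMem hz, ENNReal.zero_rpow_of_pos hp])
    simpa only [lintegral_indicator_one (hm _)] using this
  let R : ℝ → ℝ≥0∞ := fun t => ρ t * gaussianPDF 0 1 t
  have hRm : Measurable R := hρm.mul (measurable_gaussianPDF 0 1)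
  have hpdf1 : ∀ t, gaussianPDF 0 1 t ≤ 1 := by
    intro t
    rw [gaussianPDF, ENNReal.ofReal_le_one, gaussianPDFReal]
    have h1 : (√(2 * Real.pi * (1 : ℝ≥0)))⁻¹ ≤ 1 := by
      refine inv_le_one_of_one_le₀ (Real.one_le_sqrt.2 ?_)
      simp only [NNReal.coe_one, mul_one]; linarith [Real.pi_gt_three]
    have h2 : Real.exp (-(t - 0) ^ 2 / (2 * (1 : ℝ≥0))) ≤ 1 := by
      rw [Real.exp_le_one_iff, neg_div]; simp; positivity
    exact mul_le_one₀ h1 (Real.exp_pos _).le h2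
  have hR1 : ∀ t, R t ≤ 1 := fun t => mul_le_one' (hρ1 t) (hpdf1 t)
  have hRtop : ∀ t, R t ≠ ∞ := fun t => ne_top_of_le_ne_top ENNReal.one_ne_top (hR1 t)
  have hform : ∀ u : ℝ → ℝ≥0∞, Measurable u →
      ∫⁻ x in K, u ⟪ω, x⟫ ∂(stdGaussian E) = ∫⁻ t, u t * R t := by
    intro u hu
    have hum : Measurable fun x : E => u ⟪ω, x⟫ := hu.comp (by fun_prop)
    have hm' : Measurable fun z => K.indicator (fun x => u ⟪ω, x⟫) (Φ z) :=
      (hum.indicator hK).comp hΦ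
    rw [← lintegral_indicator hK, hγ, lintegral_map (hum.indicator hK) hΦ,
      lintegral_prod _ hm'.aemeasurable]
    have : ∀ t, ∫⁻ y, K.indicator (fun x => u ⟪ω, x⟫) (Φ (t, y)) ∂ν = u t * ρ t := by
      intro t
      have hm : MeasurableSet (Prod.mk t ⁻¹' (Φ ⁻¹' K)) := measurable_prodMk_left hS
      change _ = u t * ν (Prod.mk t ⁻¹' (Φ ⁻¹' K))
      rw [← lintegral_indicator_one hm, ← lintegral_const_mul _ (measurable_one.indicator hm)]
      congr 1 with y
      by_cases hy : Φ (t, y) ∈ K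
      · rw [indicator_of_mem hy, indicator_of_mem (show y ∈ Prod.mk t ⁻¹' (Φ ⁻¹' K) from hy), hinner]
        simp
      · rw [indicator_of_notMem hy, indicator_of_notMem (show y ∉ Prod.mk t ⁻¹' (Φ ⁻¹' K) from hy)]
        simp
    simp only [this]
    rw [gaussianReal_of_var_ne_zero _ one_ne_zero, lintegral_withDensity_eq_lintegral_mul _
      (measurable_gaussianPDF 0 1) (show Measurable fun x => u x * ρ x from hu.mul hρm)]
    congr 1 with t
    simp only [Pi.mul_apply, R]; ring
  have hmass : ∫⁻ t, R t = stdGaussian E K := by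
    have := hform 1 measurable_one
    simpa using this.symm
  refine ⟨fun t => (R t).toReal, ⟨fun t => ENNReal.toReal_nonneg, ?_, ?_, hRm.ennreal_toReal, ?_, ?_⟩,
    ?_⟩
  · exact integrable_toReal_of_lintegral_ne_top hRm.aemeasurable (hmass ▸ measure_ne_top _ _)
  · refine ⟨1, ?_⟩
    rintro _ ⟨t, rfl⟩
    exact ENNReal.toReal_le_of_le_ofReal zero_le_one (by simpa using hR1 t)
  · intro p q hp hq hpq x y
    rw [ENNReal.toReal_rpow, ENNReal.toReal_rpow, ← ENNReal.toReal_mul]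
    refine ENNReal.toReal_mono (hRtop _) ?_
    simp only [R]
    rw [ENNReal.mul_rpow_of_nonneg _ _ hp.le, ENNReal.mul_rpow_of_nonneg _ _ hq.le, mul_mul_mul_comm]
    exact mul_le_mul' (hρlog hp hq hpq x y) (gaussianPDF_mul_le hp hq hpq x y)
  · rw [integral_toReal hRm.aemeasurable (ae_of_all _ fun t => (hRtop t).lt_top), hmass]
    exact ENNReal.toReal_pos hK0 (measure_ne_top _ _)
  · intro u hu
    rw [hform u hu]
    congr 1 with t
    rw [ENNReal.ofReal_toReal (hRtop t)]

end Needle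

/-- `f` restricts to a polynomial of degree at most `m` on every line. -/
def IsPolynomialOnLines {E : Type*} [AddCommGroup E] [Module ℝ E] (f : E → ℝ) (m : ℕ) : Prop :=
  ∀ x v : E, ∃ p : Polynomial ℝ, p.natDegree ≤ m ∧ ∀ t : ℝ, f (x + t • v) = p.eval t

/-- The normal vector is nonzero because `j ≠ k` and `cos² + sin² = 1`, so its pairing with a
standard Gaussian vector has positive variance and no atoms. -/
theorem stdGaussian_hyperplane_eq_zero {ι : Type*} [Fintype ι] {j k : ι} (hjk : j ≠ k) (a b θ : ℝ) :
    stdGaussian (EuclideanSpace ℝ ι)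
      {x | Real.cos θ * (x j - a) + Real.sin θ * (x k - b) = 0} = 0 := by
  classical
  let w : EuclideanSpace ℝ ι :=
    Real.cos θ • EuclideanSpace.single j 1 + Real.sin θ • EuclideanSpace.single k 1
  have hw : ∀ x : EuclideanSpace ℝ ι, innerSL ℝ w x = Real.cos θ * x j + Real.sin θ * x k := by
    intro x
    simp [w, EuclideanSpace.inner_single_left]
  have hwn : ‖w‖ ≠ 0 := by
    rw [norm_ne_zero_iff]
    intro h
    have h1 : w j = Real.cos θ := by simp [w, hjk]
    have h2 : w k = Real.sin θ := by simp [w, hjk.symm]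
    have := Real.sin_sq_add_cos_sq θ
    rw [← h1, ← h2, h] at this
    simp at this
  have hmap := IsGaussian.map_eq_gaussianReal (μ := stdGaussian (EuclideanSpace ℝ ι)) (innerSL ℝ w)
  rw [variance_dual_stdGaussian] at hmap
  have hset : {x : EuclideanSpace ℝ ι | Real.cos θ * (x j - a) + Real.sin θ * (x k - b) = 0}
      = innerSL ℝ w ⁻¹' {Real.cos θ * a + Real.sin θ * b} := by
    ext x
    simp only [mem_ofPred_eq, mem_preimage, hw, mem_singleton_iff]
    constructor <;> intro h <;> linarith
  rw [hset, ← Measure.map_apply (innerSL ℝ w).measurable (measurableSet_singleton _), hmap]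
  have : NullSingletonClass (gaussianReal ((stdGaussian (EuclideanSpace ℝ ι))[innerSL ℝ w])
      (‖innerSL ℝ w‖ ^ 2).toNNReal) := by
    refine nullSingletonClass_gaussianReal ?_
    rw [innerSL_apply_norm]
    simp only [ne_eq, Real.toNNReal_eq_zero, not_le]
    positivity
  exact measure_singleton _

/-- On a convex body close to a line, a polynomial whose small values have a large share has a small
second moment. -/
theorem setLIntegral_sq_le_of_thin {E : Type*} [NormedAddCommGroup E] [InnerProductSpace ℝ E]
    [FiniteDimensional ℝ E] [MeasurableSpace E] [BorelSpace E] {k : ℕ}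
    (hk : Module.finrank ℝ E = k + 1) {ω y : E} (hω : ‖ω‖ = 1) {K : Set E} (hK : MeasurableSet K)
    (hKc : Convex ℝ K) (hK0 : stdGaussian E K ≠ 0) {f : E → ℝ} {m : ℕ}
    (hm : 1 ≤ m) (hp : IsPolynomialOnLines f m) {ε η v : ℝ} (hε : 0 < ε)
    (hηε : η ≤ ε) (hv : 0 < v) (hthin : ∀ x ∈ K, |f x - f (y + ⟪ω, x⟫ • ω)| ≤ η)
    (hV : v * (stdGaussian E).real K ≤ (stdGaussian E).real (K ∩ {x | |f x| ≤ ε})) :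
    ∫⁻ x in K, ENNReal.ofReal (f x ^ 2) ∂(stdGaussian E)
      ≤ ENNReal.ofReal ((8 * ε ^ 2 * (32 * Real.exp 5 * m / v) ^ (2 * m) + 2 * η ^ 2)
        * (stdGaussian E).real K) := by
  obtain ⟨p, hpdeg, hpf⟩ := hp y ω
  obtain ⟨r, hr, hru⟩ := exists_logConcave_marginal hk hω hK hKc hK0
  have hI : (stdGaussian E).real K = ∫ t, r t := by
    have h1 := hru 1 measurable_one
    simp only [Pi.one_apply, one_mul, lintegral_one, Measure.restrict_apply_univ] at h1
    rw [measureReal_def, h1, ← ofReal_integral_eq_lintegral_ofReal hr.integrable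
      (ae_of_all _ hr.nonneg), ENNReal.toReal_ofReal hr.integral_pos.le]
  have hpm : Measurable fun t => p.eval t := p.continuous.measurable
  -- Passing from `f` to `p` on the line moves values by at most `η ≤ ε`, hence the threshold `2 *
  -- ε`.
  have hVm : MeasurableSet {t | |p.eval t| ≤ 2 * ε} := measurableSet_le hpm.abs measurable_const
  have hV' : v * ∫ t, r t ≤ ∫ t in {t | |p.eval t| ≤ 2 * ε}, r t := by
    rw [← hI]
    refine hV.trans ?_
    rw [measureReal_def]
    refine ENNReal.toReal_le_of_le_ofReal (integral_nonneg hr.nonneg) ?_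
    rw [ofReal_integral_eq_lintegral_ofReal hr.integrable.integrableOn (ae_of_all _ hr.nonneg)]
    have h2 := hru ({t | |p.eval t| ≤ 2 * ε}.indicator 1) (measurable_one.indicator hVm)
    have h3 : ∫⁻ t, {t | |p.eval t| ≤ 2 * ε}.indicator 1 t * ENNReal.ofReal (r t)
        = ∫⁻ t in {t | |p.eval t| ≤ 2 * ε}, ENNReal.ofReal (r t) := by
      rw [← lintegral_indicator hVm]
      congr 1 with t
      by_cases ht : t ∈ {t | |p.eval t| ≤ 2 * ε}
      · simp [indicator_of_mem ht]
      · simp [indicator_of_notMem ht]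
    rw [← h3, ← h2]
    have hWm : MeasurableSet {x : E | |p.eval ⟪ω, x⟫| ≤ 2 * ε} :=
      (show Measurable fun x : E => ⟪ω, x⟫ by fun_prop) hVm
    calc stdGaussian E (K ∩ {x | |f x| ≤ ε}) ≤ stdGaussian E (K ∩ {x | |p.eval ⟪ω, x⟫| ≤ 2 * ε}) := by
          refine measure_mono fun x hx => ⟨hx.1, ?_⟩
          have h4 := hthin x hx.1
          rw [hpf] at h4
          have h5 : |f x| ≤ ε := hx.2
          simp only [mem_ofPred_eq]
          rw [abs_le] at *
          constructor <;> linarith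
      _ = ∫⁻ x in K, {x : E | |p.eval ⟪ω, x⟫| ≤ 2 * ε}.indicator 1 x ∂(stdGaussian E) := by
          rw [lintegral_indicator_one hWm, Measure.restrict_apply hWm, inter_comm]
      _ ≤ _ := le_of_eq rfl
  have hmain := hr.lintegral_sq_mul_le hm hpdeg (by positivity : 0 < 2 * ε) hv hV'
  calc ∫⁻ x in K, ENNReal.ofReal (f x ^ 2) ∂(stdGaussian E)
      ≤ ∫⁻ x in K, (2 * ENNReal.ofReal (p.eval ⟪ω, x⟫ ^ 2) + ENNReal.ofReal (2 * η ^ 2))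
          ∂(stdGaussian E) := by
        refine setLIntegral_mono' hK fun x hx => ?_
        rw [← ENNReal.ofReal_ofNat, ← ENNReal.ofReal_mul (by norm_num),
          ← ENNReal.ofReal_add (by positivity) (by positivity)]
        refine ENNReal.ofReal_le_ofReal ?_
        have h4 := hthin x hx
        rw [hpf] at h4
        have h5 : (f x - p.eval ⟪ω, x⟫) ^ 2 ≤ η ^ 2 := sq_le_sq' (by linarith [abs_le.1 h4]) (abs_le.1 h4).2
        nlinarith [sq_nonneg (f x - 2 * p.eval ⟪ω, x⟫)]
    _ = 2 * (∫⁻ t, ENNReal.ofReal (p.eval t ^ 2 * r t))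
          + ENNReal.ofReal (2 * η ^ 2) * stdGaussian E K := by
        have hsm : Measurable fun t => ENNReal.ofReal (p.eval t ^ 2) :=
          (hpm.pow_const 2).ennreal_ofReal
        rw [lintegral_add_right _ measurable_const, setLIntegral_const,
          lintegral_const_mul' _ _ ENNReal.ofNat_ne_top, hru _ hsm]
        congr 3 with t
        rw [ENNReal.ofReal_mul (sq_nonneg _)]
    _ ≤ 2 * ENNReal.ofReal ((2 * ε) ^ 2 * (32 * Real.exp 5 * m / v) ^ (2 * m) * ∫ s, r s)
          + ENNReal.ofReal (2 * η ^ 2) * stdGaussian E K := by gcongr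
    _ = _ := by
        rw [← hI, ← ofReal_measureReal, ← ENNReal.ofReal_ofNat, ← ENNReal.ofReal_mul (by norm_num),
          ← ENNReal.ofReal_mul (by positivity), ← ENNReal.ofReal_add (by positivity) (by positivity)]
        congr 1; ring

/-- The **Carbery–Wright inequality** for the standard Gaussian measure. -/
theorem stdGaussian_small_ball_le {ι : Type*} [Fintype ι] [Nonempty ι] {m : ℕ} (hm : 1 ≤ m)
    {f : EuclideanSpace ℝ ι → ℝ} (hf : Continuous f) (hp : IsPolynomialOnLines f m)
    (hL2 : MemLp f 2 (stdGaussian (EuclideanSpace ℝ ι)))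
    (hpos : 0 < ∫ x, f x ^ 2 ∂(stdGaussian (EuclideanSpace ℝ ι))) {ε : ℝ} (hε : 0 < ε) :
    (stdGaussian (EuclideanSpace ℝ ι)).real {x | |f x| ≤ ε} ≤ 256 * Real.exp 5 * m *
      (ε / √(∫ x, f x ^ 2 ∂(stdGaussian (EuclideanSpace ℝ ι)))) ^ (1 / (m : ℝ)) := by
  set γ := stdGaussian (EuclideanSpace ℝ ι) with hγ
  set A := ∫ x, f x ^ 2 ∂γ with hA
  set e := (ε / √A) ^ (1 / (m : ℝ)) with he
  have he0 : 0 < e := by positivity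
  have hm0 : (0 : ℝ) < m := by exact_mod_cast hm
  have hem : e ^ (2 * m) = ε ^ 2 / A := by
    rw [pow_mul', he, ← Real.rpow_natCast _ m, ← Real.rpow_mul (by positivity), one_div,
      inv_mul_cancel₀ hm0.ne', Real.rpow_one, div_pow, Real.sq_sqrt hpos.le]
  by_contra hcon
  push Not at hcon
  -- Eight times `32 * exp 5 * m * e`, so that the one-dimensional estimate carries `(1 / 8) ^ (2 *
  -- m)`, small enough for the contradiction.
  set v := 256 * Real.exp 5 * m * e with hv
  have hv0 : 0 < v := by positivity
  have hf2 : Integrable (fun x => f x ^ 2) γ := hL2.integrable_sq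
  have hVm : MeasurableSet {x | |f x| ≤ ε} := measurableSet_le hf.abs.measurable measurable_const
  set g : EuclideanSpace ℝ ι → ℝ := fun x => {x | |f x| ≤ ε}.indicator 1 x - v with hg
  have hind : Integrable ({x | |f x| ≤ ε}.indicator (1 : EuclideanSpace ℝ ι → ℝ)) γ :=
    (integrable_const (1 : ℝ)).indicator hVm
  have hgi : Integrable g γ := hind.sub (integrable_const _)
  have hgint : ∀ K : Set (EuclideanSpace ℝ ι), MeasurableSet K →
      ∫ x in K, g x ∂γ = γ.real (K ∩ {x | |f x| ≤ ε}) - v * γ.real K := by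
    intro K hK
    rw [hg, integral_sub hind.integrableOn (integrable_const _), setIntegral_const,
      integral_indicator_one hVm, measureReal_restrict_apply hVm, inter_comm, smul_eq_mul, mul_comm v]
  -- Subtracting `A / 2` rather than `A` makes the integral strictly positive, so it survives
  -- restriction to a large ball.
  have hhi : Integrable (fun x => f x ^ 2 - A / 2) γ := hf2.sub (integrable_const _)
  have hhint : ∀ K : Set (EuclideanSpace ℝ ι), MeasurableSet K →
      ∫ x in K, (f x ^ 2 - A / 2) ∂γ = (∫ x in K, f x ^ 2 ∂γ) - A / 2 * γ.real K := by
    intro K hK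
    rw [integral_sub hf2.integrableOn (integrable_const _), setIntegral_const, smul_eq_mul,
      mul_comm (A / 2)]
  have hmono : Monotone fun n : ℕ => Metric.closedBall (0 : EuclideanSpace ℝ ι) n := fun a b hab =>
    Metric.closedBall_subset_closedBall (by exact_mod_cast hab)
  have hU : ⋃ n : ℕ, Metric.closedBall (0 : EuclideanSpace ℝ ι) n = univ :=
    Metric.iUnion_closedBall_nat 0
  have hlim : ∀ u : EuclideanSpace ℝ ι → ℝ, Integrable u γ → Filter.Tendsto
      (fun n : ℕ => ∫ x in Metric.closedBall (0 : EuclideanSpace ℝ ι) n, u x ∂γ) Filter.atTop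
      (nhds (∫ x, u x ∂γ)) := by
    intro u hu
    have := tendsto_setIntegral_of_monotone (μ := γ) (f := u)
      (fun n : ℕ => (Metric.isClosed_closedBall (x := (0 : EuclideanSpace ℝ ι)) (ε := n)).measurableSet)
      hmono hu.integrableOn
    rwa [hU, setIntegral_univ] at this
  have hlimg := hlim g hgi
  have hlimh := hlim _ hhi
  have hg0 : 0 < ∫ x, g x ∂γ := by
    have := hgint univ MeasurableSet.univ
    rw [setIntegral_univ, univ_inter, probReal_univ, mul_one] at this
    rw [this]; linarith
  have hh0 : 0 < ∫ x, (f x ^ 2 - A / 2) ∂γ := by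
    have := hhint univ MeasurableSet.univ
    rw [setIntegral_univ, setIntegral_univ, probReal_univ, mul_one] at this
    rw [this, ← hA]; linarith
  obtain ⟨N, hgN, hhN⟩ := ((hlimg.eventually_const_lt hg0).and (hlimh.eventually_const_lt hh0)).exists
  set η := min ε (√(A / 16)) with hη
  have hη0 : 0 < η := lt_min hε (Real.sqrt_pos.2 (by positivity))
  have hη2 : η ^ 2 ≤ A / 16 := by
    calc η ^ 2 ≤ √(A / 16) ^ 2 := by gcongr; exact min_le_right _ _
      _ = A / 16 := Real.sq_sqrt (by positivity)
  -- The radius is `N + 1` because projecting a point of `K` to the line may leave the ball of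
  -- radius `N`, by less than `1`.
  have hunif := (isCompact_closedBall (0 : EuclideanSpace ℝ ι) (N + 1)).uniformContinuousOn_of_continuous
    hf.continuousOn
  rw [Metric.uniformContinuousOn_iff] at hunif
  obtain ⟨τ, hτ, hτf⟩ := hunif η hη0
  obtain ⟨K, hKN, hKc, hKconv, hKh, hKg, x₀, ω, hω, hthin⟩ := exists_thin_convex
    (fun j k hjk a b θ => stdGaussian_hyperplane_eq_zero hjk a b θ) hhi hgi
    (isCompact_closedBall (0 : EuclideanSpace ℝ ι) N) (convex_closedBall _ _) hhN.le hgN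
    (lt_min hτ one_pos)
  have hKm := hKc.measurableSet
  rw [hgint K hKm] at hKg
  rw [hhint K hKm] at hKh
  have hK0 : γ K ≠ 0 := by
    intro h0
    have h1 : γ.real K = 0 := by rw [measureReal_def, h0, ENNReal.toReal_zero]
    have h2 : γ.real (K ∩ {x | |f x| ≤ ε}) ≤ γ.real K := measureReal_mono inter_subset_left
    rw [h1] at h2 hKg
    linarith
  have hKr : 0 < γ.real K := ENNReal.toReal_pos hK0 (measure_ne_top _ _)
  obtain ⟨k, hk⟩ : ∃ k, Module.finrank ℝ (EuclideanSpace ℝ ι) = k + 1 :=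
    ⟨Fintype.card ι - 1, by rw [finrank_euclideanSpace]; have := Fintype.card_pos (α := ι); omega⟩
  have hclose : ∀ x ∈ K, |f x - f ((x₀ - ⟪ω, x₀⟫ • ω) + ⟪ω, x⟫ • ω)| ≤ η := by
    intro x hx
    have e1 : (x₀ - ⟪ω, x₀⟫ • ω) + ⟪ω, x⟫ • ω = x₀ + ⟪ω, x - x₀⟫ • ω := by
      rw [inner_sub_right, sub_smul]; abel
    rw [e1]
    have h1 := hthin x hx
    have hxN : ‖x‖ ≤ N := by simpa using hKN hx
    have h2 := hτf x (by simp; linarith) (x₀ + ⟪ω, x - x₀⟫ • ω) (by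
      rw [mem_closedBall_zero_iff]
      have := norm_sub_norm_le (x₀ + ⟪ω, x - x₀⟫ • ω) x
      rw [norm_sub_rev] at this
      linarith [h1.trans_le (min_le_right _ _)])
      (by rw [dist_eq_norm]; exact h1.trans_le (min_le_left _ _))
    rw [Real.dist_eq] at h2
    exact h2.le
  have hfin := setLIntegral_sq_le_of_thin hk hω hKm hKconv hK0 hm hp hε (min_le_left _ _) hv0
    hclose (by linarith)
  rw [← hγ, ← ofReal_integral_eq_lintegral_ofReal hf2.integrableOn (ae_of_all _ fun x => sq_nonneg _),
    ENNReal.ofReal_le_ofReal_iff (by positivity)] at hfin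
  have hratio : 32 * Real.exp 5 * m / v = (1 / 8) / e := by rw [hv]; field_simp; norm_num
  have h8 : ((1 : ℝ) / 8) ^ (2 * m) ≤ 1 / 64 := by
    calc ((1 : ℝ) / 8) ^ (2 * m) ≤ (1 / 8) ^ (2 * 1) :=
          pow_le_pow_of_le_one (by norm_num) (by norm_num) (by omega)
      _ = 1 / 64 := by norm_num
  have hcoef : 8 * ε ^ 2 * (32 * Real.exp 5 * m / v) ^ (2 * m) ≤ A / 8 := by
    rw [hratio, div_pow, hem]
    calc 8 * ε ^ 2 * ((1 / 8) ^ (2 * m) / (ε ^ 2 / A)) = 8 * A * (1 / 8) ^ (2 * m) := by field_simp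
      _ ≤ 8 * A * (1 / 64) := by gcongr
      _ = A / 8 := by ring
  -- The mean of `f²` over `K` is at least `A / 2`, while the needle estimate bounds it by `A / 4`.
  have h9 : A / 2 * γ.real K ≤ (A / 8 + 2 * (A / 16)) * γ.real K := by
    refine (by linarith : A / 2 * γ.real K ≤ ∫ x in K, f x ^ 2 ∂γ).trans (hfin.trans ?_)
    gcongr
  have h10 := le_of_mul_le_mul_right h9 hKr
  linarith

/-! ### Multilinear polynomials as combinations of products of affine coordinates. -/

section Multilinear

variable {n d : ℕ} {q : MvPolynomial (Fin n × Fin d) ℝ}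

theorem continuous_evalAt (q : MvPolynomial (Fin n × Fin d) ℝ) : Continuous (evalAt q) := by
  unfold evalAt
  exact (MvPolynomial.continuous_eval q).comp (by fun_prop)

theorem differentiable_evalAt (q : MvPolynomial (Fin n × Fin d) ℝ) : Differentiable ℝ (evalAt q) := by
  unfold evalAt
  induction q using MvPolynomial.induction_on with
  | C a => simp
  | add p q hp hq => simpa only [map_add] using hp.fun_add hq
  | mul_X p i hp =>
    simp only [map_mul, MvPolynomial.eval_X]
    refine hp.mul ?_
    fun_prop

/-- A multilinear polynomial is affine in each of its vector arguments. -/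
theorem IsMultilinear.evalAt_update (hq : IsMultilinear q) (i : Fin n)
    (x : Fin n → EuclideanSpace ℝ (Fin d)) (y : EuclideanSpace ℝ (Fin d)) :
    evalAt q (Function.update x i y)
      = evalAt q (Function.update x i 0) + ⟪partialGrad q i x, y⟫ := by
  set φ : EuclideanSpace ℝ (Fin d) → ℝ := fun y => evalAt q (Function.update x i y) with hφ
  have hd : Differentiable ℝ φ := (differentiable_evalAt q).comp (by
    rw [differentiable_pi]
    intro k
    by_cases hk : k = i
    · subst hk; simp
    · simp [Function.update_of_ne hk])
  have hgrad : ∀ z, gradient φ z = partialGrad q i x := by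
    intro z
    rw [← hq i x z, partialGrad]
    simp [hφ]
  set ψ : EuclideanSpace ℝ (Fin d) → ℝ := fun y => φ y - innerSL ℝ (partialGrad q i x) y with hψ
  have hψd : Differentiable ℝ ψ := hd.sub (innerSL ℝ (partialGrad q i x)).differentiable
  have hψ0 : ∀ z, fderiv ℝ ψ z = 0 := by
    intro z
    rw [hψ, fderiv_fun_sub (hd z) (innerSL ℝ (partialGrad q i x)).differentiableAt,
      ContinuousLinearMap.fderiv, ← toDual_gradient, hgrad]
    ext w; simp
  have := is_const_of_fderiv_eq_zero hψd hψ0 y 0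
  simp only [hψ, hφ, innerSL_apply_apply, inner_zero_right, sub_zero] at this
  linarith

/-- The functions `1, x₁, …, x_d` on `ℝ^d`. -/
def affineBasis (k : Option (Fin d)) (x : EuclideanSpace ℝ (Fin d)) : ℝ :=
  k.elim 1 fun j => x j

theorem continuous_affineBasis (k : Option (Fin d)) : Continuous (affineBasis k) := by
  cases k with
  | none => exact continuous_const
  | some j => exact (show Continuous fun x : EuclideanSpace ℝ (Fin d) => x j by fun_prop)

/-- Induction on the set `s` of free arguments, the others being frozen at `z`. Freeing argument `i`
expands an affine function through its values at `0` and at the basis vectors; these are frozen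
values, so `z` has to vary in the induction. -/
theorem IsMultilinear.evalAt_piecewise_mem_span (hq : IsMultilinear q) (s : Finset (Fin n)) :
    ∀ z : Fin n → EuclideanSpace ℝ (Fin d),
      (fun x => evalAt q (s.piecewise x z)) ∈ Submodule.span ℝ (range
        fun (φ : Fin n → Option (Fin d)) (x : Fin n → EuclideanSpace ℝ (Fin d)) =>
          ∏ i ∈ s, affineBasis (φ i) (x i)) := by
  induction s using Finset.induction_on with
  | empty =>
    intro z
    simp only [Finset.piecewise_empty, Finset.prod_empty]
    have : (fun _ : Fin n → EuclideanSpace ℝ (Fin d) => evalAt q z)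
        = evalAt q z • fun _ : Fin n → EuclideanSpace ℝ (Fin d) => (1 : ℝ) := by ext; simp
    rw [this]
    exact Submodule.smul_mem _ _ (Submodule.subset_span ⟨fun _ => none, rfl⟩)
  | insert i s his ih =>
    intro z
    have hmul : ∀ (k : Option (Fin d)) (G : (Fin n → EuclideanSpace ℝ (Fin d)) → ℝ),
        G ∈ Submodule.span ℝ (range fun (φ : Fin n → Option (Fin d))
          (x : Fin n → EuclideanSpace ℝ (Fin d)) => ∏ i ∈ s, affineBasis (φ i) (x i)) →
        (fun x => affineBasis k (x i) * G x) ∈ Submodule.span ℝ (range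
          fun (φ : Fin n → Option (Fin d)) (x : Fin n → EuclideanSpace ℝ (Fin d)) =>
            ∏ i ∈ insert i s, affineBasis (φ i) (x i)) := by
      intro k G hG
      induction hG using Submodule.span_induction with
      | mem G hG =>
        obtain ⟨φ, rfl⟩ := hG
        refine Submodule.subset_span ⟨Function.update φ i k, ?_⟩
        ext x
        simp only
        rw [Finset.prod_insert his, Function.update_self]
        congr 1
        refine Finset.prod_congr rfl fun j hj => ?_
        rw [Function.update_of_ne (ne_of_mem_of_not_mem hj his)]
      | zero =>
        simp only [Pi.zero_apply, mul_zero]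
        exact Submodule.zero_mem _
      | add G H _ _ hG hH =>
        simp only [Pi.add_apply, mul_add]
        exact Submodule.add_mem _ hG hH
      | smul c G _ hG =>
        have := Submodule.smul_mem _ c hG
        convert this using 1
        ext x; simp; ring
    have hpw : ∀ x e, Function.update ((insert i s).piecewise x z) i e
        = s.piecewise x (Function.update z i e) := by
      intro x e
      ext1 k
      by_cases hk : k = i
      · subst hk; simp [his]
      · by_cases hks : k ∈ s <;> simp [hk, hks, Finset.piecewise]
    have hself : ∀ x, (insert i s).piecewise x z
        = Function.update ((insert i s).piecewise x z) i (x i) := by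
      intro x
      rw [eq_comm, Function.update_eq_self_iff]
      simp
    have hexp : (fun x => evalAt q ((insert i s).piecewise x z))
        = (fun x => affineBasis none (x i) * evalAt q (s.piecewise x (Function.update z i 0)))
          + ∑ j, ((fun x => affineBasis (some j) (x i)
              * evalAt q (s.piecewise x (Function.update z i (EuclideanSpace.single j 1))))
            - fun x => affineBasis (some j) (x i)
              * evalAt q (s.piecewise x (Function.update z i 0))) := by
      ext x
      rw [hself x, hq.evalAt_update, hpw]
      have hG : ∀ j, partialGrad q i ((insert i s).piecewise x z) j
          = evalAt q (s.piecewise x (Function.update z i (EuclideanSpace.single j 1)))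
            - evalAt q (s.piecewise x (Function.update z i 0)) := by
        intro j
        have := hq.evalAt_update i ((insert i s).piecewise x z) (EuclideanSpace.single j 1)
        rw [hpw, hpw, EuclideanSpace.inner_single_right] at this
        simp at this
        linarith
      simp only [Pi.add_apply, Finset.sum_apply, Pi.sub_apply, affineBasis, Option.elim, one_mul,
        PiLp.inner_apply, hG, RCLike.inner_apply, conj_trivial]
      congr 1
      refine Finset.sum_congr rfl fun j _ => ?_
      ring
    rw [hexp]
    refine Submodule.add_mem _ (hmul _ _ (ih _)) (Submodule.sum_mem _ fun j _ => ?_)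
    exact Submodule.sub_mem _ (hmul _ _ (ih _)) (hmul _ _ (ih _))

theorem IsMultilinear.exists_expansion (hq : IsMultilinear q) :
    ∃ c : (Fin n → Option (Fin d)) → ℝ, ∀ x,
      evalAt q x = ∑ φ, c φ * ∏ i, affineBasis (φ i) (x i) := by
  have h := hq.evalAt_piecewise_mem_span Finset.univ 0
  obtain ⟨c, hc⟩ := (Submodule.mem_span_range_iff_exists_fun ℝ).1 h
  refine ⟨c, fun x => ?_⟩
  have := congrFun hc x
  simp only [Finset.piecewise_univ, Finset.sum_apply, Pi.smul_apply, smul_eq_mul] at this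
  exact this.symm

end Multilinear

/-! ### First and second moments depend only on means and covariances. -/

section Moments

variable {n d : ℕ} {q : MvPolynomial (Fin n × Fin d) ℝ} {Ω : Type*} [MeasurableSpace Ω]
  {μ : Measure Ω}

theorem memLp_affineBasis [IsProbabilityMeasure μ] {Y : Ω → EuclideanSpace ℝ (Fin d)} (hY : MemLp Y 2 μ)
    (k : Option (Fin d)) : MemLp (fun ω => affineBasis k (Y ω)) 2 μ := by
  cases k with
  | none => exact memLp_const 1
  | some j => exact MemLp.eval_piLp hY j

theorem integrable_prod_affineBasis [IsProbabilityMeasure μ] {Y : Fin n → Ω → EuclideanSpace ℝ (Fin d)}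
    (hind : iIndepFun Y μ) (hY : ∀ i, MemLp (Y i) 2 μ) (φ ψ : Fin n → Option (Fin d)) :
    Integrable (fun ω => ∏ i, (affineBasis (φ i) (Y i ω) * affineBasis (ψ i) (Y i ω))) μ := by
  have hm : ∀ i, AEMeasurable (Y i) μ := fun i => (hY i).aestronglyMeasurable.aemeasurable
  have hint : ∀ i, Integrable (fun x => affineBasis (φ i) x * affineBasis (ψ i) x) (μ.map (Y i)) := by
    intro i
    rw [integrable_map_measure (((continuous_affineBasis _).fun_mul
      (continuous_affineBasis _)).aestronglyMeasurable) (hm i)]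
    exact (memLp_affineBasis (hY i) (φ i)).integrable_mul (memLp_affineBasis (hY i) (ψ i))
  have : ∀ i, IsProbabilityMeasure (μ.map (Y i)) := fun i => Measure.isProbabilityMeasure_map (hm i)
  have h := Integrable.fintype_prod hint
  rw [← hind.map_fun_eq_pi_map hm] at h
  exact (integrable_map_measure h.aestronglyMeasurable (aemeasurable_pi_lambda _ hm)).1 h

theorem integral_prod_affineBasis {Y : Fin n → Ω → EuclideanSpace ℝ (Fin d)}
    (hind : iIndepFun Y μ) (hY : ∀ i, MemLp (Y i) 2 μ) (φ ψ : Fin n → Option (Fin d)) :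
    ∫ ω, ∏ i, (affineBasis (φ i) (Y i ω) * affineBasis (ψ i) (Y i ω)) ∂μ
      = ∏ i, ∫ ω, affineBasis (φ i) (Y i ω) * affineBasis (ψ i) (Y i ω) ∂μ :=
  hind.integral_fun_prod_comp (f := fun i x => affineBasis (φ i) x * affineBasis (ψ i) x)
    (fun i => (hY i).aestronglyMeasurable.aemeasurable)
    fun _ => ((continuous_affineBasis _).mul (continuous_affineBasis _)).aestronglyMeasurable

theorem IsMultilinear.memLp_evalAt [IsProbabilityMeasure μ] (hq : IsMultilinear q)
    {Y : Fin n → Ω → EuclideanSpace ℝ (Fin d)} (hind : iIndepFun Y μ) (hY : ∀ i, MemLp (Y i) 2 μ) :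
    MemLp (fun ω => evalAt q fun i => Y i ω) 2 μ := by
  obtain ⟨c, hc⟩ := hq.exists_expansion
  simp only [hc]
  refine memLp_finsetSum _ fun φ _ => MemLp.const_mul ?_ _
  have hm : AEStronglyMeasurable (fun ω => ∏ i, affineBasis (φ i) (Y i ω)) μ :=
    Finset.aestronglyMeasurable_fun_prod _ fun i _ =>
      (memLp_affineBasis (hY i) (φ i)).aestronglyMeasurable
  rw [memLp_two_iff_integrable_sq hm]
  simpa only [← sq, Finset.prod_pow] using integrable_prod_affineBasis hind hY φ φ

/-- The coefficients are fixed before `Y`, so that `X` and `Z` can be compared term by term. The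
factor `none` in the mean lets the same pair moments serve both formulas. -/
theorem IsMultilinear.integral_evalAt_sq [IsProbabilityMeasure μ] (hq : IsMultilinear q) :
    ∃ c : (Fin n → Option (Fin d)) → ℝ, ∀ {Y : Fin n → Ω → EuclideanSpace ℝ (Fin d)},
      iIndepFun Y μ → (∀ i, MemLp (Y i) 2 μ) →
      ∫ ω, evalAt q (fun i => Y i ω) ∂μ = ∑ φ, c φ *
        ∏ i, ∫ ω, affineBasis (φ i) (Y i ω) * affineBasis none (Y i ω) ∂μ ∧
      ∫ ω, evalAt q (fun i => Y i ω) ^ 2 ∂μ = ∑ φ, ∑ ψ, c φ * c ψ *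
        ∏ i, ∫ ω, affineBasis (φ i) (Y i ω) * affineBasis (ψ i) (Y i ω) ∂μ := by
  obtain ⟨c, hc⟩ := hq.exists_expansion
  refine ⟨c, fun {Y} hind hY => ⟨?_, ?_⟩⟩
  · simp only [hc]
    rw [integral_finsetSum]
    · refine Finset.sum_congr rfl fun φ _ => ?_
      rw [integral_const_mul, ← integral_prod_affineBasis hind hY φ fun _ => none]
      simp [affineBasis]
    · intro φ _
      refine Integrable.const_mul ?_ _
      simpa [affineBasis] using integrable_prod_affineBasis hind hY φ fun _ => none
  · have : ∀ ω, evalAt q (fun i => Y i ω) ^ 2 = ∑ φ, ∑ ψ, c φ * c ψ *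
        ∏ i, (affineBasis (φ i) (Y i ω) * affineBasis (ψ i) (Y i ω)) := by
      intro ω
      rw [hc, sq, Finset.sum_mul_sum]
      refine Finset.sum_congr rfl fun φ _ => Finset.sum_congr rfl fun ψ _ => ?_
      rw [Finset.prod_mul_distrib]; ring
    simp only [this]
    rw [integral_finsetSum]
    · refine Finset.sum_congr rfl fun φ _ => ?_
      rw [integral_finsetSum]
      · refine Finset.sum_congr rfl fun ψ _ => ?_
        rw [integral_const_mul, integral_prod_affineBasis hind hY φ ψ]
      · exact fun ψ _ => (integrable_prod_affineBasis hind hY φ ψ).const_mul _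
    · exact fun φ _ => integrable_finsetSum _ fun ψ _ =>
        (integrable_prod_affineBasis hind hY φ ψ).const_mul _

theorem posSemidef_covMatrix [IsProbabilityMeasure μ] {Y : Ω → EuclideanSpace ℝ (Fin d)} (hY : MemLp Y 2 μ) :
    (covMatrix Y μ).PosSemidef := by
  have hj : ∀ j, MemLp (fun ω => Y ω j) 2 μ := fun j => MemLp.eval_piLp hY j
  refine Matrix.PosSemidef.of_dotProduct_mulVec_nonneg ?_ fun x => ?_
  · ext j k
    simp [covMatrix, covariance_comm]
  · have : star x ⬝ᵥ (covMatrix Y μ).mulVec x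
        = covariance (fun ω => ∑ j, x j * Y ω j) (fun ω => ∑ j, x j * Y ω j) μ := by
      rw [covariance_fun_sum_fun_sum (fun j => (hj j).const_mul _) fun j => (hj j).const_mul _]
      simp only [dotProduct, Matrix.mulVec, covMatrix, Matrix.of_apply, Finset.mul_sum,
        covariance_const_mul_left, covariance_const_mul_right]
      refine Finset.sum_congr rfl fun j _ => Finset.sum_congr rfl fun k _ => ?_
      simp; ring
    rw [this, covariance_self]
    · exact variance_nonneg _ _
    · exact (Finset.aemeasurable_fun_sum _ fun j _ =>
        ((hj j).aestronglyMeasurable.aemeasurable).const_mul _)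

theorem memLp_of_hasLaw_multivariateGaussian {Y : Ω → EuclideanSpace ℝ (Fin d)}
    {v : EuclideanSpace ℝ (Fin d)} {S : Matrix (Fin d) (Fin d) ℝ}
    (hY : HasLaw Y (multivariateGaussian v S) μ) (p : ℝ≥0∞) (hp : p ≠ ∞) : MemLp Y p μ := by
  have : MemLp id p (μ.map Y) := by
    rw [hY.map_eq]; exact IsGaussian.memLp_id _ p hp
  exact (memLp_map_measure_iff aestronglyMeasurable_id hY.aemeasurable).1 this

theorem covariance_eval_eq_of_hasLaw [IsProbabilityMeasure μ] {X Z : Ω → EuclideanSpace ℝ (Fin d)}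
    (hX : MemLp X 2 μ) (hZ : HasLaw Z (multivariateGaussian (∫ ω, X ω ∂μ) (covMatrix X μ)) μ)
    (i j : Fin d) :
    covariance (fun ω => X ω i) (fun ω => X ω j) μ
      = covariance (fun ω => Z ω i) (fun ω => Z ω j) μ := by
  rw [hZ.covariance_fun_comp (f := fun x => x i) (g := fun x => x j) (by fun_prop) (by fun_prop),
    covariance_eval_multivariateGaussian (posSemidef_covMatrix hX)]
  rfl

theorem integral_affineBasis_mul_eq [IsProbabilityMeasure μ] {X Z : Ω → EuclideanSpace ℝ (Fin d)} (hX : MemLp X 2 μ)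
    (hZ : HasLaw Z (multivariateGaussian (∫ ω, X ω ∂μ) (covMatrix X μ)) μ) (k l : Option (Fin d)) :
    ∫ ω, affineBasis k (X ω) * affineBasis l (X ω) ∂μ
      = ∫ ω, affineBasis k (Z ω) * affineBasis l (Z ω) ∂μ := by
  have hZ2 : MemLp Z 2 μ := memLp_of_hasLaw_multivariateGaussian hZ 2 (by simp)
  have hev : ∀ Y : Ω → EuclideanSpace ℝ (Fin d), MemLp Y 2 μ → ∀ j,
      ∫ ω, Y ω j ∂μ = (∫ ω, Y ω ∂μ) j := fun Y hY j =>
    (EuclideanSpace.proj (𝕜 := ℝ) j).integral_comp_comm (hY.integrable (by norm_num))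
  have hmean : ∀ j, ∫ ω, X ω j ∂μ = ∫ ω, Z ω j ∂μ := by
    intro j
    rw [hev X hX, hev Z hZ2, hZ.integral_eq, integral_id_multivariateGaussian]
  have hcov := covariance_eval_eq_of_hasLaw hX hZ
  have hsec : ∀ i j, ∫ ω, X ω i * X ω j ∂μ = ∫ ω, Z ω i * Z ω j ∂μ := by
    intro i j
    have h1 := covariance_eq_sub (MemLp.eval_piLp hX i) (MemLp.eval_piLp hX j)
    have h2 := covariance_eq_sub (MemLp.eval_piLp hZ2 i) (MemLp.eval_piLp hZ2 j)
    simp only [Pi.mul_apply] at h1 h2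
    rw [hmean i, hmean j, hcov i j] at h1
    linarith
  cases k <;> cases l <;> simp [affineBasis, hmean, hsec]

end Moments

/-! ### Smooth steps and the replacement of one scalar variable. -/

/-- `H` is a continuous function decreasing from `1` to `0` on the unit interval, with a uniform
second-order Taylor bound of exponent `ν`. -/
structure IsSmoothStep (H : ℝ → ℝ) (ν K : ℝ) : Prop where
  continuous : Continuous H
  nonneg : ∀ x, 0 ≤ H x
  le_one : ∀ x, H x ≤ 1
  eq_one : ∀ x ≤ 0, H x = 1
  eq_zero : ∀ x, 1 ≤ x → H x = 0
  taylor : ∀ x, ∃ α β : ℝ, ∀ y, |H (x + y) - H x - α * y - β * y ^ 2| ≤ K * |y| ^ ν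

theorem abs_le_mul_of_abs_deriv_le {f f' : ℝ → ℝ} (hf : ∀ s, HasDerivAt f (f' s) s) (h0 : f 0 = 0)
    {y C : ℝ} (hC : ∀ s, |s| ≤ |y| → |f' s| ≤ C) : |f y| ≤ C * |y| := by
  have := (convex_Icc (-|y|) |y|).norm_image_sub_le_of_norm_hasDerivWithin_le (f := f) (f' := f')
    (C := C) (fun s _ => (hf s).hasDerivWithinAt) (fun s hs => hC s (abs_le.2 (mem_Icc.1 hs)))
    (x := 0) (y := y) (mem_Icc.2 (abs_le.1 (by simp))) (mem_Icc.2 (abs_le.1 le_rfl))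
  simpa [h0] using this

theorem exists_isSmoothStep {ν : ℝ} (hν : ν ∈ Ioc (2 : ℝ) 3) :
    ∃ (H : ℝ → ℝ) (K : ℝ), 0 < K ∧ IsSmoothStep H ν K := by
  set H : ℝ → ℝ := fun x => 1 - Real.smoothTransition x with hH
  have hs : ContDiff ℝ (⊤ : ℕ∞) H := contDiff_const.sub Real.smoothTransition.contDiff
  have hs1 : ContDiff ℝ (⊤ : ℕ∞) (deriv H) := ((contDiff_infty_iff_deriv).1 hs).2
  have hs2 : ContDiff ℝ (⊤ : ℕ∞) (deriv (deriv H)) := ((contDiff_infty_iff_deriv).1 hs1).2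
  have hs3 : ContDiff ℝ (⊤ : ℕ∞) (deriv (deriv (deriv H))) := ((contDiff_infty_iff_deriv).1 hs2).2
  have hd : ∀ x, HasDerivAt H (deriv H x) x := fun x =>
    ((hs.differentiable (by simp)) x).hasDerivAt
  have hd1 : ∀ x, HasDerivAt (deriv H) (deriv (deriv H) x) x := fun x =>
    ((hs1.differentiable (by simp)) x).hasDerivAt
  have hd2 : ∀ x, HasDerivAt (deriv (deriv H)) (deriv (deriv (deriv H)) x) x := fun x =>
    ((hs2.differentiable (by simp)) x).hasDerivAt
  have hsupp : HasCompactSupport (deriv H) := by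
    refine HasCompactSupport.of_support_subset_isCompact (isCompact_Icc (a := (0 : ℝ)) (b := 1)) ?_
    intro x hx
    by_contra hx'
    apply hx
    rw [mem_Icc, not_and_or, not_le, not_le] at hx'
    rcases hx' with h | h
    · have : H =ᶠ[nhds x] fun _ => 1 := by
        filter_upwards [Iio_mem_nhds h] with y hy
        simp [hH, Real.smoothTransition.zero_of_nonpos (le_of_lt hy)]
      rw [this.deriv_eq]; simp
    · have : H =ᶠ[nhds x] fun _ => 0 := by
        filter_upwards [Ioi_mem_nhds h] with y hy
        simp [hH, Real.smoothTransition.one_of_one_le (le_of_lt hy)]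
      rw [this.deriv_eq]; simp
  obtain ⟨B₂, hB₂⟩ := hs2.continuous.bounded_above_of_compact_support hsupp.deriv
  obtain ⟨B₃, hB₃⟩ := hs3.continuous.bounded_above_of_compact_support hsupp.deriv.deriv
  simp only [Real.norm_eq_abs] at hB₂ hB₃
  set K := max 1 (max (2 * B₂) B₃) with hK
  have hK1 : 1 ≤ K := le_max_left _ _
  have hK2 : 2 * B₂ ≤ K := (le_max_left _ _).trans (le_max_right _ _)
  have hK3 : B₃ ≤ K := (le_max_right _ _).trans (le_max_right _ _)
  refine ⟨H, K, by linarith, hs.continuous, fun x => ?_, fun x => ?_, fun x hx => ?_,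
    fun x hx => ?_, fun x => ⟨deriv H x, deriv (deriv H) x / 2, fun y => ?_⟩⟩
  · simp [hH, Real.smoothTransition.le_one]
  · simp [hH, Real.smoothTransition.nonneg]
  · simp [hH, Real.smoothTransition.zero_of_nonpos hx]
  · simp [hH, Real.smoothTransition.one_of_one_le hx]
  set R2 : ℝ → ℝ := fun s => deriv (deriv H) (x + s) - deriv (deriv H) x with hR2
  set R1 : ℝ → ℝ := fun s => deriv H (x + s) - deriv H x - deriv (deriv H) x * s with hR1
  set R0 : ℝ → ℝ := fun s => H (x + s) - H x - deriv H x * s - deriv (deriv H) x / 2 * s ^ 2 with hR0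
  have hder0 : ∀ s, HasDerivAt R0 (R1 s) s := by
    intro s
    have h1 := ((hd (x + s)).comp_const_add x s).sub_const (H x)
    have h2 := (h1.sub ((hasDerivAt_id s).const_mul (deriv H x))).sub
      (((hasDerivAt_id s).pow 2).const_mul (deriv (deriv H) x / 2))
    refine h2.congr_deriv ?_
    simp only [hR1, id]
    ring
  have hder1 : ∀ s, HasDerivAt R1 (R2 s) s := by
    intro s
    have h1 := ((hd1 (x + s)).comp_const_add x s).sub_const (deriv H x)
    have h2 := h1.sub ((hasDerivAt_id s).const_mul (deriv (deriv H) x))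
    refine h2.congr_deriv ?_
    simp only [hR2]
    ring
  have hder2 : ∀ s, HasDerivAt R2 (deriv (deriv (deriv H)) (x + s)) s := fun s =>
    ((hd2 (x + s)).comp_const_add x s).sub_const _
  -- The second derivative is bounded and Lipschitz. Integrating this bound twice gives `K * min 1
  -- |y| * |y| ^ 2`, which is at most `K * |y| ^ ν` exactly because `2 ≤ ν ≤ 3`.
  have hb2 : ∀ s, |s| ≤ |y| → |R2 s| ≤ K * min 1 |y| := by
    intro s hsy
    have h1 : |R2 s| ≤ B₃ * |s| := abs_le_mul_of_abs_deriv_le hder2 (by simp [hR2]) fun u _ => hB₃ _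
    have h2 : |R2 s| ≤ 2 * B₂ := by
      have := abs_sub (deriv (deriv H) (x + s)) (deriv (deriv H) x)
      linarith [hB₂ (x + s), hB₂ x]
    have hB3 : 0 ≤ B₃ := (abs_nonneg _).trans (hB₃ 0)
    rcases min_choice 1 |y| with h | h <;> rw [h]
    · linarith
    · exact h1.trans (mul_le_mul hK3 hsy (abs_nonneg _) (by linarith))
  have hb1 : ∀ s, |s| ≤ |y| → |R1 s| ≤ K * min 1 |y| * |y| := by
    intro s hsy
    refine (abs_le_mul_of_abs_deriv_le hder1 (by simp [hR1])
      fun u hu => hb2 u (hu.trans hsy)).trans ?_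
    have : 0 ≤ K * min 1 |y| := by positivity
    gcongr
  have hb0 : |R0 y| ≤ K * min 1 |y| * |y| * |y| :=
    abs_le_mul_of_abs_deriv_le hder0 (by simp [hR0]) hb1
  have hfinal : min 1 |y| * |y| * |y| ≤ |y| ^ ν := by
    rcases (abs_nonneg y).eq_or_lt with h0 | hpos
    · rw [← h0, Real.zero_rpow (by linarith [hν.1])]; simp
    rcases le_total 1 |y| with h | h
    · rw [min_eq_left h]
      calc 1 * |y| * |y| = |y| ^ (2 : ℝ) := by rw [Real.rpow_two]; ring
        _ ≤ |y| ^ ν := Real.rpow_le_rpow_of_exponent_le h hν.1.le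
    · rw [min_eq_right h]
      calc |y| * |y| * |y| = |y| ^ (3 : ℝ) := by
            rw [show (3 : ℝ) = ((3 : ℕ) : ℝ) by norm_num, Real.rpow_natCast]; ring
        _ ≤ |y| ^ ν := Real.rpow_le_rpow_of_exponent_ge hpos h hν.2
  calc |R0 y| ≤ K * min 1 |y| * |y| * |y| := hb0
    _ = K * (min 1 |y| * |y| * |y|) := by ring
    _ ≤ K * |y| ^ ν := by gcongr

/-- The absolute moment of order `ν` of the standard Gaussian distribution. -/
noncomputable def gaussianMoment (ν : ℝ) : ℝ≥0∞ := ∫⁻ x, ‖x‖ₑ ^ ν ∂(gaussianReal 0 1)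

theorem gaussianMoment_ne_top {ν : ℝ} (hν : 0 < ν) : gaussianMoment ν ≠ ∞ := by
  have h := (memLp_id_gaussianReal' (μ := 0) (v := 1) (ENNReal.ofReal ν) ENNReal.ofReal_ne_top).2
  have := lintegral_rpow_enorm_lt_top_of_eLpNorm_lt_top (by simpa using hν) ENNReal.ofReal_ne_top h
  rw [ENNReal.toReal_ofReal hν.le] at this
  exact this.ne

theorem lintegral_rpow_gaussianReal {ν : ℝ} (hν : 0 < ν) {s : ℝ} :
    ∫⁻ x, ‖x‖ₑ ^ ν ∂(gaussianReal 0 (s ^ 2).toNNReal) = ‖s‖ₑ ^ ν * gaussianMoment ν := by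
  have hmap := gaussianReal_map_const_mul (μ := 0) (v := 1) s
  have e : NNReal.mk (s ^ 2) (sq_nonneg s) * 1 = (s ^ 2).toNNReal := by
    rw [mul_one]; ext; simp [Real.coe_toNNReal _ (sq_nonneg s)]
  rw [mul_zero] at hmap
  have hm : Measurable fun x : ℝ => ‖x‖ₑ ^ ν := by fun_prop
  rw [← e, ← hmap, lintegral_map hm (by fun_prop), gaussianMoment,
    ← lintegral_const_mul _ hm]
  congr 1 with x
  rw [enorm_mul, ENNReal.mul_rpow_of_nonneg _ _ hν.le]

/-- One replacement in the Lindeberg method, for real random variables. -/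
theorem IsSmoothStep.abs_integral_sub_gaussian_le {H : ℝ → ℝ} {ν K : ℝ} (hH : IsSmoothStep H ν K)
    (hK : 0 < K) (hν : 2 < ν) {P : Measure ℝ} [IsProbabilityMeasure P] (hP : MemLp id 2 P)
    (hmean : ∫ x, x ∂P = 0) (a D : ℝ) (hD : 0 < D) :
    ENNReal.ofReal |∫ x, H ((a + x) / D) ∂P
        - ∫ x, H ((a + x) / D) ∂(gaussianReal 0 (∫ x, x ^ 2 ∂P).toNNReal)|
      ≤ ENNReal.ofReal (K / D ^ ν) * (1 + gaussianMoment ν) * ∫⁻ x, ‖x‖ₑ ^ ν ∂P := by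
  set v := ∫ x, x ^ 2 ∂P with hv
  have hv0 : 0 ≤ v := integral_nonneg fun x => sq_nonneg x
  set Q := gaussianReal 0 v.toNNReal with hQ
  have hν0 : 0 < ν := by linarith
  -- The Gaussian moment of order `ν` is `v ^ (ν / 2)` times a constant, and `v ^ (ν / 2)` is at
  -- most the corresponding moment of `P` by monotonicity of `L^p` norms.
  have hmomQ : ∫⁻ x, ‖x‖ₑ ^ ν ∂Q ≤ gaussianMoment ν * ∫⁻ x, ‖x‖ₑ ^ ν ∂P := by
    have h1 : ∫⁻ x, ‖x‖ₑ ^ ν ∂Q = ‖√v‖ₑ ^ ν * gaussianMoment ν := by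
      rw [← lintegral_rpow_gaussianReal hν0, Real.sq_sqrt hv0]
    have h2 : ‖√v‖ₑ = eLpNorm id 2 P := by
      rw [eLpNorm_eq_lintegral_rpow_enorm_toReal (by norm_num) (by norm_num), hv]
      have h5 : ∫⁻ x, ‖id x‖ₑ ^ (2 : ℝ≥0∞).toReal ∂P = ENNReal.ofReal (∫ x, x ^ 2 ∂P) := by
        rw [ofReal_integral_eq_lintegral_ofReal (f := fun x => x ^ 2) hP.integrable_sq (ae_of_all _ fun x => sq_nonneg x)]
        refine lintegral_congr fun x => ?_
        rw [← ofReal_norm, ENNReal.toReal_ofNat, Real.norm_eq_abs,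
          ENNReal.ofReal_rpow_of_nonneg (abs_nonneg _) (by norm_num), Real.rpow_two, sq_abs, id]
      rw [h5, ENNReal.ofReal_rpow_of_nonneg hv0 (by norm_num), ENNReal.toReal_ofNat,
        ← Real.sqrt_eq_rpow, ← ofReal_norm, Real.norm_of_nonneg (Real.sqrt_nonneg _)]
    have h3 : eLpNorm id 2 P ≤ eLpNorm id (ENNReal.ofReal ν) P := by
      refine eLpNorm_le_eLpNorm_of_exponent_le ?_ hP.1
      rw [← ENNReal.ofReal_ofNat]; exact ENNReal.ofReal_le_ofReal hν.le
    have h4 : eLpNorm id (ENNReal.ofReal ν) P ^ ν = ∫⁻ x, ‖x‖ₑ ^ ν ∂P := by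
      rw [eLpNorm_eq_lintegral_rpow_enorm_toReal (by simpa using hν0) ENNReal.ofReal_ne_top,
        ENNReal.toReal_ofReal hν0.le, ← ENNReal.rpow_mul, one_div, inv_mul_cancel₀ hν0.ne',
        ENNReal.rpow_one]
      rfl
    rw [h1, h2, mul_comm, ← h4]
    gcongr
  have hDν : 0 < D ^ ν := Real.rpow_pos_of_pos hD _
  have hKD : 0 < K / D ^ ν := by positivity
  rcases eq_or_ne (∫⁻ x, ‖x‖ₑ ^ ν ∂P) ∞ with htop | hfin
  · rw [htop, ENNReal.mul_top]
    · exact le_top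
    · refine mul_ne_zero (by simpa using hKD) (by simp)
  have hfinQ : ∫⁻ x, ‖x‖ₑ ^ ν ∂Q ≠ ∞ :=
    ne_top_of_le_ne_top (ENNReal.mul_ne_top (gaussianMoment_ne_top hν0) hfin) hmomQ
  obtain ⟨α, β, hT⟩ := hH.taylor (a / D)
  set T : ℝ → ℝ := fun x => H (a / D) + α / D * x + β / D ^ 2 * x ^ 2 with hTdef
  have hrem : ∀ x, |H ((a + x) / D) - T x| ≤ K / D ^ ν * |x| ^ ν := by
    intro x
    have := hT (x / D)
    rw [abs_div, abs_of_pos hD, Real.div_rpow (abs_nonneg _) hD.le] at this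
    calc |H ((a + x) / D) - T x| = |H (a / D + x / D) - H (a / D) - α * (x / D) - β * (x / D) ^ 2| := by
          rw [hTdef, add_div]; congr 1; ring
      _ ≤ K * (|x| ^ ν / D ^ ν) := this
      _ = _ := by ring
  have hQ2 : MemLp id 2 Q := memLp_id_gaussianReal' 2 (by simp)
  have hmeanQ : ∫ x, x ∂Q = 0 := integral_id_gaussianReal
  have hvQ : ∫ x, x ^ 2 ∂Q = v := by
    have h1 : Var[fun x => x; Q] = v := by
      rw [hQ, variance_fun_id_gaussianReal, Real.coe_toNNReal _ hv0]
    rw [variance_eq_integral aemeasurable_id', hmeanQ] at h1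
    simpa using h1
  -- The Taylor polynomial has the same integral under `P` and `Q`, since mean and variance agree;
  -- only the remainders survive.
  have hTint : ∀ ρ : Measure ℝ, IsProbabilityMeasure ρ → MemLp id 2 ρ → (∫ x, x ∂ρ) = 0 →
      (∫ x, x ^ 2 ∂ρ) = v → Integrable T ρ ∧ (∫ x, T x ∂ρ) = H (a / D) + β / D ^ 2 * v := by
    intro ρ _ hρ hρ1 hρ2
    have i1 : Integrable (fun x : ℝ => x) ρ := hρ.integrable (by norm_num)
    have i2 : Integrable (fun x : ℝ => x ^ 2) ρ := hρ.integrable_sq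
    have j1 : Integrable (fun x : ℝ => H (a / D) + α / D * x) ρ :=
      (integrable_const _).add (i1.const_mul _)
    refine ⟨j1.add (i2.const_mul _), ?_⟩
    rw [hTdef, integral_add j1 (i2.const_mul _), integral_add (integrable_const _) (i1.const_mul _),
      integral_const_mul, integral_const_mul, hρ1, hρ2]
    simp
  have hHint : ∀ ρ : Measure ℝ, IsProbabilityMeasure ρ → Integrable (fun x => H ((a + x) / D)) ρ := by
    intro ρ _
    refine Integrable.of_bound (C := 1) ?_ (ae_of_all _ fun x => ?_)
    · exact (hH.continuous.comp (by fun_prop)).aestronglyMeasurable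
    · rw [Real.norm_eq_abs, abs_of_nonneg (hH.nonneg _)]; exact hH.le_one _
  have hbound : ∀ ρ : Measure ℝ, IsProbabilityMeasure ρ → Integrable T ρ →
      ENNReal.ofReal |(∫ x, H ((a + x) / D) ∂ρ) - (∫ x, T x ∂ρ)|
        ≤ ENNReal.ofReal (K / D ^ ν) * ∫⁻ x, ‖x‖ₑ ^ ν ∂ρ := by
    intro ρ hρ hTR
    rw [← integral_sub (hHint ρ hρ) hTR, ← Real.norm_eq_abs, ofReal_norm]
    refine (enorm_integral_le_lintegral_enorm _).trans ?_
    rw [← lintegral_const_mul _ (by fun_prop)]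
    refine lintegral_mono fun x => ?_
    rw [← ofReal_norm, ← ofReal_norm, ENNReal.ofReal_rpow_of_nonneg (norm_nonneg _)
      hν0.le, ← ENNReal.ofReal_mul hKD.le]
    exact ENNReal.ofReal_le_ofReal (hrem x)
  obtain ⟨hTP, hTP'⟩ := hTint P inferInstance hP hmean rfl
  obtain ⟨hTQ, hTQ'⟩ := hTint Q inferInstance hQ2 hmeanQ hvQ
  calc ENNReal.ofReal |∫ x, H ((a + x) / D) ∂P - ∫ x, H ((a + x) / D) ∂Q|
      ≤ ENNReal.ofReal (|∫ x, H ((a + x) / D) ∂P - ∫ x, T x ∂P|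
          + |∫ x, H ((a + x) / D) ∂Q - ∫ x, T x ∂Q|) := by
        refine ENNReal.ofReal_le_ofReal ?_
        rw [hTP', hTQ', abs_sub_comm (∫ x, H ((a + x) / D) ∂Q)]
        exact abs_sub_le _ _ _
    _ ≤ ENNReal.ofReal (K / D ^ ν) * (∫⁻ x, ‖x‖ₑ ^ ν ∂P)
          + ENNReal.ofReal (K / D ^ ν) * (gaussianMoment ν * ∫⁻ x, ‖x‖ₑ ^ ν ∂P) := by
        rw [ENNReal.ofReal_add (abs_nonneg _) (abs_nonneg _)]
        exact add_le_add (hbound P inferInstance hTP)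
          ((hbound Q inferInstance hTQ).trans (by gcongr))
    _ = _ := by ring

/-! ### Replacement of one random vector. -/

section Replacement

variable {n d : ℕ} {q : MvPolynomial (Fin n × Fin d) ℝ} {Ω : Type*} [MeasurableSpace Ω]
  {μ : Measure Ω} [IsProbabilityMeasure μ]

theorem variance_inner_eq_of_hasLaw {X Z : Ω → EuclideanSpace ℝ (Fin d)} (hX : MemLp X 2 μ)
    (hZ : HasLaw Z (multivariateGaussian (∫ ω, X ω ∂μ) (covMatrix X μ)) μ)
    (b : EuclideanSpace ℝ (Fin d)) :
    Var[fun ω => ⟪b, X ω⟫; μ] = Var[fun ω => ⟪b, Z ω⟫; μ] := by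
  have hZ2 : MemLp Z 2 μ := memLp_of_hasLaw_multivariateGaussian hZ 2 (by simp)
  have key : ∀ Y : Ω → EuclideanSpace ℝ (Fin d), MemLp Y 2 μ → Var[fun ω => ⟪b, Y ω⟫; μ]
      = ∑ i, ∑ j, b j * (b i * covariance (fun ω => Y ω i) (fun ω => Y ω j) μ) := by
    intro Y hY
    have hj : ∀ j, MemLp (fun ω => b j * Y ω j) 2 μ := fun j => (MemLp.eval_piLp hY j).const_mul _
    have hin : ∀ ω, ⟪b, Y ω⟫ = ∑ j, b j * Y ω j := by
      intro ω
      rw [PiLp.inner_apply]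
      exact Finset.sum_congr rfl fun j _ => by simp [mul_comm]
    simp only [hin]
    rw [← covariance_self, covariance_fun_sum_fun_sum hj hj]
    · simp only [covariance_const_mul_left, covariance_const_mul_right]
    · exact (memLp_finsetSum _ fun j _ => hj j).aestronglyMeasurable.aemeasurable
  rw [key X hX, key Z hZ2]
  simp only [covariance_eval_eq_of_hasLaw hX hZ]

/-- With the other arguments frozen, only the scalar `⟪b, X⟫` matters. The pairing `⟪b, Z⟫` is
Gaussian with the same mean and variance, so centring both reduces to the scalar case. -/
theorem IsSmoothStep.abs_integral_inner_sub_le {H : ℝ → ℝ} {ν K : ℝ} (hH : IsSmoothStep H ν K)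
    (hK : 0 < K) (hν : 2 < ν) {X Z : Ω → EuclideanSpace ℝ (Fin d)} (hX : MemLp X 2 μ)
    (hZ : HasLaw Z (multivariateGaussian (∫ ω, X ω ∂μ) (covMatrix X μ)) μ)
    (a : ℝ) (b : EuclideanSpace ℝ (Fin d)) {D : ℝ} (hD : 0 < D) :
    ENNReal.ofReal |∫ ω, H ((a + ⟪b, X ω⟫) / D) ∂μ - ∫ ω, H ((a + ⟪b, Z ω⟫) / D) ∂μ|
      ≤ ENNReal.ofReal (K / D ^ ν) * (1 + gaussianMoment ν)
        * ∫⁻ ω, ‖⟪b, X ω - ∫ ω', X ω' ∂μ⟫‖ₑ ^ ν ∂μ := by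
  set m := ∫ ω, X ω ∂μ with hm
  have hZ2 : MemLp Z 2 μ := memLp_of_hasLaw_multivariateGaussian hZ 2 (by simp)
  have hbX : MemLp (fun ω => ⟪b, X ω⟫) 2 μ := hX.const_inner b
  have hbZ : MemLp (fun ω => ⟪b, Z ω⟫) 2 μ := hZ2.const_inner b
  have hmX : ∫ ω, ⟪b, X ω⟫ ∂μ = ⟪b, m⟫ := integral_inner (hX.integrable (by norm_num)) b
  have hmZ : ∫ ω, ⟪b, Z ω⟫ ∂μ = ⟪b, m⟫ := by
    rw [integral_inner (hZ2.integrable (by norm_num)) b, hZ.integral_eq,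
      integral_id_multivariateGaussian]
  set U : Ω → ℝ := fun ω => ⟪b, X ω⟫ - ⟪b, m⟫ with hU
  set V : Ω → ℝ := fun ω => ⟪b, Z ω⟫ - ⟪b, m⟫ with hV
  have hU2 : MemLp U 2 μ := hbX.sub (memLp_const _)
  have hV2 : MemLp V 2 μ := hbZ.sub (memLp_const _)
  have hUm : AEMeasurable U μ := hU2.aestronglyMeasurable.aemeasurable
  have hVm : AEMeasurable V μ := hV2.aestronglyMeasurable.aemeasurable
  have hcont : Continuous fun x : ℝ => H ((a + ⟪b, m⟫ + x) / D) := hH.continuous.comp (by fun_prop)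
  set P := μ.map U with hP
  have : IsProbabilityMeasure P := Measure.isProbabilityMeasure_map hUm
  have hP2 : MemLp id 2 P := (memLp_map_measure_iff aestronglyMeasurable_id hUm).2 hU2
  have hPmean : ∫ x, x ∂P = 0 := by
    rw [hP, integral_map hUm (by fun_prop), hU, integral_sub (hbX.integrable (by norm_num))
      (integrable_const _), hmX]
    simp
  have hPvar : ∫ x, x ^ 2 ∂P = Var[fun ω => ⟪b, X ω⟫; μ] := by
    rw [hP, integral_map hUm (by fun_prop), variance_eq_integral
      hbX.aestronglyMeasurable.aemeasurable, hmX]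
  have hQ : μ.map V = gaussianReal 0 (∫ x, x ^ 2 ∂P).toNNReal := by
    have h1 : μ.map (fun ω => ⟪b, Z ω⟫)
        = gaussianReal ⟪b, m⟫ (Var[fun ω => ⟪b, Z ω⟫; μ]).toNNReal := by
      have := ((hZ.hasGaussianLaw).map_fun (innerSL ℝ b)).map_eq_gaussianReal
      simp only [innerSL_apply_apply] at this
      rw [this, hmZ]
    have h2 := gaussianReal_map_sub_const (μ := ⟪b, m⟫)
      (v := (Var[fun ω => ⟪b, Z ω⟫; μ]).toNNReal) ⟪b, m⟫
    rw [sub_self, ← h1, AEMeasurable.map_map_of_aemeasurable (by fun_prop)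
      hbZ.aestronglyMeasurable.aemeasurable] at h2
    rw [hPvar, variance_inner_eq_of_hasLaw hX hZ, ← h2]
    rfl
  have hmain := hH.abs_integral_sub_gaussian_le hK hν hP2 hPmean (a + ⟪b, m⟫) D hD
  rw [← hQ, integral_map hVm hcont.aestronglyMeasurable, hP,
    integral_map hUm hcont.aestronglyMeasurable,
    lintegral_map' (by fun_prop) hUm] at hmain
  simp only [hU, hV, add_add_sub_cancel] at hmain
  simp only [← inner_sub_right] at hmain
  exact hmain

theorem IsMultilinear.continuous_partialGrad (hq : IsMultilinear q) (i : Fin n) :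
    Continuous (partialGrad q i) := by
  have hj : ∀ x j, partialGrad q i x j = evalAt q (Function.update x i (EuclideanSpace.single j 1))
      - evalAt q (Function.update x i 0) := by
    intro x j
    rw [hq.evalAt_update i x (EuclideanSpace.single j 1), EuclideanSpace.inner_single_right]
    simp
  have hupd : ∀ e : EuclideanSpace ℝ (Fin d), Continuous fun x => evalAt q (Function.update x i e) :=
    fun e => (continuous_evalAt q).comp (continuous_id.update i continuous_const)
  have : Continuous fun x => WithLp.toLp 2 fun j => partialGrad q i x j := by
    refine (PiLp.continuous_toLp 2 _).comp (continuous_pi fun j => ?_)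
    simp only [hj]
    exact (hupd _).sub (hupd _)
  exact this

/-- One replacement in the Lindeberg method. -/
theorem IsSmoothStep.abs_integral_update_sub_le {H : ℝ → ℝ} {ν K : ℝ} (hH : IsSmoothStep H ν K)
    (hK : 0 < K) (hν : 2 < ν) (hq : IsMultilinear q) {X Z : Ω → EuclideanSpace ℝ (Fin d)}
    (hX : MemLp X 2 μ)
    (hZ : HasLaw Z (multivariateGaussian (∫ ω, X ω ∂μ) (covMatrix X μ)) μ)
    {W : Ω → Fin n → EuclideanSpace ℝ (Fin d)} (hW : AEMeasurable W μ)
    (hWX : IndepFun W X μ) (hWZ : IndepFun W Z μ) (i : Fin n) (T : ℝ) {D : ℝ} (hD : 0 < D) :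
    ENNReal.ofReal |∫ ω, H ((evalAt q (Function.update (W ω) i (X ω)) - T) / D) ∂μ
        - ∫ ω, H ((evalAt q (Function.update (W ω) i (Z ω)) - T) / D) ∂μ|
      ≤ ENNReal.ofReal (K / D ^ ν) * (1 + gaussianMoment ν)
        * ∫⁻ ω, ‖⟪partialGrad q i (W ω), X ω - ∫ ω', X ω' ∂μ⟫‖ₑ ^ ν ∂μ := by
  have hXm : AEMeasurable X μ := hX.aestronglyMeasurable.aemeasurable
  have hZm : AEMeasurable Z μ := hZ.aemeasurable
  set F : (Fin n → EuclideanSpace ℝ (Fin d)) × EuclideanSpace ℝ (Fin d) → ℝ :=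
    fun p => H ((evalAt q (Function.update p.1 i p.2) - T) / D) with hF
  have hFc : Continuous F := by
    refine hH.continuous.comp ?_
    have : Continuous fun p : (Fin n → EuclideanSpace ℝ (Fin d)) × EuclideanSpace ℝ (Fin d) =>
        evalAt q (Function.update p.1 i p.2) :=
      (continuous_evalAt q).comp (continuous_fst.update i continuous_snd)
    fun_prop
  have hFb : ∀ p, ‖F p‖ ≤ 1 := fun p => by
    rw [Real.norm_eq_abs, abs_of_nonneg (hH.nonneg _)]; exact hH.le_one _
  -- Independence lets `W` be frozen: integrate over the replaced vector first, then over the law of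
  -- `W`.
  have hsplit : ∀ Y : Ω → EuclideanSpace ℝ (Fin d), AEMeasurable Y μ → IndepFun W Y μ →
      Integrable (fun w => ∫ ω, F (w, Y ω) ∂μ) (μ.map W) ∧
      ∫ ω, F (W ω, Y ω) ∂μ = ∫ w, ∫ ω, F (w, Y ω) ∂μ ∂(μ.map W) := by
    intro Y hY hWY
    have : IsProbabilityMeasure (μ.map Y) := Measure.isProbabilityMeasure_map hY
    have : IsProbabilityMeasure (μ.map W) := Measure.isProbabilityMeasure_map hW
    have hint : Integrable F ((μ.map W).prod (μ.map Y)) :=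
      Integrable.of_bound hFc.aestronglyMeasurable 1 (ae_of_all _ hFb)
    have hin : ∀ w, ∫ y, F (w, y) ∂(μ.map Y) = ∫ ω, F (w, Y ω) ∂μ := fun w =>
      integral_map hY (hFc.comp (by fun_prop)).aestronglyMeasurable
    simp only [← hin]
    refine ⟨hint.integral_prod_left, ?_⟩
    rw [← integral_prod _ hint, ← (indepFun_iff_map_prod_eq_prod_map_map hW hY).1 hWY,
      integral_map (hW.prodMk hY) hFc.aestronglyMeasurable]
  obtain ⟨hiX, heX⟩ := hsplit X hXm hWX
  obtain ⟨hiZ, heZ⟩ := hsplit Z hZm hWZ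
  set c := ENNReal.ofReal (K / D ^ ν) * (1 + gaussianMoment ν) with hc
  set G : (Fin n → EuclideanSpace ℝ (Fin d)) × EuclideanSpace ℝ (Fin d) → ℝ≥0∞ :=
    fun p => ‖⟪partialGrad q i p.1, p.2 - ∫ ω', X ω' ∂μ⟫‖ₑ ^ ν with hG
  have hGm : Measurable G := by
    have := hq.continuous_partialGrad i
    have : Continuous fun p : (Fin n → EuclideanSpace ℝ (Fin d)) × EuclideanSpace ℝ (Fin d) =>
        ⟪partialGrad q i p.1, p.2 - ∫ ω', X ω' ∂μ⟫ := by fun_prop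
    exact this.measurable.enorm.pow_const ν
  have hlin : ∫⁻ ω, G (W ω, X ω) ∂μ = ∫⁻ w, ∫⁻ ω, G (w, X ω) ∂μ ∂(μ.map W) := by
    have : IsProbabilityMeasure (μ.map X) := Measure.isProbabilityMeasure_map hXm
    have hin : ∀ w, ∫⁻ y, G (w, y) ∂(μ.map X) = ∫⁻ ω, G (w, X ω) ∂μ := fun w =>
      lintegral_map' (hGm.comp (by fun_prop)).aemeasurable hXm
    simp only [← hin]
    rw [← lintegral_prod _ hGm.aemeasurable,
      ← (indepFun_iff_map_prod_eq_prod_map_map hW hXm).1 hWX,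
      lintegral_map' hGm.aemeasurable (hW.prodMk hXm)]
  have hpt : ∀ w, ‖∫ ω, F (w, X ω) ∂μ - ∫ ω, F (w, Z ω) ∂μ‖ₑ ≤ c * ∫⁻ ω, G (w, X ω) ∂μ := by
    intro w
    have := hH.abs_integral_inner_sub_le hK hν hX hZ
      (evalAt q (Function.update w i 0) - T) (partialGrad q i w) hD
    rw [← ofReal_norm, Real.norm_eq_abs]
    convert this using 6 with ω ω <;>
    · simp only [hF]
      rw [hq.evalAt_update]
      ring_nf
  calc ENNReal.ofReal |∫ ω, F (W ω, X ω) ∂μ - ∫ ω, F (W ω, Z ω) ∂μ|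
      = ‖∫ w, (∫ ω, F (w, X ω) ∂μ - ∫ ω, F (w, Z ω) ∂μ) ∂(μ.map W)‖ₑ := by
        rw [heX, heZ, ← integral_sub hiX hiZ, ← ofReal_norm, Real.norm_eq_abs]
    _ ≤ ∫⁻ w, ‖∫ ω, F (w, X ω) ∂μ - ∫ ω, F (w, Z ω) ∂μ‖ₑ ∂(μ.map W) :=
        enorm_integral_le_lintegral_enorm _
    _ ≤ ∫⁻ w, c * ∫⁻ ω, G (w, X ω) ∂μ ∂(μ.map W) := lintegral_mono hpt
    _ = c * ∫⁻ ω, G (W ω, X ω) ∂μ := by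
        have hin : ∀ w, ∫⁻ y, G (w, y) ∂(μ.map X) = ∫⁻ ω, G (w, X ω) ∂μ := fun w =>
          lintegral_map' (hGm.comp (by fun_prop)).aemeasurable hXm
        have : IsProbabilityMeasure (μ.map X) := Measure.isProbabilityMeasure_map hXm
        rw [hlin]
        simp only [← hin]
        rw [lintegral_const_mul _ hGm.lintegral_prod_right']

end Replacement

/-! ### Telescoping and passage to distribution functions. -/

section Lindeberg

variable {n d : ℕ} {q : MvPolynomial (Fin n × Fin d) ℝ} {Ω : Type*} [MeasurableSpace Ω]
  {μ : Measure Ω} {X Z : Fin n → Ω → EuclideanSpace ℝ (Fin d)}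

theorem aemeasurable_hybrid (hX : ∀ i, AEMeasurable (X i) μ) (hZ : ∀ i, AEMeasurable (Z i) μ)
    (i : Fin n) : AEMeasurable (hybrid X Z i) μ := by
  refine aemeasurable_pi_iff.2 fun k => ?_
  unfold hybrid
  split_ifs
  · exact hX k
  · exact aemeasurable_const
  · exact hZ k

/-- The hybrid is a measurable function of the family with both `Xᵢ` and `Zᵢ` removed. -/
theorem indepFun_hybrid (hind : iIndepFun (Sum.elim X Z) μ) (hX : ∀ i, AEMeasurable (X i) μ)
    (hZ : ∀ i, AEMeasurable (Z i) μ) (i : Fin n) :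
    IndepFun (hybrid X Z i) (X i) μ ∧ IndepFun (hybrid X Z i) (Z i) μ := by
  classical
  set S : Finset (Fin n ⊕ Fin n) := Finset.univ.filter fun s => s ≠ .inl i ∧ s ≠ .inr i with hS
  have hm : ∀ s, AEMeasurable (Sum.elim X Z s) μ := by rintro (k | k) <;> simp [hX, hZ]
  have hl : ∀ k, k < i → (.inl k : Fin n ⊕ Fin n) ∈ S := fun k hk => by simp [hS, hk.ne]
  have hr : ∀ k, k ≠ i → (.inr k : Fin n ⊕ Fin n) ∈ S := fun k hk => by simp [hS, hk]
  set g : (S → EuclideanSpace ℝ (Fin d)) → Fin n → EuclideanSpace ℝ (Fin d) := fun u k =>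
    if h : k < i then u ⟨.inl k, hl k h⟩ else if h : k = i then 0 else u ⟨.inr k, hr k h⟩ with hg
  have hgm : Measurable g := by
    refine measurable_pi_iff.2 fun k => ?_
    simp only [hg]
    split_ifs <;> fun_prop
  have hgW : (g ∘ fun ω (s : S) => Sum.elim X Z s ω) = hybrid X Z i := by
    ext1 ω
    ext1 k
    simp only [hg, hybrid, Function.comp_apply]
    split_ifs <;> simp
  have key : ∀ s : Fin n ⊕ Fin n, s ∉ S → IndepFun (hybrid X Z i) (Sum.elim X Z s) μ := by
    intro s hs
    have h := hind.indepFun_finset₀ S {s} (by simpa using hs) hm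
    have := h.comp hgm (measurable_pi_apply (⟨s, Finset.mem_singleton_self s⟩ : ({s} : Finset _)))
    rw [hgW] at this
    exact this
  exact ⟨key (.inl i) (by simp [hS]), key (.inr i) (by simp [hS])⟩

variable [IsProbabilityMeasure μ]

/-- Let `E j` take its first `j` arguments from `X` and the others from `Z`. Then `E (i + 1)` and `E
i` come from the same hybrid by filling slot `i` with `Xᵢ` or `Zᵢ`, and the differences telescope.
-/
theorem IsSmoothStep.abs_integral_sub_le_sum {H : ℝ → ℝ} {ν K : ℝ} (hH : IsSmoothStep H ν K)
    (hK : 0 < K) (hν : 2 < ν) (hq : IsMultilinear q) (hind : iIndepFun (Sum.elim X Z) μ)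
    (hX : ∀ i, MemLp (X i) 2 μ)
    (hZ : ∀ i, HasLaw (Z i) (multivariateGaussian (∫ ω, X i ω ∂μ) (covMatrix (X i) μ)) μ)
    (T : ℝ) {D : ℝ} (hD : 0 < D) :
    ENNReal.ofReal |∫ ω, H ((evalAt q (fun i => X i ω) - T) / D) ∂μ
        - ∫ ω, H ((evalAt q (fun i => Z i ω) - T) / D) ∂μ|
      ≤ ENNReal.ofReal (K / D ^ ν) * (1 + gaussianMoment ν) * ∑ i, influence q X Z μ ν i ^ ν := by
  have hν0 : 0 < ν := by linarith
  have hXm : ∀ i, AEMeasurable (X i) μ := fun i => (hX i).aestronglyMeasurable.aemeasurable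
  have hZm : ∀ i, AEMeasurable (Z i) μ := fun i => (hZ i).aemeasurable
  set E : ℕ → ℝ := fun j =>
    ∫ ω, H ((evalAt q (fun k => if k.val < j then X k ω else Z k ω) - T) / D) ∂μ with hE
  have hstep : ∀ i : Fin n, ENNReal.ofReal |E (i + 1) - E i|
      ≤ ENNReal.ofReal (K / D ^ ν) * (1 + gaussianMoment ν) * influence q X Z μ ν i ^ ν := by
    intro i
    obtain ⟨h1, h2⟩ := indepFun_hybrid hind hXm hZm i
    have := hH.abs_integral_update_sub_le hK hν hq (hX i) (hZ i) (aemeasurable_hybrid hXm hZm i)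
      h1 h2 i T hD
    have hinf : influence q X Z μ ν i ^ ν = ∫⁻ ω, ‖⟪partialGrad q i (hybrid X Z i ω),
        X i ω - ∫ ω', X i ω' ∂μ⟫‖ₑ ^ ν ∂μ := by
      rw [influence, eLpNorm_eq_lintegral_rpow_enorm_toReal (by simpa using hν0)
        ENNReal.ofReal_ne_top, ENNReal.toReal_ofReal hν0.le, ← ENNReal.rpow_mul, one_div,
        inv_mul_cancel₀ hν0.ne', ENNReal.rpow_one]
    rw [hinf]
    have eX : ∀ ω, Function.update (hybrid X Z i ω) i (X i ω)
        = fun k => if k.val < i.val + 1 then X k ω else Z k ω := by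
      intro ω
      ext1 k
      rcases lt_trichotomy k i with h | h | h
      · have : k.val < i.val + 1 := by omega
        simp [Function.update_of_ne h.ne, hybrid, h, this]
      · subst h; simp
      · have : ¬ k.val < i.val + 1 := by omega
        simp [hybrid, h.not_gt, h.ne', this]
    have eZ : ∀ ω, Function.update (hybrid X Z i ω) i (Z i ω)
        = fun k => if k.val < i.val then X k ω else Z k ω := by
      intro ω
      ext1 k
      rcases lt_trichotomy k i with h | h | h
      · have : k.val < i.val := by omega
        simp [Function.update_of_ne h.ne, hybrid, h]
      · subst h; simp
      · have : ¬ k.val < i.val := by omega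
        simp [hybrid, h.not_gt, h.ne']
    simp only [eX, eZ] at this
    exact this
  have hn : E n = ∫ ω, H ((evalAt q (fun i => X i ω) - T) / D) ∂μ := by simp [hE]
  have h0 : E 0 = ∫ ω, H ((evalAt q (fun i => Z i ω) - T) / D) ∂μ := by simp [hE]
  rw [← hn, ← h0, ← Finset.sum_range_sub, ← Fin.sum_univ_eq_sum_range (fun j => E (j + 1) - E j),
    Finset.mul_sum]
  calc ENNReal.ofReal |∑ i : Fin n, (E (i + 1) - E i)|
      ≤ ENNReal.ofReal (∑ i : Fin n, |E (i + 1) - E i|) :=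
        ENNReal.ofReal_le_ofReal (Finset.abs_sum_le_sum_abs _ _)
    _ = ∑ i : Fin n, ENNReal.ofReal |E (i + 1) - E i| :=
        ENNReal.ofReal_sum_of_nonneg fun _ _ => abs_nonneg _
    _ ≤ _ := Finset.sum_le_sum fun i _ => hstep i

/-- Comparison of distribution functions through a smooth step of width `D`. -/
theorem IsSmoothStep.abs_measureReal_sub_le {H : ℝ → ℝ} {ν K : ℝ} (hH : IsSmoothStep H ν K)
    {f g : Ω → ℝ} (hf : AEMeasurable f μ) (hg : AEMeasurable g μ) (T : ℝ) {D B : ℝ} (hD : 0 < D)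
    (h : ∀ T', |∫ ω, H ((f ω - T') / D) ∂μ - ∫ ω, H ((g ω - T') / D) ∂μ| ≤ B) :
    |μ.real {ω | f ω ≤ T} - μ.real {ω | g ω ≤ T}| ≤ B + μ.real {ω | |g ω - T| ≤ D} := by
  have hint : ∀ {f : Ω → ℝ}, AEMeasurable f μ → ∀ T', Integrable (fun ω => H ((f ω - T') / D)) μ := by
    intro f hf T'
    refine Integrable.of_bound (C := 1) ?_ (ae_of_all _ fun x => ?_)
    · exact (hH.continuous.measurable.comp_aemeasurable
        ((hf.sub_const T').div_const D)).aestronglyMeasurable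
    · rw [Real.norm_eq_abs, abs_of_nonneg (hH.nonneg _)]; exact hH.le_one _
  have hset : ∀ {f : Ω → ℝ}, AEMeasurable f μ → ∀ T', NullMeasurableSet {ω | f ω ≤ T'} μ :=
    fun hf T' => hf.nullMeasurableSet_preimage measurableSet_Iic
  have hind : ∀ {s : Set Ω}, NullMeasurableSet s μ →
      ∫ ω, s.indicator (fun _ => (1 : ℝ)) ω ∂μ = μ.real s := fun {s} hs => by
    rw [integral_indicator₀ hs]; simp
  have hiint : ∀ {s : Set Ω}, NullMeasurableSet s μ →
      Integrable (s.indicator fun _ => (1 : ℝ)) μ := fun {s} hs =>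
    (integrable_const (1 : ℝ)).indicator₀ hs
  have hle : ∀ {f : Ω → ℝ}, AEMeasurable f μ → ∀ T',
      μ.real {ω | f ω ≤ T'} ≤ ∫ ω, H ((f ω - T') / D) ∂μ := by
    intro f hf T'
    rw [← hind (hset hf T')]
    refine integral_mono (hiint (hset hf T')) (hint hf T') fun ω => ?_
    by_cases hω : f ω ≤ T'
    · rw [indicator_of_mem (by exact hω), hH.eq_one _ (div_nonpos_of_nonpos_of_nonneg
        (by linarith) hD.le)]
    · rw [indicator_of_notMem (by exact hω)]; exact hH.nonneg _
  have hge : ∀ {f : Ω → ℝ}, AEMeasurable f μ → ∀ T',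
      ∫ ω, H ((f ω - T') / D) ∂μ ≤ μ.real {ω | f ω ≤ T' + D} := by
    intro f hf T'
    rw [← hind (hset hf _)]
    refine integral_mono (hint hf T') (hiint (hset hf _)) fun ω => ?_
    by_cases hω : f ω ≤ T' + D
    · rw [indicator_of_mem (by exact hω)]; exact hH.le_one _
    · rw [indicator_of_notMem (by exact hω), hH.eq_zero _ (by
        rw [le_div_iff₀ hD]; linarith [not_le.1 hω])]
  have hL : μ.real {ω | g ω ≤ T} ≤ μ.real {ω | g ω ≤ T - D} + μ.real {ω | |g ω - T| ≤ D} := by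
    refine (measureReal_mono ?_).trans (measureReal_union_le _ _)
    intro ω hω
    rcases le_or_gt (g ω) (T - D) with h' | h'
    · exact Or.inl h'
    · exact Or.inr (show |g ω - T| ≤ D from abs_le.2 ⟨by linarith, by linarith [show g ω ≤ T from hω]⟩)
  have hR : μ.real {ω | g ω ≤ T + D} ≤ μ.real {ω | g ω ≤ T} + μ.real {ω | |g ω - T| ≤ D} := by
    refine (measureReal_mono fun ω hω => ?_).trans (measureReal_union_le _ _)
    rcases le_or_gt (g ω) T with h' | h'
    · exact Or.inl h'
    · exact Or.inr (show |g ω - T| ≤ D from abs_le.2 ⟨by linarith, by linarith [show g ω ≤ T + D from hω]⟩)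
  -- The step started at `T` gives the upper bound and the step ending at `T` the lower one. Both
  -- are charged to the concentration of `g` alone, which will be the Gaussian side.
  have h1 := abs_le.1 (h T)
  have h2 := abs_le.1 (h (T - D))
  have e1 := hle hf T
  have e2 := hge hg T
  have e3 := hge hf (T - D)
  have e4 := hle hg (T - D)
  rw [sub_add_cancel] at e3
  rw [abs_le]
  constructor <;> linarith

end Lindeberg

/-! ### Small-ball estimate for the polynomial in general Gaussian vectors. -/

section AntiConcentration

variable {n d : ℕ} {q : MvPolynomial (Fin n × Fin d) ℝ} {Ω : Type*} [MeasurableSpace Ω]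
  {μ : Measure Ω} {Z : Fin n → Ω → EuclideanSpace ℝ (Fin d)}

theorem pi_stdGaussian_map_toLp {ι : Type*} [Fintype ι] {E : ι → Type*}
    [∀ i, NormedAddCommGroup (E i)] [∀ i, InnerProductSpace ℝ (E i)]
    [∀ i, FiniteDimensional ℝ (E i)] [∀ i, MeasurableSpace (E i)] [∀ i, BorelSpace (E i)] :
    (Measure.pi fun i => stdGaussian (E i)).map (WithLp.toLp 2) = stdGaussian (PiLp 2 E) := by
  apply Measure.ext_of_charFun
  ext t
  rw [charFun_stdGaussian, charFun_pi]
  simp_rw [charFun_stdGaussian, ← Complex.exp_sum, ← Complex.ofReal_pow, PiLp.norm_sq_eq_of_L2]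
  simp [Finset.sum_div, neg_div]

open scoped MatrixOrder in
/-- Independent Gaussian vectors are the image of a standard Gaussian vector under an affine map. -/
theorem exists_map_stdGaussian_eq (hind : iIndepFun Z μ) {v : Fin n → EuclideanSpace ℝ (Fin d)}
    {S : Fin n → Matrix (Fin d) (Fin d) ℝ}
    (hZ : ∀ i, HasLaw (Z i) (multivariateGaussian (v i) (S i)) μ) :
    ∃ (c : Fin n → EuclideanSpace ℝ (Fin d))
      (L : EuclideanSpace ℝ (Σ _ : Fin n, Fin d) →L[ℝ] (Fin n → EuclideanSpace ℝ (Fin d))),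
      μ.map (fun ω i => Z i ω) = (stdGaussian _).map fun x => c + L x := by
  set A : Fin n → (EuclideanSpace ℝ (Fin d) →L[ℝ] EuclideanSpace ℝ (Fin d)) := fun i =>
    Matrix.toEuclideanCLM (𝕜 := ℝ) (CFC.sqrt (S i)) with hA
  set e := LinearIsometryEquiv.piLpCurry ℝ 2 fun (_ : Fin n) (_ : Fin d) => ℝ with he
  set L₁ : EuclideanSpace ℝ (Σ _ : Fin n, Fin d) →L[ℝ] (Fin n → EuclideanSpace ℝ (Fin d)) :=
    (PiLp.continuousLinearEquiv 2 ℝ fun _ : Fin n => EuclideanSpace ℝ (Fin d)).toContinuousLinearMap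
      ∘L e.toContinuousLinearEquiv.toContinuousLinearMap with hL₁
  set L : EuclideanSpace ℝ (Σ _ : Fin n, Fin d) →L[ℝ] (Fin n → EuclideanSpace ℝ (Fin d)) :=
    ContinuousLinearMap.pi fun i => A i ∘L ContinuousLinearMap.proj i ∘L L₁ with hL
  refine ⟨v, L, ?_⟩
  have h1 : (stdGaussian (EuclideanSpace ℝ (Σ _ : Fin n, Fin d))).map L₁
      = Measure.pi fun _ : Fin n => stdGaussian (EuclideanSpace ℝ (Fin d)) := by
    have h2 : (stdGaussian (EuclideanSpace ℝ (Σ _ : Fin n, Fin d))).map e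
        = stdGaussian (PiLp 2 fun _ : Fin n => EuclideanSpace ℝ (Fin d)) := stdGaussian_map e
    have h3 : (L₁ : _ → _) = WithLp.ofLp ∘ e := rfl
    rw [h3, ← Measure.map_map (by fun_prop) (by fun_prop), h2, ← pi_stdGaussian_map_toLp,
      Measure.map_map (by fun_prop) (by fun_prop)]
    exact Measure.map_id
  have h4 : (fun x => v + L x) = (fun (y : Fin n → EuclideanSpace ℝ (Fin d)) i =>
      v i + A i (y i)) ∘ L₁ := rfl
  rw [hind.map_fun_eq_pi_map fun i => (hZ i).aemeasurable, h4,
    ← Measure.map_map (by fun_prop) (by fun_prop), h1]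
  simp only [(hZ _).map_eq]
  have (i : Fin n) : IsProbabilityMeasure ((stdGaussian (EuclideanSpace ℝ (Fin d))).map
      fun y => v i + A i y) := Measure.isProbabilityMeasure_map (by fun_prop)
  exact (Measure.pi_map_pi (f := fun i y => v i + A i y)
    fun i => (show Measurable fun y => v i + A i y by fun_prop).aemeasurable).symm

theorem isPolynomialOnLines_evalAt (q : MvPolynomial (Fin n × Fin d) ℝ) {m : ℕ}
    (hm : q.totalDegree ≤ m) : IsPolynomialOnLines (evalAt q) m := by
  intro x v
  refine ⟨MvPolynomial.aeval (fun p : Fin n × Fin d =>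
    Polynomial.C (x p.1 p.2) + Polynomial.C (v p.1 p.2) * Polynomial.X) q, ?_, fun t => ?_⟩
  · have := MvPolynomial.aeval_natDegree_le q hm (fun p : Fin n × Fin d =>
      Polynomial.C (x p.1 p.2) + Polynomial.C (v p.1 p.2) * Polynomial.X) (n := 1) fun p => by
        compute_degree
    simpa using this
  · rw [evalAt, ← Polynomial.coe_aeval_eq_eval, MvPolynomial.comp_aeval_apply,
      ← MvPolynomial.coe_aeval_eq_eval]
    simp [mul_comm t]

/-- Restriction to lines turns an affine change of variables into another such restriction of the
same degree, so Carbery–Wright transfers from the standard Gaussian even when covariances are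
singular. -/
theorem IsMultilinear.gaussian_small_ball_le [IsProbabilityMeasure μ] (hq : IsMultilinear q) {m : ℕ} (hm : 1 ≤ m)
    (hqm : q.totalDegree ≤ m) [Nonempty (Σ _ : Fin n, Fin d)] (hind : iIndepFun Z μ)
    {v : Fin n → EuclideanSpace ℝ (Fin d)} {S : Fin n → Matrix (Fin d) (Fin d) ℝ}
    (hZ : ∀ i, HasLaw (Z i) (multivariateGaussian (v i) (S i)) μ) (T : ℝ)
    (hpos : 0 < ∫ ω, (evalAt q (fun i => Z i ω) - T) ^ 2 ∂μ) {ε : ℝ} (hε : 0 < ε) :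
    μ.real {ω | |evalAt q (fun i => Z i ω) - T| ≤ ε} ≤ 256 * Real.exp 5 * m *
      (ε / √(∫ ω, (evalAt q (fun i => Z i ω) - T) ^ 2 ∂μ)) ^ (1 / (m : ℝ)) := by
  obtain ⟨c, L, hmap⟩ := exists_map_stdGaussian_eq hind hZ
  have hZm : AEMeasurable (fun ω i => Z i ω) μ := aemeasurable_pi_lambda _ fun i => (hZ i).aemeasurable
  have hΦ : Continuous fun x => c + L x := by fun_prop
  have hg : Continuous fun y => evalAt q y - T := (continuous_evalAt q).sub continuous_const
  set f : EuclideanSpace ℝ (Σ _ : Fin n, Fin d) → ℝ := fun x => evalAt q (c + L x) - T with hf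
  have hfc : Continuous f := hg.comp hΦ
  have hline : IsPolynomialOnLines f m := by
    intro x w
    obtain ⟨p, hp, hp'⟩ := isPolynomialOnLines_evalAt q hqm (c + L x) (L w)
    refine ⟨p - Polynomial.C T, by simpa using hp, fun t => ?_⟩
    rw [hf, Polynomial.eval_sub, Polynomial.eval_C, ← hp']
    simp [add_assoc]
  have hL2 : MemLp (fun ω => evalAt q (fun i => Z i ω) - T) 2 μ :=
    (hq.memLp_evalAt hind fun i => memLp_of_hasLaw_multivariateGaussian (hZ i) 2 (by simp)).sub
      (memLp_const T)
  have hfL2 : MemLp f 2 (stdGaussian _) := by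
    have h1 := (memLp_map_measure_iff (p := 2) hg.aestronglyMeasurable hZm).2 hL2
    rw [hmap] at h1
    exact (memLp_map_measure_iff hg.aestronglyMeasurable hΦ.aemeasurable).1 h1
  have hint : ∫ ω, (evalAt q (fun i => Z i ω) - T) ^ 2 ∂μ = ∫ x, f x ^ 2 ∂(stdGaussian _) := by
    have hg2 : Continuous fun y => (evalAt q y - T) ^ 2 := hg.pow 2
    rw [← integral_map (f := fun y => (evalAt q y - T) ^ 2) hZm hg2.aestronglyMeasurable, hmap,
      integral_map hΦ.aemeasurable hg2.aestronglyMeasurable]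
  have hset : μ.real {ω | |evalAt q (fun i => Z i ω) - T| ≤ ε}
      = (stdGaussian _).real {x | |f x| ≤ ε} := by
    have hms : MeasurableSet {y | |evalAt q y - T| ≤ ε} :=
      measurableSet_le hg.abs.measurable measurable_const
    have h1 := map_measureReal_apply_of_aemeasurable hZm hms
    rw [hmap, map_measureReal_apply_of_aemeasurable hΦ.aemeasurable hms] at h1
    exact h1.symm
  rw [hset, hint]
  rw [hint] at hpos
  exact stdGaussian_small_ball_le hm hfc hline hfL2 hpos hε

end AntiConcentration

/-! ### Optimal smoothing width and the main theorem. -/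

theorem le_mul_rpow_of_forall_le_add {Δ A B ν s : ℝ} {m : ℕ} (hm : 1 ≤ m) (hν : 0 < ν) (hs : 0 ≤ s)
    (hA : 0 ≤ A) (hB : 0 < B)
    (h : ∀ τ > 0, Δ ≤ A * s / τ ^ ν + B * m * τ ^ (1 / (m : ℝ))) :
    Δ ≤ (A + B) * m * s ^ (1 / (ν * m + 1)) := by
  have hm1 : (1 : ℝ) ≤ m := by exact_mod_cast hm
  have hm0 : (0 : ℝ) < m := by linarith
  have hν1 : 0 < ν * m + 1 := by positivity
  rcases hs.eq_or_lt with rfl | hs0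
  · rw [Real.zero_rpow (by positivity), mul_zero]
    refine le_of_forall_pos_le_add fun η hη => ?_
    -- For `s = 0` the bound vanishes as `τ → 0`; its `m`-th power, used as `τ`, makes the second
    -- term equal to `η`.
    have hτ : 0 < η / (B * m) := by positivity
    have := h ((η / (B * m)) ^ (m : ℝ)) (Real.rpow_pos_of_pos hτ _)
    rw [← Real.rpow_mul hτ.le _ (1 / (m : ℝ)), mul_one_div_cancel hm0.ne', Real.rpow_one,
      mul_div_cancel₀ _ (by positivity)] at this
    simpa using this
  -- This `τ` balances `s / τ ^ ν` with `τ ^ (1 / m)`.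
  · have := h (s ^ (m / (ν * m + 1))) (Real.rpow_pos_of_pos hs0 _)
    have e1 : s / (s ^ (m / (ν * m + 1))) ^ ν = s ^ (1 / (ν * m + 1)) := by
      rw [← Real.rpow_mul hs]
      nth_rw 1 [← Real.rpow_one s]
      rw [← Real.rpow_sub hs0]
      congr 1
      field_simp
      ring
    have e2 : (s ^ (m / (ν * m + 1))) ^ (1 / (m : ℝ)) = s ^ (1 / (ν * m + 1)) := by
      rw [← Real.rpow_mul hs]
      congr 1
      field_simp
    rw [mul_div_assoc, e1, e2] at this
    have hr : 0 ≤ s ^ (1 / (ν * m + 1)) := Real.rpow_nonneg hs _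
    nlinarith [mul_nonneg (mul_nonneg hA hr) (sub_nonneg.2 hm1)]

theorem variance_evalAt_eq_zero_of_isEmpty {n d : ℕ} [IsEmpty (Fin n × Fin d)]
    (q : MvPolynomial (Fin n × Fin d) ℝ) {Ω : Type*} [MeasurableSpace Ω] (μ : Measure Ω)
    [IsProbabilityMeasure μ] (X : Fin n → Ω → EuclideanSpace ℝ (Fin d)) :
    Var[fun ω => evalAt q fun i => X i ω; μ] = 0 := by
  have : (fun ω => evalAt q fun i => X i ω) = fun _ => evalAt q 0 := by
    ext ω
    unfold evalAt
    congr 2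
    exact Subsingleton.elim _ _
  rw [this]
  simp [variance_eq_integral aemeasurable_const]

section Main

variable {n d : ℕ} {q : MvPolynomial (Fin n × Fin d) ℝ} {Ω : Type*} [MeasurableSpace Ω]
  {μ : Measure Ω} [IsProbabilityMeasure μ] {X Z : Fin n → Ω → EuclideanSpace ℝ (Fin d)}

theorem IsMultilinear.moments_eq (hq : IsMultilinear q) (hindX : iIndepFun X μ)
    (hindZ : iIndepFun Z μ) (hX : ∀ i, MemLp (X i) 2 μ)
    (hZ : ∀ i, HasLaw (Z i) (multivariateGaussian (∫ ω, X i ω ∂μ) (covMatrix (X i) μ)) μ) :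
    ∫ ω, evalAt q (fun i => X i ω) ∂μ = ∫ ω, evalAt q (fun i => Z i ω) ∂μ ∧
      Var[fun ω => evalAt q (fun i => X i ω); μ] = Var[fun ω => evalAt q (fun i => Z i ω); μ] := by
  have hZ2 : ∀ i, MemLp (Z i) 2 μ := fun i =>
    memLp_of_hasLaw_multivariateGaussian (hZ i) 2 (by simp)
  obtain ⟨c, hc⟩ := hq.integral_evalAt_sq (μ := μ)
  obtain ⟨h1, h2⟩ := hc hindX hX
  obtain ⟨h3, h4⟩ := hc hindZ hZ2
  simp only [integral_affineBasis_mul_eq (hX _) (hZ _)] at h1 h2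
  have hmean := h1.trans h3.symm
  have hsq := h2.trans h4.symm
  refine ⟨hmean, ?_⟩
  rw [variance_eq_sub (hq.memLp_evalAt hindX hX), variance_eq_sub (hq.memLp_evalAt hindZ hZ2), hmean]
  simp only [Pi.pow_apply, hsq]

/-- The width is `s * τ` with `s` the root mean square of `q(Z) - T`, which makes the small-ball
term a function of `τ` and `m` only. -/
theorem IsSmoothStep.abs_cdf_sub_le {H : ℝ → ℝ} {ν K : ℝ} (hH : IsSmoothStep H ν K)
    (hK : 0 < K) (hν : 2 < ν) (hq : IsMultilinear q) {m : ℕ} (hm : 1 ≤ m)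
    (hqm : q.totalDegree ≤ m) (hind : iIndepFun (Sum.elim X Z) μ) (hindZ : iIndepFun Z μ)
    (hX : ∀ i, MemLp (X i) 2 μ)
    (hZ : ∀ i, HasLaw (Z i) (multivariateGaussian (∫ ω, X i ω ∂μ) (covMatrix (X i) μ)) μ)
    [Nonempty (Σ _ : Fin n, Fin d)] (T : ℝ) {s : ℝ} (hs : 0 < s)
    (hvar : ∫ ω, (evalAt q (fun i => Z i ω) - T) ^ 2 ∂μ = s ^ 2)
    (hfin : ∑ i, influence q X Z μ ν i ^ ν ≠ ∞) {τ : ℝ} (hτ : 0 < τ) :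
    |μ.real {ω | evalAt q (fun i => X i ω) ≤ T} - μ.real {ω | evalAt q (fun i => Z i ω) ≤ T}|
      ≤ K * (1 + (gaussianMoment ν).toReal) * ((∑ i, influence q X Z μ ν i ^ ν).toReal / s ^ ν)
          / τ ^ ν + 256 * Real.exp 5 * m * τ ^ (1 / (m : ℝ)) := by
  have hν0 : 0 < ν := by linarith
  have hmeas : ∀ {Y : Fin n → Ω → EuclideanSpace ℝ (Fin d)}, (∀ i, AEMeasurable (Y i) μ) →
      AEMeasurable (fun ω => evalAt q fun i => Y i ω) μ := fun hY =>
    (continuous_evalAt q).measurable.comp_aemeasurable (aemeasurable_pi_lambda _ hY)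
  have hD : 0 < s * τ := by positivity
  have hDν : 0 < (s * τ) ^ ν := Real.rpow_pos_of_pos hD _
  set M := ∑ i, influence q X Z μ ν i ^ ν with hM
  have hB : ∀ T', |∫ ω, H ((evalAt q (fun i => X i ω) - T') / (s * τ)) ∂μ
      - ∫ ω, H ((evalAt q (fun i => Z i ω) - T') / (s * τ)) ∂μ|
      ≤ K / (s * τ) ^ ν * (1 + (gaussianMoment ν).toReal) * M.toReal := by
    intro T'
    have h1 := hH.abs_integral_sub_le_sum hK hν hq hind hX hZ T' hD
    rw [ENNReal.ofReal_le_iff_le_toReal, ENNReal.toReal_mul, ENNReal.toReal_mul,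
      ENNReal.toReal_ofReal (by positivity), ENNReal.toReal_add (by simp)
      (gaussianMoment_ne_top hν0), ENNReal.toReal_one] at h1
    · exact h1
    · exact ENNReal.mul_ne_top (ENNReal.mul_ne_top ENNReal.ofReal_ne_top
        (ENNReal.add_ne_top.2 ⟨by simp, gaussianMoment_ne_top hν0⟩)) hfin
  have h2 := hH.abs_measureReal_sub_le (hmeas fun i => (hX i).aestronglyMeasurable.aemeasurable)
    (hmeas fun i => (hZ i).aemeasurable) T hD hB
  have h3 := hq.gaussian_small_ball_le hm hqm hindZ hZ T (by rw [hvar]; positivity) hD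
  rw [hvar, Real.sqrt_sq hs.le, mul_div_cancel_left₀ _ hs.ne'] at h3
  refine h2.trans ((add_le_add_right h3 _).trans_eq ?_)
  rw [Real.mul_rpow hs.le hτ.le]
  congr 1
  have := Real.rpow_pos_of_pos hs ν
  have := Real.rpow_pos_of_pos hτ ν
  field_simp

end Main

end Universality

open MeasureTheory Set ProbabilityTheory Universality
open scoped ENNReal

theorem theorem1 (ν : ℝ) (hν : ν ∈ Set.Ioc (2 : ℝ) 3) :
    ∃ C : ℝ, 0 < C ∧
      ∀ (n m d : ℕ) (q : MvPolynomial (Fin n × Fin d) ℝ),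
        q.totalDegree ≤ m → Universality.IsMultilinear q →
      ∀ (Ω : Type*) [MeasurableSpace Ω] (μ : MeasureTheory.Measure Ω)
        [MeasureTheory.IsProbabilityMeasure μ]
        (X Z : Fin n → Ω → EuclideanSpace ℝ (Fin d)),
        -- `X₁, …, Xₙ, Z₁, …, Zₙ` are independent, the `Xᵢ` are square integrable,
        -- and `Zᵢ ∼ N(𝔼 Xᵢ, Var Xᵢ)`
        ProbabilityTheory.iIndepFun (Sum.elim X Z) μ →
        (∀ i, MeasureTheory.MemLp (X i) 2 μ) →
        (∀ i, ProbabilityTheory.HasLaw (Z i)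
          (ProbabilityTheory.multivariateGaussian
            (∫ ω, X i ω ∂μ) (Universality.covMatrix (X i) μ)) μ) →
        (0 < Universality.sd q X μ → ∀ t : ℝ,
          ENNReal.ofReal
            |Universality.standardizedCDF q X μ
                (∫ ω, Universality.evalAt q (fun i => X i ω) ∂μ) (Universality.sd q X μ) t
              - Universality.standardizedCDF q Z μ
                (∫ ω, Universality.evalAt q (fun i => X i ω) ∂μ) (Universality.sd q X μ) t|
          ≤ ENNReal.ofReal (C * m) *
            ((∑ i, Universality.influence q X Z μ ν i ^ ν) /
              ENNReal.ofReal ((1 + t ^ 2) ^ (ν / 2) * Universality.sd q X μ ^ ν))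
              ^ (1 / (ν * m + 1))) ∧
        MeasureTheory.MemLp (fun ω => Universality.evalAt q (fun i => X i ω)) 2 μ ∧
        MeasureTheory.MemLp (fun ω => Universality.evalAt q (fun i => Z i ω)) 2 μ ∧
        ∫ ω, Universality.evalAt q (fun i => X i ω) ∂μ
          = ∫ ω, Universality.evalAt q (fun i => Z i ω) ∂μ ∧
        ProbabilityTheory.variance (fun ω => Universality.evalAt q (fun i => X i ω)) μ
          = ProbabilityTheory.variance (fun ω => Universality.evalAt q (fun i => Z i ω)) μ := by
  obtain ⟨H, K, hK, hH⟩ := exists_isSmoothStep hν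
  have hν0 : 0 < ν := by linarith [hν.1]
  set A := K * (1 + (gaussianMoment ν).toReal) with hA
  have hA0 : 0 ≤ A := by positivity
  refine ⟨A + 256 * Real.exp 5, by positivity, ?_⟩
  intro n m d q hqm hq Ω _ μ _ X Z hind hX hZ
  have hindX : iIndepFun X μ := iIndepFun.precomp (g := Sum.inl) Sum.inl_injective hind
  have hindZ : iIndepFun Z μ := iIndepFun.precomp (g := Sum.inr) Sum.inr_injective hind
  have hZ2 : ∀ i, MemLp (Z i) 2 μ := fun i =>
    memLp_of_hasLaw_multivariateGaussian (hZ i) 2 (by simp)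
  obtain ⟨hmean, hvar⟩ := hq.moments_eq hindX hindZ hX hZ
  refine ⟨fun hσ t => ?_, hq.memLp_evalAt hindX hX, hq.memLp_evalAt hindZ hZ2, hmean, hvar⟩
  have hvpos : 0 < Var[fun ω => evalAt q fun i => X i ω; μ] := Real.sqrt_pos.1 hσ
  have hm : 1 ≤ m := by
    by_contra hm
    have h0 : q.totalDegree = 0 := by omega
    rw [MvPolynomial.totalDegree_eq_zero_iff_eq_C] at h0
    rw [h0] at hvpos
    simp [evalAt, variance_eq_integral aemeasurable_const] at hvpos
  have hne : Nonempty (Σ _ : Fin n, Fin d) := by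
    by_contra he
    have : IsEmpty (Fin n × Fin d) := ⟨fun p => he ⟨⟨p.1, p.2⟩⟩⟩
    exact hvpos.ne' (variance_evalAt_eq_zero_of_isEmpty q μ X)
  set σ := sd q X μ with hσdef
  set c := ∫ ω, evalAt q (fun i => X i ω) ∂μ with hc
  have hσ2 : σ ^ 2 = Var[fun ω => evalAt q fun i => Z i ω; μ] := by
    rw [← hvar]; exact Real.sq_sqrt hvpos.le
  -- Root mean square of `q(Z)` about `T = c + σ * t`: the variance `σ ^ 2` plus the squared bias
  -- `(σ * t) ^ 2`.
  set s := σ * √(1 + t ^ 2) with hs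
  have ht : 0 < 1 + t ^ 2 := by positivity
  have hs0 : 0 < s := by positivity
  have hsν : (1 + t ^ 2) ^ (ν / 2) * σ ^ ν = s ^ ν := by
    rw [hs, Real.mul_rpow hσ.le (Real.sqrt_nonneg _), Real.sqrt_eq_rpow, ← Real.rpow_mul ht.le,
      mul_comm, one_div_mul_eq_div]
  have hsνpos : 0 < s ^ ν := Real.rpow_pos_of_pos hs0 _
  have hcdf : ∀ Y : Fin n → Ω → EuclideanSpace ℝ (Fin d), standardizedCDF q Y μ c σ t
      = μ.real {ω | evalAt q (fun i => Y i ω) ≤ c + σ * t} := by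
    intro Y
    unfold standardizedCDF
    congr 1
    ext ω
    change _ / σ ≤ t ↔ _ ≤ c + σ * t
    rw [div_le_iff₀ hσ, sub_le_iff_le_add', mul_comm]
  have hsq : ∫ ω, (evalAt q (fun i => Z i ω) - (c + σ * t)) ^ 2 ∂μ = s ^ 2 := by
    have hL := hq.memLp_evalAt hindZ hZ2
    have h1 := variance_eq_sub (hL.sub (memLp_const (c + σ * t)))
    have h2 := variance_sub_const hL.aestronglyMeasurable (c + σ * t)
    have h3 : ∫ ω, (evalAt q (fun i => Z i ω) - (c + σ * t)) ∂μ = -(σ * t) := by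
      rw [integral_sub (hL.integrable (by norm_num)) (integrable_const _), ← hmean]
      simp
    simp only [Pi.pow_apply, Pi.sub_apply] at h1
    rw [h3] at h1
    have h4 : s ^ 2 = σ ^ 2 * (1 + t ^ 2) := by rw [hs, mul_pow, Real.sq_sqrt ht.le]
    have h5 := h2.symm.trans h1
    rw [← hσ2] at h5
    linarith
  rw [hcdf, hcdf, hsν]
  have hexp : 0 < 1 / (ν * m + 1) := by positivity
  have hm0 : (0 : ℝ) < m := by exact_mod_cast hm
  rcases eq_or_ne (∑ i, influence q X Z μ ν i ^ ν) ∞ with htop | hfin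
  · rw [htop, ENNReal.top_div_of_ne_top ENNReal.ofReal_ne_top, ENNReal.top_rpow_of_pos hexp,
      ENNReal.mul_top]
    · exact le_top
    · have : 0 < (A + 256 * Real.exp 5) * m := by positivity
      simpa using this
  · have key := le_mul_rpow_of_forall_le_add hm hν0 (by positivity) hA0
      (by positivity : 0 < 256 * Real.exp 5) fun τ hτ =>
      hH.abs_cdf_sub_le hK hν.1 hq hm hqm hind hindZ hX hZ (c + σ * t) hs0 hsq hfin hτ
    refine (ENNReal.ofReal_le_ofReal key).trans_eq ?_
    rw [ENNReal.ofReal_mul (by positivity), ← ENNReal.ofReal_rpow_of_nonneg (by positivity) hexp.le,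
      ENNReal.ofReal_div_of_pos hsνpos, ENNReal.ofReal_toReal hfin]
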